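/- **Setting.** A set of $n \ge 3f+2p+1$ validators, at most $f$ of them Byzantine, replicates user actors and reactive actors. Validators communicate over authenticated perfect links in the GST model: there is a delay $\delta$ with $0\le\delta\le\Delta$, where $\Delta$ is known to the protocol, such that every message sent at time $\tau$ by an honest validator (or by an honest user) is delivered to every honest validator by time $\max(\tau,\mathrm{GST})+\delta$. Local computation, and communication inside a validator, take no time. Signatures and proofs of decisions are unforgeable. Created objects are added to the owner's objects; consumed objects no longer exist. The transactions are: UA (a user actor with a sequence number, no recipient), UA-RA (from a user actor with a sequence number to a reactive actor) and RA-RA (between reactive actors). Executing a transaction on a reactive actor is a deterministic state transition which may send RA-RA transactions, create objects and spawn actors. *Users.* An honest user numbers the transactions of its user actor consecutively, never uses an object twice, uses only objects whose creation is confirmed by $f+1$ validators, and issues a UA-RA transaction only once $f+1$ validators have confirmed that its preceding transaction is executed. Byzantine users are arbitrary. A validator FP-locks at most one transaction for each user actor and sequence number. It FP-locks a correctly signed user transaction on reception when the sequence number is free; a UA-RA transaction then joins the pool of its recipient as soon as its *preconditions* hold (the preceding transaction of the user actor is executed, and the user actor owns the consumed objects). RA-RA transactions join the pool of their recipient when they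 are sent. *POA (Parallel Optimistic Agreement).* Each reactive actor $X$ has consecutive instances $k=0,1,\dots$; a validator starts the first one when $X$ comes into existence at it, and the next one when it has decided the current one. On starting, the leader of the instance broadcasts its pool for $X$ as proposal $B$. A validator in the instance that holds $B$ at most $3\Delta$ after its start, all transactions of $B$ being addressed to $X$ and all RA-RA transactions of $B$ being in its own pool, requests an FP-lock for every UA-RA transaction of $B$. A request succeeds if the signature is valid, no conflicting transaction is FP-locked and the preconditions hold within $\Delta$. When all requests are answered, and if it has not yet decided, the validator broadcasts a vote, for $B$ if all of them succeeded and for $\bot$ otherwise, together with its pool as fallback block. It decides a block upon $n-p$ votes for it, upon a valid proof that it is decided, or through the slow path. The slow path begins more than $3\Delta$ after the start with $n-f$ votes: the validator proposes to Quorum Consensus a block with at least $n-p-2f$ votes, if all its UA-RA transactions can be SP-locked, and otherwise the SP-lockable transactions found in at least $n-2f$ fallback blocks; then one Transaction Agreement per UA-RA transaction of the block decided there selects those that are kept. Upon deciding, a validator broadcasts a proof of the decision, executes the block, and does nothing more in this instance. *POB (Parallel Optimistic Broadcast, for UA transactions).* Validators vote for the UA transaction that they FP-lock, decide it upon $n-p$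 votes, a valid proof, or a decision of Transaction Agreement (to which they propose, after SP-locking, upon $n-p-2f$ votes), and broadcast a proof upon deciding. A decided UA transaction is executed when its preconditions hold. Quorum Consensus and Transaction Agreement are any primitives, with transferable certificates of decision, that satisfy Agreement and Quorum Validity: (I) a transaction contained in every proposal made by an honest validator is in the decided block (for Transaction Agreement: if all proposals made by honest validators are the same value, only it can be decided), and (II) every transaction in the decided block (every decided value) was proposed by at least $n-3f$ honest validators. **Theorem (Fast Termination of POA).** Consider an execution of this system, a reactive actor $X$, and an instance $k$ of POA for $X$ that some honest validator starts. Suppose that the leader $L$ of the instance is honest, that at most $p$ validators misbehave, that the system has reached GST (no honest validator starts the instance before GST), and that every UA-RA transaction in $L$'s pool for $X$ when $L$ starts the instance was issued by an honest user. Then $L$ starts the instance at some time $t_L$, and every honest validator $V$ starts it at some time $s_V$ and decides a block in it at some time $d_V$ with $$d_V\le t_L+2\delta\qquad\text{and}\qquad d_V\le s_V+3\delta\le s_V+3\Delta .$$ After time $d_V$ the validator $V$ sends no message of this instance, and it never enters the agreement primitives of the slow path of this instance (it proposes nothing to its Quorum Consensus and requests no Transaction Agreement for it). -/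

import Mathlib

/-! # Replicated actors: system model and protocol

Validators `Val` replicate user actors `UA` and reactive actors `RA`.  The model is a timed
transition system: local computation is instantaneous, validators exchange messages over partially
synchronous perfect links, and time may pass only when no honest validator has a protocol action
left to perform.  Maps that are initially undefined (`⊥`) are functions into `Option`. -/

namespace Mangrove

open scoped Classical

/-- Transactions.  `ua` has no recipient; `uara` goes from a user actor to a reactive actor; `rara`
goes from a reactive actor to a reactive actor and has no sequence number. -/
inductive Tx (UA RA Obj Code : Type*) where
  | ua (sender : UA) (sn : ℕ) (objs : Finset Obj) (code : Code)
  | uara (sender : UA) (sn : ℕ) (recipient : RA) (objs : Finset Obj) (pre call post : Code)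
  | rara (sender : RA) (recipient : RA) (objs : Finset Obj) (pre call post : Code)

namespace Tx

variable {UA RA Obj Code : Type*}

/-- The user actor that issued the transaction, if any. -/
def issuer : Tx UA RA Obj Code → Option UA
  | ua A _ _ _ => some A
  | uara A _ _ _ _ _ _ => some A
  | rara _ _ _ _ _ _ => none

/-- The sequence number (of a user transaction). -/
def sn : Tx UA RA Obj Code → ℕ
  | ua _ m _ _ => m
  | uara _ m _ _ _ _ _ => m
  | rara _ _ _ _ _ _ => 0

/-- The consumed objects. -/
def objs : Tx UA RA Obj Code → Finset Obj
  | ua _ _ os _ => os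
  | uara _ _ _ os _ _ _ => os
  | rara _ _ os _ _ _ => os

def recipient : Tx UA RA Obj Code → Option RA
  | ua _ _ _ _ => none
  | uara _ _ X _ _ _ _ => some X
  | rara _ X _ _ _ _ => some X

def IsUA (A : UA) (tx : Tx UA RA Obj Code) : Prop :=
  tx.issuer = some A ∧ tx.recipient = none

def IsUARA (A : UA) (tx : Tx UA RA Obj Code) : Prop :=
  tx.issuer = some A ∧ tx.recipient ≠ none

def IsRARA (tx : Tx UA RA Obj Code) : Prop :=
  tx.issuer = none

end Tx

/-- A block is a finite set of transactions. -/
abbrev Block (UA RA Obj Code : Type*) := Finset (Tx UA RA Obj Code)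

/-- A transaction that a reactive actor wants to send. -/
structure Outgoing (RA Obj Code : Type*) where
  recipient : RA
  objs : Finset Obj
  pre : Code
  call : Code
  post : Code

/-- The effects of executing a transaction on a reactive actor: its new state, the objects it
receives, the transactions it wants to send, the objects created at user actors, and the newly
spawned reactive actors. -/
structure Outcome (UA RA Obj Code State : Type*) where
  state : State
  received : Finset Obj
  outgoing : List (Outgoing RA Obj Code)
  created : Finset (UA × Obj)
  spawned : Finset RA

/-- The public parameters: the resilience parameters `f` and `p`, the timing parameter `Δ`, the
leader oracle, the deterministic semantics of code (arbitrary), a deterministic order on the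
transactions of a block, and the genesis state. -/
structure Params (Val UA RA Obj Code State : Type*) where
  f : ℕ
  p : ℕ
  Δ : ℝ
  leader : RA → ℕ → Val
  /-- Effects of a transaction executed on a reactive actor in a given state
  (pre-processing, call and post-processing together). -/
  exec : RA → State → Tx UA RA Obj Code → Outcome UA RA Obj Code State
  /-- Objects created at user actors by a UA transaction, and reactive actors spawned by it. -/
  execUA : Tx UA RA Obj Code → Finset (UA × Obj) × Finset RA
  order : Block UA RA Obj Code → List (Tx UA RA Obj Code)
  mem_order : ∀ B tx, tx ∈ order B ↔ tx ∈ B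
  genesisRA : Finset RA
  genesisObjs : Set (UA × Obj)
  initState : RA → State
  initObjs : RA → Finset Obj

/-- Messages between validators. The fast vote `none` is the negative vote `⊥`. -/
inductive Msg (UA RA Obj Code : Type*) where
  /-- the leader's proposal in instance `k` of POA for `X` -/
  | propose (X : RA) (k : ℕ) (B : Block UA RA Obj Code)
  /-- a vote together with the voter's fallback block -/
  | vote (X : RA) (k : ℕ) (v : Option (Block UA RA Obj Code)) (fallback : Block UA RA Obj Code)
  /-- a proof that `B` is decided in instance `k` of POA for `X` -/
  | proof (X : RA) (k : ℕ) (B : Block UA RA Obj Code)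
  /-- a vote in instance `sn` of POB for `A` -/
  | pobVote (A : UA) (sn : ℕ) (v : Option (Tx UA RA Obj Code))
  /-- a proof that `tx` is decided in instance `sn` of POB for `A` -/
  | pobProof (A : UA) (sn : ℕ) (tx : Tx UA RA Obj Code)

/-- The message belongs to instance `k` of POA for `X`. -/
def Msg.OfInstance {UA RA Obj Code : Type*} (X : RA) (k : ℕ) : Msg UA RA Obj Code → Prop
  | .propose Y m _ => Y = X ∧ m = k
  | .vote Y m _ _ => Y = X ∧ m = k
  | .proof Y m _ => Y = X ∧ m = k
  | .pobVote _ _ _ => False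
  | .pobProof _ _ _ => False

/-- State of an entity `V.X` of a validator `V` at a reactive actor `X`. -/
structure RAState (UA RA Obj Code State : Type*) where
  state : State
  owned : Finset Obj
  pool : Finset (Tx UA RA Obj Code)
  /-- the executed transactions -/
  done : Finset (Tx UA RA Obj Code)
  /-- the time at which an instance of POA was started -/
  start : ℕ → Option ℝ
  /-- the block decided in an instance of POA, and when -/
  decided : ℕ → Option (Block UA RA Obj Code × ℝ)
  /-- the leader's block for which FP-locks were requested, and when -/
  fp : ℕ → Option (Block UA RA Obj Code × ℝ)
  fpReply : ℕ → Tx UA RA Obj Code → Option Bool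
  voted : Set ℕ
  /-- the first slow-path candidate -/
  cand : ℕ → Option (Block UA RA Obj Code)
  spReply : ℕ → Tx UA RA Obj Code → Option Bool
  needFallback : Set ℕ
  /-- the second slow-path candidate, made from fallback blocks -/
  cand₂ : ℕ → Option (Block UA RA Obj Code)
  spReply₂ : ℕ → Tx UA RA Obj Code → Option Bool
  /-- the block decided in Quorum Consensus -/
  qcDecided : ℕ → Option (Block UA RA Obj Code)
  /-- the instances and transactions for which Transaction Agreement was requested -/
  taAsked : Set (ℕ × Tx UA RA Obj Code)

/-- State of a validator: the data of its user actor entities `V.A` and of its reactive actor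
entities `V.X`. -/
structure Local (UA RA Obj Code State : Type*) where
  fpLock : UA → ℕ → Option (Tx UA RA Obj Code)
  spLock : UA → ℕ → Option (Tx UA RA Obj Code)
  /-- the sequence numbers executed at each user actor -/
  executed : Set (UA × ℕ)
  /-- the objects created so far at user actors -/
  created : Set (UA × Obj)
  /-- the objects consumed so far at user actors; a consumed object no longer exists -/
  consumed : Set (UA × Obj)
  /-- UA-RA transactions locked on reception that are not yet forwarded to their recipient -/
  waiting : Set (Tx UA RA Obj Code)
  /-- UA-RA transactions executed on their recipient, with the objects they created, whose effects
  are not yet applied at the user actors -/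
  effects : Set (Tx UA RA Obj Code × Finset (UA × Obj))
  pobDecided : UA → ℕ → Option (Tx UA RA Obj Code)
  taDecided : UA → ℕ → Option (Tx UA RA Obj Code)
  /-- the reactive actors that exist -/
  active : Set RA
  ra : RA → RAState UA RA Obj Code State

/-- A global configuration. -/
structure Config (Val UA RA Obj Code State : Type*) where
  now : ℝ
  loc : Val → Local UA RA Obj Code State
  /-- `(V, m, τ)`: validator `V` broadcast `m` to all validators at time `τ` -/
  sent : Set (Val × Msg UA RA Obj Code × ℝ)
  /-- `(U, m) ∈ inbox V`: the message `m` from `U` was delivered to `V` -/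
  inbox : Val → Set (Val × Msg UA RA Obj Code)
  /-- `(tx, τ)`: an honest user signed `tx` and broadcast it to all validators at time `τ` -/
  emitted : Set (Tx UA RA Obj Code × ℝ)
  /-- the next sequence number of each user actor -/
  nextSn : UA → ℕ
  /-- the user transactions delivered to each validator -/
  txInbox : Val → Set (Tx UA RA Obj Code)
  /-- proposals of honest validators to Quorum Consensus -/
  qcProposed : Set (Val × RA × ℕ × Block UA RA Obj Code)
  /-- proposals of honest validators to Transaction Agreement -/
  taProposed : Set (Val × UA × ℕ × Tx UA RA Obj Code)
  /-- decisions (with a transferable certificate) of Quorum Consensus -/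
  qcCert : Set (RA × ℕ × Block UA RA Obj Code)
  /-- decisions (with a transferable certificate) of Transaction Agreement -/
  taCert : Set (UA × ℕ × Tx UA RA Obj Code)

/-- The environment: which validators and which users (identified with the user actors that they
control) are honest, the global stabilization time, and the actual message delay `δ` after it. -/
structure Scenario (Val UA : Type*) where
  honest : Set Val
  honestUser : Set UA
  GST : ℝ
  δ : ℝ

section Model

variable {Val UA RA Obj Code State : Type*}

/-- Update a map of two arguments at one place. -/
noncomputable def upd₂ {α β γ : Type*} (g : α → β → γ) (a : α) (b : β) (v : γ) : α → β → γ :=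
  Function.update g a (Function.update (g a) b v)

/-! ### Execution of transactions -/

namespace Local

/-- The objects currently owned by user actor `A`. -/
def ownedBy (s : Local UA RA Obj Code State) (A : UA) : Set Obj :=
  {o | (A, o) ∈ s.created ∧ (A, o) ∉ s.consumed}

/-- `executed[sn - 1]`; there is nothing to wait for before the first transaction. -/
def prevExecuted (s : Local UA RA Obj Code State) (A : UA) (sn : ℕ) : Prop :=
  sn = 0 ∨ (A, sn - 1) ∈ s.executed

/-- The execution preconditions of a transaction of user actor `A`. -/
def Ready (s : Local UA RA Obj Code State) (A : UA) (tx : Tx UA RA Obj Code) : Prop :=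
  s.prevExecuted A tx.sn ∧ (tx.objs : Set Obj) ⊆ s.ownedBy A

noncomputable def updRA (s : Local UA RA Obj Code State) (X : RA)
    (g : RAState UA RA Obj Code State → RAState UA RA Obj Code State) :
    Local UA RA Obj Code State :=
  { s with ra := Function.update s.ra X (g (s.ra X)) }

noncomputable def setFP (s : Local UA RA Obj Code State) (A : UA) (tx : Tx UA RA Obj Code) :
    Local UA RA Obj Code State :=
  { s with fpLock := upd₂ s.fpLock A tx.sn (some tx) }

/-- SP-lock `tx` unless some transaction with this sequence number is already SP-locked. -/
noncomputable def trySP (s : Local UA RA Obj Code State) (A : UA) (tx : Tx UA RA Obj Code) :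
    Local UA RA Obj Code State :=
  if s.spLock A tx.sn = none then
    { s with spLock := upd₂ s.spLock A tx.sn (some tx) }
  else s

/-- Deliver a transaction over inner links to the entity of its recipient. -/
noncomputable def addPool (s : Local UA RA Obj Code State) (tx : Tx UA RA Obj Code) :
    Local UA RA Obj Code State :=
  match tx.recipient with
  | none => s
  | some X => s.updRA X fun r => if tx ∈ r.done then r else { r with pool := insert tx r.pool }

end Local

/-- The transactions that reactive actor `X` manages to send when it owns `os`, and the objects
left: a transaction that consumes objects `X` does not own is dropped. -/
noncomputable def sendAll (X : RA) :
    Finset Obj → List (Outgoing RA Obj Code) → Finset Obj × List (Tx UA RA Obj Code)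
  | os, [] => (os, [])
  | os, t :: ts =>
    if t.objs ⊆ os then
      ((sendAll X (os \ t.objs) ts).1,
        Tx.rara X t.recipient t.objs t.pre t.call t.post :: (sendAll X (os \ t.objs) ts).2)
    else sendAll X os ts

/-- A validator executes `tx` on the reactive actor `X` (at most once). -/
noncomputable def execTx (P : Params Val UA RA Obj Code State) (X : RA)
    (s : Local UA RA Obj Code State) (tx : Tx UA RA Obj Code) : Local UA RA Obj Code State :=
  if tx ∈ (s.ra X).done then s else
    let out := P.exec X (s.ra X).state tx
    let res : Finset Obj × List (Tx UA RA Obj Code) :=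
      sendAll X ((s.ra X).owned ∪ out.received) out.outgoing
    let s₁ := s.updRA X fun r =>
      { r with state := out.state, owned := res.1, done := insert tx r.done }
    let s₂ := res.2.foldl Local.addPool s₁
    let s₃ : Local UA RA Obj Code State := { s₂ with active := s₂.active ∪ ↑out.spawned }
    match tx with
    | .ua _ _ _ _ => s₃
    | .uara _ _ _ _ _ _ _ => { s₃ with effects := insert (tx, out.created) s₃.effects }
    | .rara _ _ _ _ _ _ => { s₃ with created := s₃.created ∪ ↑out.created }

/-- The effect at a validator of deciding block `B` at time `t` in instance `k` of POA for `X`. -/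
noncomputable def applyDecision (P : Params Val UA RA Obj Code State) (X : RA) (k : ℕ)
    (B : Block UA RA Obj Code) (t : ℝ) (s : Local UA RA Obj Code State) :
    Local UA RA Obj Code State :=
  ((P.order B).foldl (execTx P X)
      (s.updRA X fun r => { r with decided := Function.update r.decided k (some (B, t)) })).updRA X
    fun r => { r with pool := r.pool \ B }

/-! ### Network, signatures and certificates -/

namespace Config

noncomputable def setLoc (c : Config Val UA RA Obj Code State) (V : Val)
    (s : Local UA RA Obj Code State) : Config Val UA RA Obj Code State :=
  { c with loc := Function.update c.loc V s }

noncomputable def updRA (c : Config Val UA RA Obj Code State) (V : Val) (X : RA)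
    (g : RAState UA RA Obj Code State → RAState UA RA Obj Code State) :
    Config Val UA RA Obj Code State :=
  c.setLoc V ((c.loc V).updRA X g)

/-- Validator `V` broadcasts `m` to all validators (itself included). -/
def bcast (c : Config Val UA RA Obj Code State) (V : Val) (m : Msg UA RA Obj Code) :
    Config Val UA RA Obj Code State :=
  { c with sent := insert (V, m, c.now) c.sent }

/-- Signature verification: signatures of honest users cannot be forged. -/
def Verify (c : Config Val UA RA Obj Code State) (E : Scenario Val UA)
    (tx : Tx UA RA Obj Code) : Prop :=
  ∀ A, tx.issuer = some A → A ∈ E.honestUser → ∃ τ, (tx, τ) ∈ c.emitted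

/-- The validators from which `V` has received a vote in instance `k` of POA for `X`. -/
def voters (c : Config Val UA RA Obj Code State) (V : Val) (X : RA) (k : ℕ) : Set Val :=
  {U | ∃ v fb, (U, Msg.vote X k v fb) ∈ c.inbox V}

/-- The validators from which `V` has received a vote for `B`. -/
def votersFor (c : Config Val UA RA Obj Code State) (V : Val) (X : RA) (k : ℕ)
    (B : Block UA RA Obj Code) : Set Val :=
  {U | ∃ fb, (U, Msg.vote X k (some B) fb) ∈ c.inbox V}

/-- The validators from which `V` has received a fallback block containing `tx`. -/
def fallbacksWith (c : Config Val UA RA Obj Code State) (V : Val) (X : RA) (k : ℕ)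
    (tx : Tx UA RA Obj Code) : Set Val :=
  {U | ∃ v fb, (U, Msg.vote X k v fb) ∈ c.inbox V ∧ tx ∈ fb}

/-- The validators from which `V` has received a POB vote for `tx`. -/
def pobVotersFor (c : Config Val UA RA Obj Code State) (V : Val) (A : UA)
    (tx : Tx UA RA Obj Code) : Set Val :=
  {U | (U, Msg.pobVote A tx.sn (some tx)) ∈ c.inbox V}

/-- `n - p` signed votes for `B` exist; honest validators sign only the votes they send. -/
def FastCert (c : Config Val UA RA Obj Code State) (E : Scenario Val UA)
    (P : Params Val UA RA Obj Code State) (X : RA) (k : ℕ) (B : Block UA RA Obj Code) : Prop :=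
  ∃ S : Set Val, Nat.card Val ≤ S.ncard + P.p ∧
    ∀ U ∈ S, U ∈ E.honest → ∃ fb τ, (U, Msg.vote X k (some B) fb, τ) ∈ c.sent

/-- The decisions of Quorum Consensus and of the Transaction Agreements yield `B`. -/
def SlowCert (c : Config Val UA RA Obj Code State) (X : RA) (k : ℕ)
    (B : Block UA RA Obj Code) : Prop :=
  ∃ Bqc : Block UA RA Obj Code, (X, k, Bqc) ∈ c.qcCert ∧
    (∀ tx ∈ Bqc, ∀ A, tx.IsUARA A → ∃ w, (A, tx.sn, w) ∈ c.taCert) ∧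
    B = Bqc.filter fun tx => ∀ A, tx.IsUARA A → (A, tx.sn, tx) ∈ c.taCert

/-- A valid proof of the POA decision `B` can be produced. -/
def ValidProof (c : Config Val UA RA Obj Code State) (E : Scenario Val UA)
    (P : Params Val UA RA Obj Code State) (X : RA) (k : ℕ) (B : Block UA RA Obj Code) : Prop :=
  c.FastCert E P X k B ∨ c.SlowCert X k B

/-- A valid proof of the POB decision `tx` can be produced. -/
def ValidPobProof (c : Config Val UA RA Obj Code State) (E : Scenario Val UA)
    (P : Params Val UA RA Obj Code State) (A : UA) (sn : ℕ) (tx : Tx UA RA Obj Code) : Prop :=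
  (∃ S : Set Val, Nat.card Val ≤ S.ncard + P.p ∧
    ∀ U ∈ S, U ∈ E.honest → ∃ τ, (U, Msg.pobVote A sn (some tx), τ) ∈ c.sent) ∨
  (A, sn, tx) ∈ c.taCert

/-- `V` is currently in instance `k` of POA for `X`. -/
def InInstance (c : Config Val UA RA Obj Code State) (V : Val) (X : RA) (k : ℕ) : Prop :=
  ((c.loc V).ra X).start k ≠ none ∧ ((c.loc V).ra X).decided k = none

/-- `V`'s timer in instance `k` of POA for `X` shows more than `3Δ`. -/
def TimerExpired (c : Config Val UA RA Obj Code State) (P : Params Val UA RA Obj Code State)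
    (V : Val) (X : RA) (k : ℕ) : Prop :=
  ∃ t, ((c.loc V).ra X).start k = some t ∧ t + 3 * P.Δ < c.now

/-- A user has evidence for a local fact at validators: `f + 1` validators claim it, and honest
validators report only what holds at them. -/
def Vouched (c : Config Val UA RA Obj Code State) (E : Scenario Val UA)
    (P : Params Val UA RA Obj Code State) (Q : Local UA RA Obj Code State → Prop) : Prop :=
  ∃ R : Set Val, P.f + 1 ≤ R.ncard ∧ ∀ V ∈ R, V ∈ E.honest → Q (c.loc V)

end Config

/-- Grounds on which `V` may decide `B` in instance `k` of POA for `X`: `n - p` votes, a valid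
proof, or completion of the slow path. -/
def CanDecide (P : Params Val UA RA Obj Code State) (E : Scenario Val UA)
    (c : Config Val UA RA Obj Code State) (V : Val) (X : RA) (k : ℕ)
    (B : Block UA RA Obj Code) : Prop :=
  Nat.card Val ≤ (c.votersFor V X k B).ncard + P.p ∨
  ((∃ U, (U, Msg.proof X k B) ∈ c.inbox V) ∧ c.ValidProof E P X k B) ∨
  (∃ Bqc, ((c.loc V).ra X).qcDecided k = some Bqc ∧
    (∀ tx ∈ Bqc, ∀ A, tx.IsUARA A → (c.loc V).taDecided A tx.sn ≠ none) ∧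
    B = Bqc.filter fun tx => ∀ A, tx.IsUARA A → (c.loc V).taDecided A tx.sn = some tx)

/-- Grounds on which `V` may decide `tx` in instance `tx.sn` of POB for `A`. -/
def CanPobDecide (P : Params Val UA RA Obj Code State) (E : Scenario Val UA)
    (c : Config Val UA RA Obj Code State) (V : Val) (A : UA) (tx : Tx UA RA Obj Code) : Prop :=
  Nat.card Val ≤ (c.pobVotersFor V A tx).ncard + P.p ∨
  ((∃ U, (U, Msg.pobProof A tx.sn tx) ∈ c.inbox V) ∧ c.ValidPobProof E P A tx.sn tx) ∨
  (c.loc V).taDecided A tx.sn = some tx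

/-! ### The protocol -/

/-- `Act P E V c c'`: honest validator `V` performs one protocol action, leading from `c` to `c'`.
Each action is performed as soon as it is enabled, and performing it disables it. -/
inductive Act (P : Params Val UA RA Obj Code State) (E : Scenario Val UA) (V : Val)
    (c : Config Val UA RA Obj Code State) : Config Val UA RA Obj Code State → Prop where
  /-- Start instance `k`; the leader broadcasts its pool as its proposal. -/
  | initiate (X : RA) (k : ℕ)
      (hact : X ∈ (c.loc V).active)
      (hnew : ((c.loc V).ra X).start k = none)
      (hprev : k = 0 ∨ ((c.loc V).ra X).decided (k - 1) ≠ none) :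
      Act P E V c
        (let c₁ := c.updRA V X fun r => { r with start := Function.update r.start k (some c.now) }
         if P.leader X k = V then c₁.bcast V (.propose X k ((c.loc V).ra X).pool) else c₁)
  /-- Accept the leader's proposal and request FP-locks. -/
  | fpBegin (X : RA) (k : ℕ) (B : Block UA RA Obj Code)
      (hin : c.InInstance V X k)
      (htime : ¬ c.TimerExpired P V X k)
      (hnew : ((c.loc V).ra X).fp k = none)
      (hprop : (P.leader X k, Msg.propose X k B) ∈ c.inbox V)
      (haddr : ∀ tx ∈ B, tx.recipient = some X)
      (hrara : ∀ tx ∈ B, tx.IsRARA → tx ∈ ((c.loc V).ra X).pool) :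
      Act P E V c
        (c.updRA V X fun r => { r with fp := Function.update r.fp k (some (B, c.now)) })
  /-- `V.A` FP-locks a requested transaction if its sequence number is not FP-locked. -/
  | fpLock (X : RA) (k : ℕ) (B : Block UA RA Obj Code) (t : ℝ) (A : UA) (tx : Tx UA RA Obj Code)
      (hfp : ((c.loc V).ra X).fp k = some (B, t))
      (htx : tx ∈ B) (hA : tx.IsUARA A)
      (hrep : ((c.loc V).ra X).fpReply k tx = none)
      (hver : c.Verify E tx)
      (hfree : (c.loc V).fpLock A tx.sn = none) :
      Act P E V c (c.setLoc V ((c.loc V).setFP A tx))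
  /-- `V.A` confirms an FP-lock if within `Δ` time the execution preconditions are met. -/
  | fpSuccess (X : RA) (k : ℕ) (B : Block UA RA Obj Code) (t : ℝ) (A : UA)
      (tx : Tx UA RA Obj Code)
      (hfp : ((c.loc V).ra X).fp k = some (B, t))
      (htx : tx ∈ B) (hA : tx.IsUARA A)
      (hrep : ((c.loc V).ra X).fpReply k tx = none)
      (hver : c.Verify E tx)
      (hlock : (c.loc V).fpLock A tx.sn = some tx)
      (hready : (c.loc V).Ready A tx) (htime : c.now ≤ t + P.Δ) :
      Act P E V c (c.updRA V X fun r =>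
        { r with fpReply := upd₂ r.fpReply k tx (some true) })
  /-- `V.A` refuses an FP-lock: bad signature, a conflicting lock, or `Δ` time has passed. -/
  | fpFail (X : RA) (k : ℕ) (B : Block UA RA Obj Code) (t : ℝ) (A : UA) (tx : Tx UA RA Obj Code)
      (hfp : ((c.loc V).ra X).fp k = some (B, t))
      (htx : tx ∈ B) (hA : tx.IsUARA A)
      (hrep : ((c.loc V).ra X).fpReply k tx = none)
      (hbad : ¬ c.Verify E tx ∨
        (∃ tx', (c.loc V).fpLock A tx.sn = some tx' ∧ tx' ≠ tx) ∨
        ((c.loc V).fpLock A tx.sn = some tx ∧ t + P.Δ < c.now)) :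
      Act P E V c (c.updRA V X fun r =>
        { r with fpReply := upd₂ r.fpReply k tx (some false) })
  /-- When all FP-lock replies have arrived, broadcast a vote and a fallback block. -/
  | vote (X : RA) (k : ℕ) (B : Block UA RA Obj Code) (t : ℝ)
      (hin : c.InInstance V X k)
      (hfp : ((c.loc V).ra X).fp k = some (B, t))
      (hrep : ∀ tx ∈ B, ∀ A, tx.IsUARA A → ((c.loc V).ra X).fpReply k tx ≠ none)
      (hnew : k ∉ ((c.loc V).ra X).voted) :
      Act P E V c
        ((c.updRA V X fun r => { r with voted := insert k r.voted }).bcast V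
          (.vote X k
            (if ∀ tx ∈ B, ∀ A, tx.IsUARA A → ((c.loc V).ra X).fpReply k tx = some true
              then some B else none)
            ((c.loc V).ra X).pool))
  /-- Decide, broadcast a proof of the decision, and execute the decided block. -/
  | decide (X : RA) (k : ℕ) (B : Block UA RA Obj Code)
      (hin : c.InInstance V X k)
      (hdec : CanDecide P E c V X k B) :
      Act P E V c
        ((c.setLoc V (applyDecision P X k B c.now (c.loc V))).bcast V (.proof X k B))
  /-- Slow path: some block has at least `n - p - 2f` votes; request SP-locks for it. -/
  | slowCandidate (X : RA) (k : ℕ) (B : Block UA RA Obj Code)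
      (hin : c.InInstance V X k) (htime : c.TimerExpired P V X k)
      (hvotes : Nat.card Val ≤ (c.voters V X k).ncard + P.f)
      (hnew : ((c.loc V).ra X).cand k = none) (hnew' : k ∉ ((c.loc V).ra X).needFallback)
      (hB : Nat.card Val ≤ (c.votersFor V X k B).ncard + P.p + 2 * P.f) :
      Act P E V c (c.updRA V X fun r => { r with cand := Function.update r.cand k (some B) })
  /-- Slow path: no block has `n - p - 2f` votes. -/
  | slowNoCandidate (X : RA) (k : ℕ)
      (hin : c.InInstance V X k) (htime : c.TimerExpired P V X k)
      (hvotes : Nat.card Val ≤ (c.voters V X k).ncard + P.f)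
      (hnew : ((c.loc V).ra X).cand k = none) (hnew' : k ∉ ((c.loc V).ra X).needFallback)
      (hB : ∀ B, ¬ Nat.card Val ≤ (c.votersFor V X k B).ncard + P.p + 2 * P.f) :
      Act P E V c (c.updRA V X fun r => { r with needFallback := insert k r.needFallback })
  /-- `V.A` handles an SP-lock request for the first candidate. -/
  | spLock (X : RA) (k : ℕ) (B : Block UA RA Obj Code) (A : UA) (tx : Tx UA RA Obj Code)
      (hc : ((c.loc V).ra X).cand k = some B) (htx : tx ∈ B) (hA : tx.IsUARA A)
      (hrep : ((c.loc V).ra X).spReply k tx = none) :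
      Act P E V c (c.setLoc V
        (let s := (c.loc V).trySP A tx
         s.updRA X fun r =>
          { r with spReply := upd₂ r.spReply k tx (some (decide (s.spLock A tx.sn = some tx))) }))
  /-- All SP-locks of the first candidate succeeded: propose it to Quorum Consensus. -/
  | spPropose (X : RA) (k : ℕ) (B : Block UA RA Obj Code)
      (hin : c.InInstance V X k)
      (hc : ((c.loc V).ra X).cand k = some B)
      (hrep : ∀ tx ∈ B, ∀ A, tx.IsUARA A → ((c.loc V).ra X).spReply k tx = some true)
      (hnew : (V, X, k, B) ∉ c.qcProposed) :
      Act P E V c { c with qcProposed := insert (V, X, k, B) c.qcProposed }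
  /-- Some SP-lock of the first candidate failed: fall back. -/
  | spFail (X : RA) (k : ℕ) (B : Block UA RA Obj Code)
      (hin : c.InInstance V X k)
      (hc : ((c.loc V).ra X).cand k = some B)
      (hrep : ∀ tx ∈ B, ∀ A, tx.IsUARA A → ((c.loc V).ra X).spReply k tx ≠ none)
      (hfail : ∃ tx ∈ B, ∃ A, tx.IsUARA A ∧ ((c.loc V).ra X).spReply k tx = some false)
      (hnew : k ∉ ((c.loc V).ra X).needFallback) :
      Act P E V c (c.updRA V X fun r => { r with needFallback := insert k r.needFallback })
  /-- Form the second candidate from the transactions in at least `n - 2f` fallback blocks. -/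
  | fbBegin (X : RA) (k : ℕ) (C : Block UA RA Obj Code)
      (hin : c.InInstance V X k)
      (hneed : k ∈ ((c.loc V).ra X).needFallback)
      (hnew : ((c.loc V).ra X).cand₂ k = none)
      (hC : ∀ tx, tx ∈ C ↔ Nat.card Val ≤ (c.fallbacksWith V X k tx).ncard + 2 * P.f) :
      Act P E V c (c.updRA V X fun r => { r with cand₂ := Function.update r.cand₂ k (some C) })
  /-- `V.A` handles an SP-lock request for the second candidate. -/
  | fbLock (X : RA) (k : ℕ) (C : Block UA RA Obj Code) (A : UA) (tx : Tx UA RA Obj Code)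
      (hc : ((c.loc V).ra X).cand₂ k = some C) (htx : tx ∈ C) (hA : tx.IsUARA A)
      (hrep : ((c.loc V).ra X).spReply₂ k tx = none) :
      Act P E V c (c.setLoc V
        (let s := (c.loc V).trySP A tx
         s.updRA X fun r =>
          { r with spReply₂ := upd₂ r.spReply₂ k tx (some (decide (s.spLock A tx.sn = some tx))) }))
  /-- Propose to Quorum Consensus the second candidate without the transactions that failed to
  SP-lock. -/
  | fbPropose (X : RA) (k : ℕ) (C : Block UA RA Obj Code)
      (hin : c.InInstance V X k)
      (hc : ((c.loc V).ra X).cand₂ k = some C)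
      (hrep : ∀ tx ∈ C, ∀ A, tx.IsUARA A → ((c.loc V).ra X).spReply₂ k tx ≠ none)
      (hnew : ∀ B, (V, X, k, B) ∉ c.qcProposed) :
      Act P E V c
        (let D := C.filter fun tx => ∀ A, tx.IsUARA A →
          ((c.loc V).ra X).spReply₂ k tx = some true
         { c with qcProposed := insert (V, X, k, D) c.qcProposed })
  /-- After a decision of Quorum Consensus, `V.A` tries to SP-lock each decided UA-RA transaction
  and proposes the SP-locked one to Transaction Agreement. -/
  | taPropose (X : RA) (k : ℕ) (B : Block UA RA Obj Code) (A : UA) (tx w : Tx UA RA Obj Code)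
      (hin : c.InInstance V X k)
      (hqc : ((c.loc V).ra X).qcDecided k = some B) (htx : tx ∈ B) (hA : tx.IsUARA A)
      (hnew : (k, tx) ∉ ((c.loc V).ra X).taAsked)
      (hw : ((c.loc V).trySP A tx).spLock A tx.sn = some w) :
      Act P E V c
        { c.setLoc V (((c.loc V).trySP A tx).updRA X fun r =>
            { r with taAsked := insert (k, tx) r.taAsked }) with
          taProposed := insert (V, A, tx.sn, w) c.taProposed }
  /-- Forward a waiting UA-RA transaction to the entity of its recipient. -/
  | forward (A : UA) (tx : Tx UA RA Obj Code)
      (hA : tx.IsUARA A) (hw : tx ∈ (c.loc V).waiting) (hready : (c.loc V).Ready A tx) :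
      Act P E V c (c.setLoc V
        (({ c.loc V with waiting := (c.loc V).waiting \ {tx} } :
          Local UA RA Obj Code State).addPool tx))
  /-- Apply at the user actors the effects of a UA-RA transaction executed on its recipient. -/
  | finish (A : UA) (tx : Tx UA RA Obj Code) (cr : Finset (UA × Obj))
      (hA : tx.IsUARA A) (he : (tx, cr) ∈ (c.loc V).effects)
      (hnew : (A, tx.sn) ∉ (c.loc V).executed) (hready : (c.loc V).Ready A tx) :
      Act P E V c (c.setLoc V
        { c.loc V with
          executed := insert (A, tx.sn) (c.loc V).executed
          consumed := (c.loc V).consumed ∪ {q | q.1 = A ∧ q.2 ∈ tx.objs}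
          created := (c.loc V).created ∪ ↑cr })
  /-- POB: decide and broadcast a proof of the decision. -/
  | pobDecide (A : UA) (tx : Tx UA RA Obj Code)
      (hnew : (c.loc V).pobDecided A tx.sn = none)
      (hdec : CanPobDecide P E c V A tx) :
      Act P E V c
        ((c.setLoc V { c.loc V with
            pobDecided := upd₂ (c.loc V).pobDecided A tx.sn (some tx) }).bcast V
          (.pobProof A tx.sn tx))
  /-- POB slow path: upon `n - p - 2f` votes, SP-lock and propose to Transaction Agreement. -/
  | pobPropose (A : UA) (tx : Tx UA RA Obj Code)
      (hvotes : Nat.card Val ≤ (c.pobVotersFor V A tx).ncard + P.p + 2 * P.f)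
      (hlock : (c.loc V).spLock A tx.sn = none ∨ (c.loc V).spLock A tx.sn = some tx)
      (hnew : (V, A, tx.sn, tx) ∉ c.taProposed) :
      Act P E V c
        { c.setLoc V ((c.loc V).trySP A tx) with
          taProposed := insert (V, A, tx.sn, tx) c.taProposed }
  /-- Execute a UA transaction decided in POB. -/
  | execUA (A : UA) (tx : Tx UA RA Obj Code)
      (hA : tx.IsUA A) (hdec : (c.loc V).pobDecided A tx.sn = some tx) (hver : c.Verify E tx)
      (hnew : (A, tx.sn) ∉ (c.loc V).executed) (hready : (c.loc V).Ready A tx) :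
      Act P E V c (c.setLoc V
        { c.loc V with
          executed := insert (A, tx.sn) (c.loc V).executed
          consumed := (c.loc V).consumed ∪ {q | q.1 = A ∧ q.2 ∈ tx.objs}
          created := (c.loc V).created ∪ ↑(P.execUA tx).1
          active := (c.loc V).active ∪ ↑(P.execUA tx).2 })

/-- A validator `V` handles a delivered user transaction `tx` of user actor `A`: it FP-locks `tx`
if possible; a UA-RA transaction then waits to be forwarded to its recipient, and for a UA
transaction a POB vote is broadcast. -/
noncomputable def receiveTx (c : Config Val UA RA Obj Code State) (V : Val) (A : UA)
    (tx : Tx UA RA Obj Code) : Config Val UA RA Obj Code State :=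
  let s := c.loc V
  let c₁ : Config Val UA RA Obj Code State :=
    { c with txInbox := Function.update c.txInbox V (insert tx (c.txInbox V)) }
  if tx.recipient = none then
    if s.fpLock A tx.sn = none ∨ s.fpLock A tx.sn = some tx then
      (c₁.setLoc V (s.setFP A tx)).bcast V (.pobVote A tx.sn (some tx))
    else c₁.bcast V (.pobVote A tx.sn none)
  else
    if s.fpLock A tx.sn = none then
      c₁.setLoc V { s.setFP A tx with waiting := insert tx s.waiting }
    else c₁

/-- Steps of the environment: honest users, message delivery, and the outputs of the two
black-box agreement primitives.  Byzantine validators may send anything to anyone at any time, and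
so may Byzantine users. -/
inductive Env (P : Params Val UA RA Obj Code State) (E : Scenario Val UA)
    (c : Config Val UA RA Obj Code State) : Config Val UA RA Obj Code State → Prop where
  /-- An honest user signs and broadcasts a transaction with the next sequence number.  It uses
  only objects that it owns as far as it can tell, never the same object twice, and it issues a
  UA-RA transaction only when it knows the previous one to be executed. -/
  | emit (A : UA) (tx : Tx UA RA Obj Code)
      (hA : A ∈ E.honestUser) (htx : tx.issuer = some A) (hsn : tx.sn = c.nextSn A)
      (hobj : ∀ o ∈ tx.objs, c.Vouched E P fun s => (A, o) ∈ s.created)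
      (hfresh : ∀ tx' τ, (tx', τ) ∈ c.emitted → tx'.issuer = some A → Disjoint tx'.objs tx.objs)
      (hprev : tx.IsUARA A → tx.sn = 0 ∨ c.Vouched E P fun s => (A, tx.sn - 1) ∈ s.executed) :
      Env P E c { c with
        emitted := insert (tx, c.now) c.emitted
        nextSn := Function.update c.nextSn A (c.nextSn A + 1) }
  /-- Delivery of a message between validators. -/
  | deliver (U V : Val) (m : Msg UA RA Obj Code)
      (hm : U ∈ E.honest → ∃ τ, (U, m, τ) ∈ c.sent) :
      Env P E c { c with inbox := Function.update c.inbox V (insert (U, m) (c.inbox V)) }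
  /-- Delivery of a correctly signed user transaction to an honest validator. -/
  | deliverTx (V : Val) (A : UA) (tx : Tx UA RA Obj Code)
      (hV : V ∈ E.honest) (hA : tx.issuer = some A) (hver : c.Verify E tx)
      (hnew : tx ∉ c.txInbox V) :
      Env P E c (receiveTx c V A tx)
  /-- Quorum Consensus reaches a decision. -/
  | qcCertify (X : RA) (k : ℕ) (B : Block UA RA Obj Code) :
      Env P E c { c with qcCert := insert (X, k, B) c.qcCert }
  /-- Transaction Agreement reaches a decision. -/
  | taCertify (A : UA) (sn : ℕ) (tx : Tx UA RA Obj Code) :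
      Env P E c { c with taCert := insert (A, sn, tx) c.taCert }
  /-- An honest validator learns a decision of Quorum Consensus. -/
  | qcDecide (V : Val) (X : RA) (k : ℕ) (B : Block UA RA Obj Code)
      (hV : V ∈ E.honest) (hB : (X, k, B) ∈ c.qcCert)
      (hnew : ((c.loc V).ra X).qcDecided k = none) :
      Env P E c (c.updRA V X fun r =>
        { r with qcDecided := Function.update r.qcDecided k (some B) })
  /-- An honest validator learns a decision of Transaction Agreement. -/
  | taDecide (V : Val) (A : UA) (sn : ℕ) (tx : Tx UA RA Obj Code)
      (hV : V ∈ E.honest) (htx : (A, sn, tx) ∈ c.taCert)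
      (hnew : (c.loc V).taDecided A sn = none) :
      Env P E c (c.setLoc V { c.loc V with
        taDecided := upd₂ (c.loc V).taDecided A sn (some tx) })

/-- One step of the system. Time passes only if no honest validator has an enabled action. -/
inductive Step (P : Params Val UA RA Obj Code State) (E : Scenario Val UA)
    (c : Config Val UA RA Obj Code State) : Config Val UA RA Obj Code State → Prop where
  | act (V : Val) (hV : V ∈ E.honest) (c' : Config Val UA RA Obj Code State)
      (h : Act P E V c c') : Step P E c c'
  | env (c' : Config Val UA RA Obj Code State) (h : Env P E c c') : Step P E c c'
  | tick (t : ℝ) (ht : c.now ≤ t) (hquiet : ∀ V ∈ E.honest, ∀ c', ¬ Act P E V c c') :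
      Step P E c { c with now := t }

/-! ### Executions -/

def initRA (P : Params Val UA RA Obj Code State) (X : RA) : RAState UA RA Obj Code State where
  state := P.initState X
  owned := P.initObjs X
  pool := ∅
  done := ∅
  start := fun _ => none
  decided := fun _ => none
  fp := fun _ => none
  fpReply := fun _ _ => none
  voted := ∅
  cand := fun _ => none
  spReply := fun _ _ => none
  needFallback := ∅
  cand₂ := fun _ => none
  spReply₂ := fun _ _ => none
  qcDecided := fun _ => none
  taAsked := ∅

def initLocal (P : Params Val UA RA Obj Code State) : Local UA RA Obj Code State where
  fpLock := fun _ _ => none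
  spLock := fun _ _ => none
  executed := ∅
  created := P.genesisObjs
  consumed := ∅
  waiting := ∅
  effects := ∅
  pobDecided := fun _ _ => none
  taDecided := fun _ _ => none
  active := ↑P.genesisRA
  ra := initRA P

def initConfig (P : Params Val UA RA Obj Code State) : Config Val UA RA Obj Code State where
  now := 0
  loc := fun _ => initLocal P
  sent := ∅
  inbox := fun _ => ∅
  emitted := ∅
  nextSn := fun _ => 0
  txInbox := fun _ => ∅
  qcProposed := ∅
  taProposed := ∅
  qcCert := ∅
  taCert := ∅

/-- The safety specification of Quorum Consensus: Agreement and Quorum Validity. -/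
structure QuorumConsensusSpec (P : Params Val UA RA Obj Code State) (E : Scenario Val UA)
    (run : ℕ → Config Val UA RA Obj Code State) : Prop where
  agreement : ∀ i j X k B B', (X, k, B) ∈ (run i).qcCert → (X, k, B') ∈ (run j).qcCert → B = B'
  /-- A transaction contained in every proposal of an honest validator is decided. -/
  validity_I : ∀ i X k B tx, (X, k, B) ∈ (run i).qcCert →
    (∀ j, ∀ V ∈ E.honest, ∀ B', (V, X, k, B') ∈ (run j).qcProposed → tx ∈ B') → tx ∈ B
  /-- A decided transaction is in the proposals of at least `n - 3f` honest validators. -/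
  validity_II : ∀ i X k B, ∀ tx ∈ B, (X, k, B) ∈ (run i).qcCert →
    Nat.card Val ≤
      {V | V ∈ E.honest ∧ ∃ j B', (V, X, k, B') ∈ (run j).qcProposed ∧ tx ∈ B'}.ncard + 3 * P.f

/-- The safety specification of Transaction Agreement: Agreement and Quorum Validity. -/
structure TransactionAgreementSpec (P : Params Val UA RA Obj Code State) (E : Scenario Val UA)
    (run : ℕ → Config Val UA RA Obj Code State) : Prop where
  agreement : ∀ i j A sn tx tx', (A, sn, tx) ∈ (run i).taCert → (A, sn, tx') ∈ (run j).taCert →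
    tx = tx'
  /-- If all honest proposals are the same value, then only this value can be decided. -/
  validity_I : ∀ i A sn tx w, (A, sn, tx) ∈ (run i).taCert →
    (∀ j, ∀ V ∈ E.honest, ∀ tx', (V, A, sn, tx') ∈ (run j).taProposed → tx' = w) → tx = w
  /-- A decided value was proposed by at least `n - 3f` honest validators. -/
  validity_II : ∀ i A sn tx, (A, sn, tx) ∈ (run i).taCert →
    Nat.card Val ≤
      {V | V ∈ E.honest ∧ ∃ j, (V, A, sn, tx) ∈ (run j).taProposed}.ncard + 3 * P.f

/-- `run` is an execution of the protocol in the scenario `E`. -/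
structure IsExecution (P : Params Val UA RA Obj Code State) (E : Scenario Val UA)
    (run : ℕ → Config Val UA RA Obj Code State) : Prop where
  init : run 0 = initConfig P
  step : ∀ i, Step P E (run i) (run (i + 1))
  /-- Time diverges. -/
  diverges : ∀ T : ℝ, ∃ i, T < (run i).now
  /-- A message sent at time `τ` is delivered by time `max τ GST + δ`. -/
  delivery : ∀ i U V m τ, U ∈ E.honest → V ∈ E.honest → (U, m, τ) ∈ (run i).sent →
    max τ E.GST + E.δ < (run i).now → (U, m) ∈ (run i).inbox V
  /-- The same for transactions broadcast by honest users. -/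
  txDelivery : ∀ i V tx τ, V ∈ E.honest → (tx, τ) ∈ (run i).emitted →
    max τ E.GST + E.δ < (run i).now → tx ∈ (run i).txInbox V
  qc : QuorumConsensusSpec P E run
  ta : TransactionAgreementSpec P E run

/-- `V` starts instance `k` of POA for `X` at time `s`. -/
def StartsAt (run : ℕ → Config Val UA RA Obj Code State) (V : Val) (X : RA) (k : ℕ) (s : ℝ) :
    Prop :=
  ∃ i, (((run i).loc V).ra X).start k = some s

/-- `V` decides `B` in instance `k` of POA for `X` at time `d`. -/
def DecidesAt (run : ℕ → Config Val UA RA Obj Code State) (V : Val) (X : RA) (k : ℕ)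
    (B : Block UA RA Obj Code) (d : ℝ) : Prop :=
  ∃ i, (((run i).loc V).ra X).decided k = some (B, d)

/-- At the moment at which the leader `L` starts instance `k` of POA for `X`, the issuer of every
UA-RA transaction in the pool of `L.X` is honest. -/
def GoodPool (E : Scenario Val UA) (run : ℕ → Config Val UA RA Obj Code State) (L : Val) (X : RA)
    (k : ℕ) : Prop :=
  ∀ i, (((run i).loc L).ra X).start k = none → (((run (i + 1)).loc L).ra X).start k ≠ none →
    ∀ tx ∈ (((run i).loc L).ra X).pool, ∀ A, tx.IsUARA A → A ∈ E.honestUser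

/-- After time `d` validator `V` sends no message of instance `k` of POA for `X`, and it never
takes part in the slow path of this instance: it makes no proposal to its Quorum Consensus and
requests no Transaction Agreement for it. -/
def StopsAt (run : ℕ → Config Val UA RA Obj Code State) (V : Val) (X : RA) (k : ℕ) (d : ℝ) :
    Prop :=
  (∀ i m τ, (V, m, τ) ∈ (run i).sent → m.OfInstance X k → τ ≤ d) ∧
  (∀ i B, (V, X, k, B) ∉ (run i).qcProposed) ∧
  (∀ i tx, (k, tx) ∉ (((run i).loc V).ra X).taAsked)

end Model

end Mangrove

/-!
The argument has a safety half and a timing half.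

*Safety.* An honest validator FP-locks at most one transaction per user actor and sequence number,
and it votes once per instance.  Since `n ≥ 3f + 2p + 1`, a transaction that `n - p` validators
FP-lock excludes that another one is FP-locked by the `n - p - 2f` validators needed for an SP-lock
(`eq_of_fastLocked`); so at most one transaction per user actor and sequence number is ever decided
(`certified_unique`).  In the same way a block with `n - p` votes is the only one that honest
validators propose to Quorum Consensus, and Quorum Validity makes the slow path agree with the fast
one: each instance has at most one provable decision (`validProof_unique`).  Execution is
deterministic, hence the blocks decided for a reactive actor determine its state and everything that
its transactions bring about (`history`, `holds_of_emits`).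

*Spreading.* Call a *fact* any of the following statements about a validator: a reactive actor
exists, an RA-RA transaction has reached its recipient, a UA-RA transaction has been executed on its
recipient, an object was created, a sequence number is executed, a block or a UA transaction is
decided.  Time passes only when no honest validator has an
action left, so at the last moment before the clock exceeds `T + δ`, with `T ≥ GST`, every message
sent by time `T` has arrived and every action that it enables has been performed
(`exists_caughtUp`).  By induction over the steps of the execution, every fact that some honest
validator has reached by time `T` then holds at all of them (`spread`): decisions arrive with their
proofs, and the rest follows by executing the same blocks and user transactions.  The execution
preconditions of a user transaction are inherited too, because the objects consumed at a validator
are those of the certified transactions that it has executed (`executed_spec`, `ready_of_facts`).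

*The instance.* By spreading, all honest validators start the instance within `δ` of each other.
Let the leader start it at `t_L` and propose its pool `B`.  By `t_L + δ` each honest validator has
`B`, the RA-RA transactions of `B` and the preconditions of its UA-RA transactions; honest issuers
sign one transaction per sequence number, so no lock conflicts, and as `δ ≤ Δ` no timeout strikes.
Hence each honest validator has voted for `B` by then, unless it has decided (`decided_or_voted`).
By `t_L + 2δ` either a proof of decision or the votes of all honest validators, at least `n - p`,
have arrived everywhere, and everyone decides.  All of this happens within `3Δ` of each start, so no
timer expires and nothing is proposed to Quorum Consensus (`qcProposed_notMem`); then Quorum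
Validity lets it decide only the empty block, for which no Transaction Agreement is requested.
-/

namespace Mangrove

open scoped Classical

section Model

variable {Val UA RA Obj Code State : Type*}
  {P : Params Val UA RA Obj Code State} {E : Scenario Val UA}
  {c c' : Config Val UA RA Obj Code State}
  {run : ℕ → Config Val UA RA Obj Code State}

/-! ### Executing blocks -/

/-- The part of the state of a reactive actor that determines how further transactions execute. -/
structure Core (UA RA Obj Code State : Type*) where
  state : State
  owned : Finset Obj
  done : Finset (Tx UA RA Obj Code)

namespace Local

/-- The core of the entity of `X`. -/
def core (s : Local UA RA Obj Code State) (X : RA) : Core UA RA Obj Code State :=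
  ⟨(s.ra X).state, (s.ra X).owned, (s.ra X).done⟩

end Local

/-- The protocol bookkeeping of the two states agrees; the pool, the decisions and the core may
differ. -/
structure RAState.SameBook (r r' : RAState UA RA Obj Code State) : Prop where
  start : r'.start = r.start
  fp : r'.fp = r.fp
  fpReply : r'.fpReply = r.fpReply
  voted : r'.voted = r.voted
  cand : r'.cand = r.cand
  spReply : r'.spReply = r.spReply
  needFallback : r'.needFallback = r.needFallback
  cand₂ : r'.cand₂ = r.cand₂
  qcDecided : r'.qcDecided = r.qcDecided
  taAsked : r'.taAsked = r.taAsked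

/-- The two local states differ at most in what the execution of transactions changes. -/
structure Local.SameBook (s s' : Local UA RA Obj Code State) : Prop where
  fpLock : s'.fpLock = s.fpLock
  spLock : s'.spLock = s.spLock
  executed : s'.executed = s.executed
  consumed : s'.consumed = s.consumed
  waiting : s'.waiting = s.waiting
  pobDecided : s'.pobDecided = s.pobDecided
  taDecided : s'.taDecided = s.taDecided
  ra : ∀ Y, (s.ra Y).SameBook (s'.ra Y)

theorem RAState.SameBook.refl (r : RAState UA RA Obj Code State) : r.SameBook r := by
  constructor <;> rfl

theorem RAState.SameBook.trans {r r' r'' : RAState UA RA Obj Code State} (h : r.SameBook r')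
    (h' : r'.SameBook r'') : r.SameBook r'' := by
  obtain ⟨⟩ := h
  obtain ⟨⟩ := h'
  constructor <;> simp_all

theorem Local.SameBook.refl (s : Local UA RA Obj Code State) : s.SameBook s := by
  constructor <;> first | rfl | exact fun Y => RAState.SameBook.refl _

theorem Local.SameBook.trans {s s' s'' : Local UA RA Obj Code State} (h : s.SameBook s')
    (h' : s'.SameBook s'') : s.SameBook s'' where
  fpLock := h'.1.trans h.1
  spLock := h'.2.trans h.2
  executed := h'.3.trans h.3
  consumed := h'.4.trans h.4
  waiting := h'.5.trans h.5
  pobDecided := h'.6.trans h.6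
  taDecided := h'.7.trans h.7
  ra Y := (h.ra Y).trans (h'.ra Y)

theorem Local.SameBook.updRA {s s' : Local UA RA Obj Code State} (h : s.SameBook s') (X : RA)
    (g : RAState UA RA Obj Code State → RAState UA RA Obj Code State)
    (hg : (s'.ra X).SameBook (g (s'.ra X))) : s.SameBook (s'.updRA X g) := by
  refine h.trans ⟨rfl, rfl, rfl, rfl, rfl, rfl, rfl, fun Y => ?_⟩
  by_cases hY : Y = X
  · subst hY; simpa [Local.updRA] using hg
  · simpa [Local.updRA, hY] using RAState.SameBook.refl _

/-- The effect of delivering a list of transactions over inner links. -/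
structure Local.PoolsExtended (s s' : Local UA RA Obj Code State)
    (l : List (Tx UA RA Obj Code)) : Prop where
  book : s.SameBook s'
  active : s'.active = s.active
  effects : s'.effects = s.effects
  created : s'.created = s.created
  core : ∀ Y, s'.core Y = s.core Y
  decided : ∀ Y, (s'.ra Y).decided = (s.ra Y).decided
  pool : ∀ Y tx, tx ∈ (s'.ra Y).pool ↔
    tx ∈ (s.ra Y).pool ∨ tx ∈ l ∧ tx.recipient = some Y ∧ tx ∉ (s.ra Y).done

theorem addPool_poolsExtended (s : Local UA RA Obj Code State) (tx : Tx UA RA Obj Code) :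
    s.PoolsExtended (s.addPool tx) [tx] := by
  unfold Local.addPool
  rcases hX : tx.recipient with _ | X
  · refine ⟨.refl _, rfl, rfl, rfl, fun _ => rfl, fun _ => rfl, fun Y t => ?_⟩
    simp only [List.mem_singleton]
    constructor
    · exact Or.inl
    · rintro (h | ⟨rfl, h, -⟩)
      · exact h
      · simp [hX] at h
  · refine ⟨(Local.SameBook.refl s).updRA X _ ?_, rfl, rfl, rfl, fun Y => ?_, fun Y => ?_,
      fun Y t => ?_⟩
    · split_ifs
      · exact .refl _
      · constructor <;> rfl
    all_goals
      by_cases hY : Y = X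
      · subst hY
        by_cases hd : tx ∈ (s.ra Y).done
        · simp [Local.updRA, Local.core, hd]
          try (rintro rfl _ h; exact absurd hd h)
        · simp [Local.updRA, Local.core, hd]
          try grind
      · simp [Local.updRA, Local.core, hY]
        try (rintro rfl h; rw [hX] at h; exact absurd (Option.some.inj h).symm hY)

theorem foldl_addPool_poolsExtended (l : List (Tx UA RA Obj Code))
    (s : Local UA RA Obj Code State) : s.PoolsExtended (l.foldl Local.addPool s) l := by
  induction l generalizing s with
  | nil => exact ⟨.refl _, rfl, rfl, rfl, fun _ => rfl, fun _ => rfl, by simp⟩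
  | cons tx l ih =>
    have h1 := addPool_poolsExtended s tx
    have h2 := ih (s.addPool tx)
    refine ⟨h1.book.trans h2.book, h2.active.trans h1.active, h2.effects.trans h1.effects,
      h2.created.trans h1.created, fun Y => (h2.core Y).trans (h1.core Y),
      fun Y => (h2.decided Y).trans (h1.decided Y), fun Y t => ?_⟩
    have hd : ((s.addPool tx).ra Y).done = (s.ra Y).done := congrArg Core.done (h1.core Y)
    have := h1.pool Y t
    have := h2.pool Y t
    rw [hd] at this
    simp only [List.foldl_cons, List.mem_cons] at *
    tauto

theorem isRARA_of_mem_sendAll {X : RA} {l : List (Outgoing RA Obj Code)} {os : Finset Obj}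
    {tx : Tx UA RA Obj Code} (h : tx ∈ (sendAll X os l).2) : tx.IsRARA := by
  induction l generalizing os with
  | nil => simp [sendAll] at h
  | cons t ts ih =>
    unfold sendAll at h
    split_ifs at h
    · rcases List.mem_cons.1 h with rfl | h
      · rfl
      · exact ih h
    · exact ih h

/-- Local facts that spread from one honest validator to all of them. -/
inductive Fact (UA RA Obj Code : Type*) where
  | active (Y : RA)
  | effect (tx : Tx UA RA Obj Code) (cr : Finset (UA × Obj))
  | created (q : UA × Obj)
  /-- the RA-RA transaction has reached its recipient -/
  | arrived (tx : Tx UA RA Obj Code)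
  | executed (q : UA × ℕ)
  | decided (X : RA) (k : ℕ) (B : Block UA RA Obj Code)
  | pobDecided (A : UA) (m : ℕ) (tx : Tx UA RA Obj Code)

/-- The fact holds in the local state. -/
def Local.Holds (s : Local UA RA Obj Code State) : Fact UA RA Obj Code → Prop
  | .active Y => Y ∈ s.active
  | .effect tx cr => (tx, cr) ∈ s.effects
  | .created q => q ∈ s.created
  | .arrived tx => tx.IsRARA ∧
      ∃ X, tx.recipient = some X ∧ (tx ∈ (s.ra X).pool ∨ tx ∈ (s.ra X).done)
  | .executed q => q ∈ s.executed
  | .decided X k B => ∃ t, (s.ra X).decided k = some (B, t)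
  | .pobDecided A m tx => s.pobDecided A m = some tx

/-- The core after one transaction. -/
noncomputable def coreTx (P : Params Val UA RA Obj Code State) (X : RA)
    (σ : Core UA RA Obj Code State) (tx : Tx UA RA Obj Code) : Core UA RA Obj Code State :=
  if tx ∈ σ.done then σ else
    ⟨(P.exec X σ.state tx).state,
      (sendAll (UA := UA) (Code := Code) X (σ.owned ∪ (P.exec X σ.state tx).received)
        (P.exec X σ.state tx).outgoing).1,
      insert tx σ.done⟩

/-- The facts that executing one transaction brings about.  An executed RA-RA transaction counts as
arrived at its recipient; a transaction that is already done brings about nothing. -/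
def emits (P : Params Val UA RA Obj Code State) (X : RA)
    (σ : Core UA RA Obj Code State) (tx : Tx UA RA Obj Code) : Fact UA RA Obj Code → Prop
  | .active Y => tx ∉ σ.done ∧ Y ∈ (P.exec X σ.state tx).spawned
  | .effect t cr => tx ∉ σ.done ∧ t = tx ∧ (∃ A, tx.IsUARA A) ∧ cr = (P.exec X σ.state tx).created
  | .created q => tx ∉ σ.done ∧ tx.IsRARA ∧ q ∈ (P.exec X σ.state tx).created
  | .arrived t => tx ∉ σ.done ∧ t.IsRARA ∧ t.recipient ≠ none ∧
      (t ∈ (sendAll X (σ.owned ∪ (P.exec X σ.state tx).received)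
        (P.exec X σ.state tx).outgoing).2 ∨ t = tx ∧ t.recipient = some X)
  | .executed _ => False
  | .decided _ _ _ => False
  | .pobDecided _ _ _ => False

/-- The facts that executing a list of transactions in order brings about. -/
def emitsList (P : Params Val UA RA Obj Code State) (X : RA) :
    Core UA RA Obj Code State → List (Tx UA RA Obj Code) → Fact UA RA Obj Code → Prop
  | _, [], _ => False
  | σ, tx :: l, φ => emits P X σ tx φ ∨ emitsList P X (coreTx P X σ tx) l φ

theorem not_emitsList_decided {X Y : RA} {σ : Core UA RA Obj Code State}
    {l : List (Tx UA RA Obj Code)} {k : ℕ} {B : Block UA RA Obj Code} :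
    ¬ emitsList P X σ l (.decided Y k B) := by
  induction l generalizing σ with
  | nil => exact id
  | cons tx l ih => exact fun h => h.elim id ih

theorem not_emitsList_pobDecided {X : RA} {σ : Core UA RA Obj Code State}
    {l : List (Tx UA RA Obj Code)} {A : UA} {m : ℕ} {tx : Tx UA RA Obj Code} :
    ¬ emitsList P X σ l (.pobDecided A m tx) := by
  induction l generalizing σ with
  | nil => exact id
  | cons tx l ih => exact fun h => h.elim id ih

/-- `s'` arises from `s` by executing the transactions `l` on `X`. -/
structure Local.Executes (P : Params Val UA RA Obj Code State) (X : RA)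
    (s s' : Local UA RA Obj Code State) (l : List (Tx UA RA Obj Code)) : Prop where
  book : s.SameBook s'
  decided : ∀ Y, (s'.ra Y).decided = (s.ra Y).decided
  core : s'.core X = l.foldl (coreTx P X) (s.core X)
  core_ne : ∀ Y, Y ≠ X → s'.core Y = s.core Y
  holds : ∀ φ, s'.Holds φ ↔ s.Holds φ ∨ emitsList P X (s.core X) l φ
  pool : ∀ Y t, t ∈ (s'.ra Y).pool → t ∈ (s.ra Y).pool ∨ t.IsRARA ∧ t.recipient = some Y
  pool_done : ∀ Y t, t ∈ (s'.ra Y).pool → t ∈ (s'.ra Y).done →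
    t ∈ (s.ra Y).pool ∧ t ∈ (s.ra Y).done ∨ Y = X ∧ t ∈ l

theorem execTx_executes (P : Params Val UA RA Obj Code State) (X : RA)
    (s : Local UA RA Obj Code State) (tx : Tx UA RA Obj Code) :
    s.Executes P X (execTx P X s tx) [tx] := by
  unfold execTx
  split_ifs with h
  · refine ⟨.refl _, fun _ => rfl, ?_, fun _ _ => rfl, fun φ => ?_, fun _ _ => .inl,
      fun _ _ h h' => .inl ⟨h, h'⟩⟩
    · simp [coreTx, Local.core, h]
    · have h' : tx ∈ (s.core X).done := h
      cases φ <;> simp [emitsList, emits, h']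
  · dsimp -iota only
    set out := P.exec X (s.ra X).state tx with hout
    set res : Finset Obj × List (Tx UA RA Obj Code) :=
      sendAll X ((s.ra X).owned ∪ out.received) out.outgoing with hres
    set s₁ := s.updRA X fun r =>
      { r with state := out.state, owned := res.1, done := insert tx r.done } with hs₁
    have book₁ : s.SameBook s₁ := by
      refine (Local.SameBook.refl s).updRA X _ ?_
      constructor <;> rfl
    have core₁ : s₁.core X = coreTx P X (s.core X) tx := by
      simp [hs₁, Local.core, Local.updRA, coreTx, h, hres, hout]
    have ra₁ : ∀ Y, Y ≠ X → s₁.ra Y = s.ra Y := fun Y hY => by simp [hs₁, Local.updRA, hY]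
    have pool₁ : ∀ Y, (s₁.ra Y).pool = (s.ra Y).pool := fun Y => by
      by_cases hY : Y = X
      · subst hY; simp [hs₁, Local.updRA]
      · rw [ra₁ Y hY]
    have decided₁ : ∀ Y, (s₁.ra Y).decided = (s.ra Y).decided := fun Y => by
      by_cases hY : Y = X
      · subst hY; simp [hs₁, Local.updRA]
      · rw [ra₁ Y hY]
    have done₁ : ∀ Y t, t ∈ (s₁.ra Y).done ↔ t ∈ (s.ra Y).done ∨ Y = X ∧ t = tx := fun Y t => by
      by_cases hY : Y = X
      · subst hY; simp [hs₁, Local.updRA, or_comm]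
      · rw [ra₁ Y hY]; simp [hY]
    have H := foldl_addPool_poolsExtended res.2 s₁
    set s₂ := res.2.foldl Local.addPool s₁ with hs₂
    have done₂ : ∀ Y, (s₂.ra Y).done = (s₁.ra Y).done := fun Y => congrArg Core.done (H.core Y)
    have rara : ∀ t ∈ res.2, t.IsRARA := fun t ht => isRARA_of_mem_sendAll ht
    have arrived : ∀ t, s₂.Holds (.arrived t) ↔ s.Holds (.arrived t) ∨
        emitsList P X (s.core X) [tx] (.arrived t) := by
      intro t
      have h' : tx ∉ (s.core X).done := h
      have hr := rara t
      have e : (sendAll X ((s.core X).owned ∪ (P.exec X (s.core X).state tx).received)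
        (P.exec X (s.core X).state tx).outgoing).2 = res.2 := rfl
      simp only [Local.Holds, emitsList, emits, or_false, H.pool, done₂, pool₁, done₁, e]
      rcases ht : t.recipient with _ | Y
      · simp
      · simp only [Option.some.injEq, exists_eq_left', ne_eq, reduceCtorEq, not_false_eq_true,
          true_and]
        tauto
    have pool₂ : ∀ Y t, t ∈ (s₂.ra Y).pool → t ∈ (s.ra Y).pool ∨
        t.IsRARA ∧ t.recipient = some Y := fun Y t ht => by
      rcases (H.pool Y t).1 ht with h | h
      · exact .inl (pool₁ Y ▸ h)
      · exact .inr ⟨rara t h.1, h.2.1⟩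
    have poolDone : ∀ Y t, t ∈ (s₂.ra Y).pool → t ∈ (s₂.ra Y).done →
        t ∈ (s.ra Y).pool ∧ t ∈ (s.ra Y).done ∨ Y = X ∧ t ∈ [tx] := fun Y t ht hd => by
      rw [done₂] at hd
      rcases (H.pool Y t).1 ht with h | h
      · rw [pool₁] at h
        have := (done₁ Y t).1 hd
        simp only [List.mem_singleton]
        tauto
      · exact absurd hd h.2.2
    have h' : tx ∉ (s.core X).done := h
    have e₁ : (P.exec X (s.core X).state tx) = out := rfl
    have book := book₁.trans H.book
    have hc : s₂.created = s.created := H.created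
    have he : s₂.effects = s.effects := H.effects
    have ha : s₂.active = s.active := H.active
    have hx : s₂.executed = s.executed := H.book.executed
    have hpd : s₂.pobDecided = s.pobDecided := H.book.pobDecided
    have hdec : ∀ Y, (s₂.ra Y).decided = (s.ra Y).decided := fun Y =>
      (H.decided Y).trans (decided₁ Y)
    have hcore := (H.core X).trans core₁
    have hcore' : ∀ Y, Y ≠ X → s₂.core Y = s.core Y := fun Y hY =>
      (H.core Y).trans (by simp [Local.core, ra₁ Y hY])
    clear_value s₂ s₁ res out
    cases tx <;>
    · refine ⟨⟨book.1, book.2, book.3, book.4, book.5, book.6, book.7, book.8⟩, hdec, hcore, hcore',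
        fun φ => ?_, pool₂, poolDone⟩
      cases φ <;> first
        | exact arrived _
        | simp [Local.Holds, emitsList, emits, h', e₁, hc, he, ha, hx, hpd, hdec, Tx.IsUARA,
            Tx.IsRARA, Tx.issuer, Tx.recipient, or_comm]

theorem foldl_execTx_executes (P : Params Val UA RA Obj Code State) (X : RA)
    (l : List (Tx UA RA Obj Code)) (s : Local UA RA Obj Code State) :
    s.Executes P X (l.foldl (execTx P X) s) l := by
  induction l generalizing s with
  | nil => exact ⟨.refl _, fun _ => rfl, rfl, fun _ _ => rfl, by simp [emitsList],
      fun _ _ => .inl, fun _ _ h h' => .inl ⟨h, h'⟩⟩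
  | cons tx l ih =>
    have h1 := execTx_executes P X s tx
    have h2 := ih (execTx P X s tx)
    have hcore : (execTx P X s tx).core X = coreTx P X (s.core X) tx := h1.core
    refine ⟨h1.book.trans h2.book, fun Y => (h2.decided Y).trans (h1.decided Y), ?_,
      fun Y hY => (h2.core_ne Y hY).trans (h1.core_ne Y hY), fun φ => ?_, fun Y t ht => ?_,
      fun Y t ht hd => ?_⟩
    · rw [List.foldl_cons, h2.core, hcore, List.foldl_cons]
    · rw [List.foldl_cons, h2.holds, h1.holds, hcore]
      simp only [emitsList, or_false, or_assoc]
    · rcases h2.pool Y t ht with h | h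
      · exact h1.pool Y t h
      · exact .inr h
    · rcases h2.pool_done Y t ht hd with h | h
      · rcases h1.pool_done Y t h.1 h.2 with h | h
        · exact .inl h
        · exact .inr ⟨h.1, by simp_all⟩
      · exact .inr ⟨h.1, List.mem_cons_of_mem _ h.2⟩

theorem mem_done_coreTx (P : Params Val UA RA Obj Code State) (X : RA)
    (σ : Core UA RA Obj Code State) (tx t : Tx UA RA Obj Code) :
    t ∈ (coreTx P X σ tx).done ↔ t ∈ σ.done ∨ t = tx := by
  unfold coreTx
  split_ifs with h
  · constructor
    · exact .inl
    · rintro (h' | rfl) <;> assumption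
  · simp [or_comm]

/-- The core after a block. -/
noncomputable def coreBlock (P : Params Val UA RA Obj Code State) (X : RA)
    (σ : Core UA RA Obj Code State) (B : Block UA RA Obj Code) : Core UA RA Obj Code State :=
  (P.order B).foldl (coreTx P X) σ

theorem mem_done_foldl_coreTx (P : Params Val UA RA Obj Code State) (X : RA)
    (l : List (Tx UA RA Obj Code)) (σ : Core UA RA Obj Code State) (t : Tx UA RA Obj Code) :
    t ∈ (l.foldl (coreTx P X) σ).done ↔ t ∈ σ.done ∨ t ∈ l := by
  induction l generalizing σ with
  | nil => simp
  | cons tx l ih => simp [ih, mem_done_coreTx, or_assoc]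

theorem mem_done_coreBlock (P : Params Val UA RA Obj Code State) (X : RA)
    (σ : Core UA RA Obj Code State) (B : Block UA RA Obj Code) (t : Tx UA RA Obj Code) :
    t ∈ (coreBlock P X σ B).done ↔ t ∈ σ.done ∨ t ∈ B := by
  rw [coreBlock, mem_done_foldl_coreTx, P.mem_order]

/-- `s'` arises from `s` by deciding `B` at time `t` in instance `k` for `X`. -/
structure Local.Decides (P : Params Val UA RA Obj Code State) (X : RA) (k : ℕ)
    (B : Block UA RA Obj Code) (t : ℝ) (s s' : Local UA RA Obj Code State) : Prop where
  book : s.SameBook s'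
  decided : (s'.ra X).decided = Function.update (s.ra X).decided k (some (B, t))
  decided_ne : ∀ Y, Y ≠ X → (s'.ra Y).decided = (s.ra Y).decided
  core : s'.core X = coreBlock P X (s.core X) B
  core_ne : ∀ Y, Y ≠ X → s'.core Y = s.core Y
  holds : ∀ φ, (∀ Y m C, φ ≠ .decided Y m C) →
    (s'.Holds φ ↔ s.Holds φ ∨ emitsList P X (s.core X) (P.order B) φ)
  pool : ∀ Y u, u ∈ (s'.ra Y).pool → u ∈ (s.ra Y).pool ∨ u.IsRARA ∧ u.recipient = some Y
  pool_done : ∀ Y u, u ∈ (s'.ra Y).pool → u ∈ (s'.ra Y).done →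
    u ∈ (s.ra Y).pool ∧ u ∈ (s.ra Y).done

theorem applyDecision_decides (P : Params Val UA RA Obj Code State) (X : RA) (k : ℕ)
    (B : Block UA RA Obj Code) (t : ℝ) (s : Local UA RA Obj Code State) :
    s.Decides P X k B t (applyDecision P X k B t s) := by
  unfold applyDecision
  set s₁ := s.updRA X fun r => { r with decided := Function.update r.decided k (some (B, t)) }
    with hs₁
  have book₁ : s.SameBook s₁ := by
    refine (Local.SameBook.refl s).updRA X _ ?_
    constructor <;> rfl
  have core₁ : ∀ Y, s₁.core Y = s.core Y := fun Y => by
    by_cases hY : Y = X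
    · subst hY; simp [hs₁, Local.core, Local.updRA]
    · simp [hs₁, Local.core, Local.updRA, hY]
  have done₁ : ∀ Y, (s₁.ra Y).done = (s.ra Y).done := fun Y => congrArg Core.done (core₁ Y)
  have pool₁ : ∀ Y, (s₁.ra Y).pool = (s.ra Y).pool := fun Y => by
    by_cases hY : Y = X
    · subst hY; simp [hs₁, Local.updRA]
    · simp [hs₁, Local.updRA, hY]
  have dec₁ : (s₁.ra X).decided = Function.update (s.ra X).decided k (some (B, t)) := by
    simp [hs₁, Local.updRA]
  have dec₁' : ∀ Y, Y ≠ X → (s₁.ra Y).decided = (s.ra Y).decided := fun Y hY => by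
    simp [hs₁, Local.updRA, hY]
  have holds₁ : ∀ φ, (∀ Y m C, φ ≠ .decided Y m C) → (s₁.Holds φ ↔ s.Holds φ) := by
    intro φ hφ
    cases φ <;> first | rfl | exact absurd rfl (hφ _ _ _) | skip
    simp [Local.Holds, pool₁, done₁]
  have H := foldl_execTx_executes P X (P.order B) s₁
  set s₂ := (P.order B).foldl (execTx P X) s₁ with hs₂
  clear_value s₁ s₂
  set s₃ := s₂.updRA X fun r => { r with pool := r.pool \ B } with hs₃
  have ra₃ : ∀ Y, Y ≠ X → s₃.ra Y = s₂.ra Y := fun Y hY => by simp [hs₃, Local.updRA, hY]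
  have core₃ : ∀ Y, s₃.core Y = s₂.core Y := fun Y => by
    by_cases hY : Y = X
    · subst hY; simp [hs₃, Local.core, Local.updRA]
    · simp [hs₃, Local.core, Local.updRA, hY]
  have done₃ : ∀ Y, (s₃.ra Y).done = (s₂.ra Y).done := fun Y => congrArg Core.done (core₃ Y)
  have pool₃ : ∀ Y u, u ∈ (s₃.ra Y).pool ↔ u ∈ (s₂.ra Y).pool ∧ ¬ (Y = X ∧ u ∈ B) := fun Y u => by
    by_cases hY : Y = X
    · subst hY; simp [hs₃, Local.updRA]
    · simp [ra₃ Y hY, hY]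
  have dec₃ : ∀ Y, (s₃.ra Y).decided = (s₂.ra Y).decided := fun Y => by
    by_cases hY : Y = X
    · subst hY; simp [hs₃, Local.updRA]
    · simp [ra₃ Y hY]
  have doneB : ∀ u ∈ B, u ∈ (s₂.ra X).done := fun u hu => by
    have : (s₂.ra X).done = _ := congrArg Core.done H.core
    rw [this, mem_done_foldl_coreTx, P.mem_order]
    exact .inr hu
  have holds₃ : ∀ φ, s₃.Holds φ ↔ s₂.Holds φ := by
    intro φ
    cases φ with
    | arrived u =>
      simp only [Local.Holds, pool₃, done₃]
      refine and_congr_right fun _ => exists_congr fun Y => and_congr_right fun _ => ?_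
      constructor
      · tauto
      · rintro (h | h)
        · by_cases hu : Y = X ∧ u ∈ B
          · exact .inr (hu.1 ▸ doneB u hu.2)
          · exact .inl ⟨h, hu⟩
        · exact .inr h
    | decided => simp [Local.Holds, dec₃]
    | _ => rfl
  refine ⟨?_, (dec₃ X).trans ((H.decided X).trans dec₁), fun Y hY => (dec₃ Y).trans
    ((H.decided Y).trans (dec₁' Y hY)), (core₃ X).trans (H.core.trans (by rw [core₁]; rfl)),
    fun Y hY => (core₃ Y).trans ((H.core_ne Y hY).trans (core₁ Y)), fun φ hφ => ?_, ?_, ?_⟩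
  · refine (book₁.trans H.book).updRA X _ ?_
    constructor <;> rfl
  · rw [holds₃, H.holds, holds₁ φ hφ, core₁]
  · intro Y u hu
    rw [pool₃] at hu
    rw [← pool₁]
    exact H.pool Y u hu.1
  · intro Y u hu hd
    rw [pool₃] at hu
    rw [done₃] at hd
    rw [← pool₁, ← done₁]
    rcases H.pool_done Y u hu.1 hd with h | h
    · exact h
    · exact absurd ⟨h.1, (P.mem_order B u).1 h.2⟩ hu.2

/-! ### One step, seen by one validator -/

@[simp] theorem Config.setLoc_loc_self (c : Config Val UA RA Obj Code State) (V : Val)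
    (s : Local UA RA Obj Code State) : (c.setLoc V s).loc V = s := by
  simp [Config.setLoc]

theorem Config.setLoc_loc_ne (c : Config Val UA RA Obj Code State) {U V : Val}
    (s : Local UA RA Obj Code State) (h : U ≠ V) : (c.setLoc V s).loc U = c.loc U := by
  simp [Config.setLoc, h]

@[simp] theorem Config.updRA_loc_self (c : Config Val UA RA Obj Code State) (V : Val) (X : RA)
    (g : RAState UA RA Obj Code State → RAState UA RA Obj Code State) :
    (c.updRA V X g).loc V = (c.loc V).updRA X g := by
  simp [Config.updRA]

theorem Config.updRA_loc_ne (c : Config Val UA RA Obj Code State) {U V : Val} (X : RA)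
    (g : RAState UA RA Obj Code State → RAState UA RA Obj Code State) (h : U ≠ V) :
    (c.updRA V X g).loc U = c.loc U := c.setLoc_loc_ne _ h

@[simp] theorem Config.bcast_loc (c : Config Val UA RA Obj Code State) (V : Val)
    (m : Msg UA RA Obj Code) : (c.bcast V m).loc = c.loc := rfl

@[simp] theorem Local.updRA_ra (s : Local UA RA Obj Code State) (X Y : RA)
    (g : RAState UA RA Obj Code State → RAState UA RA Obj Code State) :
    (s.updRA X g).ra Y = if Y = X then g (s.ra Y) else s.ra Y := by
  by_cases h : Y = X
  · subst h; simp [Local.updRA]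
  · simp [Local.updRA, h]

@[simp] theorem upd₂_apply {α β γ : Type*} (g : α → β → γ) (a a' : α) (b b' : β) (v : γ) :
    upd₂ g a b v a' b' = if a' = a ∧ b' = b then v else g a' b' := by
  unfold upd₂
  by_cases ha : a' = a
  · subst ha; simp [Function.update_apply]
  · simp [ha]

theorem Act.loc_ne {U V : Val} (h : Act P E V c c') (hU : U ≠ V) : c'.loc U = c.loc U := by
  cases h <;> try simp only [Config.bcast_loc, Config.setLoc_loc_ne _ _ hU,
    Config.updRA_loc_ne _ _ _ hU]
  split_ifs <;> simp only [Config.bcast_loc, Config.updRA_loc_ne _ _ _ hU]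

/-- How one step of the system affects the local state of `V`. -/
inductive LocStep (P : Params Val UA RA Obj Code State) (E : Scenario Val UA) (V : Val)
    (c c' : Config Val UA RA Obj Code State) : Prop where
  | same (h : c'.loc V = c.loc V)
  | act (h : Act P E V c c')
  | recv (A : UA) (tx : Tx UA RA Obj Code) (hA : tx.issuer = some A) (hver : c.Verify E tx)
      (h : c' = receiveTx c V A tx)
  | qc (X : RA) (k : ℕ) (B : Block UA RA Obj Code) (hB : (X, k, B) ∈ c.qcCert)
      (hnew : ((c.loc V).ra X).qcDecided k = none)
      (h : c' = c.updRA V X fun r => { r with qcDecided := Function.update r.qcDecided k (some B) })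
  | ta (A : UA) (sn : ℕ) (tx : Tx UA RA Obj Code) (htx : (A, sn, tx) ∈ c.taCert)
      (hnew : (c.loc V).taDecided A sn = none)
      (h : c' = c.setLoc V { c.loc V with
        taDecided := upd₂ (c.loc V).taDecided A sn (some tx) })

theorem receiveTx_loc_ne {U V : Val} {A : UA} {tx : Tx UA RA Obj Code} (hU : U ≠ V) :
    (receiveTx c V A tx).loc U = c.loc U := by
  unfold receiveTx
  dsimp only
  split_ifs <;> simp only [Config.bcast_loc, Config.setLoc_loc_ne _ _ hU]

@[simp] theorem receiveTx_loc_self (V : Val) (A : UA) (tx : Tx UA RA Obj Code) :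
    (receiveTx c V A tx).loc V =
      if (c.loc V).fpLock A tx.sn = none ∨
          tx.recipient = none ∧ (c.loc V).fpLock A tx.sn = some tx then
        { (c.loc V).setFP A tx with
          waiting := if tx.recipient = none then (c.loc V).waiting
            else insert tx (c.loc V).waiting }
      else c.loc V := by
  unfold receiveTx
  dsimp only
  split_ifs <;> first | (simp only [Config.bcast_loc, Config.setLoc_loc_self]; done) | skip
  all_goals try simp_all
  all_goals rfl

theorem Step.locStep (h : Step P E c c') (V : Val) : LocStep P E V c c' := by
  rcases h with ⟨W, hW, _, h⟩ | ⟨_, h⟩ | _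
  · by_cases hV : V = W
    · subst hV; exact .act h
    · exact .same (h.loc_ne hV)
  · cases h with
    | deliverTx W A tx hW hA hver =>
      by_cases hV : V = W
      · subst hV; exact .recv A tx hA hver rfl
      · exact .same (receiveTx_loc_ne hV)
    | qcDecide W X k B hW hB hnew =>
      by_cases hV : V = W
      · subst hV; exact .qc X k B hB hnew rfl
      · exact .same (c.updRA_loc_ne _ _ hV)
    | taDecide W A sn tx hW htx hnew =>
      by_cases hV : V = W
      · subst hV; exact .ta A sn tx htx hnew rfl
      · exact .same (c.setLoc_loc_ne _ hV)
    | _ => exact .same rfl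
  · exact .same rfl

/-! ### Fields of updated states -/

@[simp] theorem Config.ite_bcast_loc (p : Prop) [Decidable p] (c : Config Val UA RA Obj Code State)
    (V : Val) (m : Msg UA RA Obj Code) : (if p then c.bcast V m else c).loc = c.loc := by
  split_ifs <;> rfl

@[simp] theorem Local.updRA_fpLock (s : Local UA RA Obj Code State) (X : RA)
    (g : RAState UA RA Obj Code State → RAState UA RA Obj Code State) :
    (s.updRA X g).fpLock = s.fpLock := rfl

@[simp] theorem Local.updRA_spLock (s : Local UA RA Obj Code State) (X : RA)
    (g : RAState UA RA Obj Code State → RAState UA RA Obj Code State) :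
    (s.updRA X g).spLock = s.spLock := rfl

@[simp] theorem Local.updRA_executed (s : Local UA RA Obj Code State) (X : RA)
    (g : RAState UA RA Obj Code State → RAState UA RA Obj Code State) :
    (s.updRA X g).executed = s.executed := rfl

@[simp] theorem Local.updRA_created (s : Local UA RA Obj Code State) (X : RA)
    (g : RAState UA RA Obj Code State → RAState UA RA Obj Code State) :
    (s.updRA X g).created = s.created := rfl

@[simp] theorem Local.updRA_consumed (s : Local UA RA Obj Code State) (X : RA)
    (g : RAState UA RA Obj Code State → RAState UA RA Obj Code State) :
    (s.updRA X g).consumed = s.consumed := rfl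

@[simp] theorem Local.updRA_waiting (s : Local UA RA Obj Code State) (X : RA)
    (g : RAState UA RA Obj Code State → RAState UA RA Obj Code State) :
    (s.updRA X g).waiting = s.waiting := rfl

@[simp] theorem Local.updRA_effects (s : Local UA RA Obj Code State) (X : RA)
    (g : RAState UA RA Obj Code State → RAState UA RA Obj Code State) :
    (s.updRA X g).effects = s.effects := rfl

@[simp] theorem Local.updRA_pobDecided (s : Local UA RA Obj Code State) (X : RA)
    (g : RAState UA RA Obj Code State → RAState UA RA Obj Code State) :
    (s.updRA X g).pobDecided = s.pobDecided := rfl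

@[simp] theorem Local.updRA_taDecided (s : Local UA RA Obj Code State) (X : RA)
    (g : RAState UA RA Obj Code State → RAState UA RA Obj Code State) :
    (s.updRA X g).taDecided = s.taDecided := rfl

@[simp] theorem Local.updRA_active (s : Local UA RA Obj Code State) (X : RA)
    (g : RAState UA RA Obj Code State → RAState UA RA Obj Code State) :
    (s.updRA X g).active = s.active := rfl

@[simp] theorem Local.setFP_spLock (s : Local UA RA Obj Code State) (A : UA)
    (tx : Tx UA RA Obj Code) : (s.setFP A tx).spLock = s.spLock := rfl

@[simp] theorem Local.setFP_executed (s : Local UA RA Obj Code State) (A : UA)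
    (tx : Tx UA RA Obj Code) : (s.setFP A tx).executed = s.executed := rfl

@[simp] theorem Local.setFP_created (s : Local UA RA Obj Code State) (A : UA)
    (tx : Tx UA RA Obj Code) : (s.setFP A tx).created = s.created := rfl

@[simp] theorem Local.setFP_consumed (s : Local UA RA Obj Code State) (A : UA)
    (tx : Tx UA RA Obj Code) : (s.setFP A tx).consumed = s.consumed := rfl

@[simp] theorem Local.setFP_waiting (s : Local UA RA Obj Code State) (A : UA)
    (tx : Tx UA RA Obj Code) : (s.setFP A tx).waiting = s.waiting := rfl

@[simp] theorem Local.setFP_effects (s : Local UA RA Obj Code State) (A : UA)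
    (tx : Tx UA RA Obj Code) : (s.setFP A tx).effects = s.effects := rfl

@[simp] theorem Local.setFP_pobDecided (s : Local UA RA Obj Code State) (A : UA)
    (tx : Tx UA RA Obj Code) : (s.setFP A tx).pobDecided = s.pobDecided := rfl

@[simp] theorem Local.setFP_taDecided (s : Local UA RA Obj Code State) (A : UA)
    (tx : Tx UA RA Obj Code) : (s.setFP A tx).taDecided = s.taDecided := rfl

@[simp] theorem Local.setFP_active (s : Local UA RA Obj Code State) (A : UA)
    (tx : Tx UA RA Obj Code) : (s.setFP A tx).active = s.active := rfl

@[simp] theorem Local.ite_fpLock (p : Prop) [Decidable p] (a b : Local UA RA Obj Code State) :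
    (if p then a else b).fpLock = if p then a.fpLock else b.fpLock := apply_ite _ _ _ _

@[simp] theorem Local.ite_spLock (p : Prop) [Decidable p] (a b : Local UA RA Obj Code State) :
    (if p then a else b).spLock = if p then a.spLock else b.spLock := apply_ite _ _ _ _

@[simp] theorem Local.ite_executed (p : Prop) [Decidable p] (a b : Local UA RA Obj Code State) :
    (if p then a else b).executed = if p then a.executed else b.executed := apply_ite _ _ _ _

@[simp] theorem Local.ite_created (p : Prop) [Decidable p] (a b : Local UA RA Obj Code State) :
    (if p then a else b).created = if p then a.created else b.created := apply_ite _ _ _ _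

@[simp] theorem Local.ite_consumed (p : Prop) [Decidable p] (a b : Local UA RA Obj Code State) :
    (if p then a else b).consumed = if p then a.consumed else b.consumed := apply_ite _ _ _ _

@[simp] theorem Local.ite_waiting (p : Prop) [Decidable p] (a b : Local UA RA Obj Code State) :
    (if p then a else b).waiting = if p then a.waiting else b.waiting := apply_ite _ _ _ _

@[simp] theorem Local.ite_effects (p : Prop) [Decidable p] (a b : Local UA RA Obj Code State) :
    (if p then a else b).effects = if p then a.effects else b.effects := apply_ite _ _ _ _

@[simp] theorem Local.ite_pobDecided (p : Prop) [Decidable p] (a b : Local UA RA Obj Code State) :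
    (if p then a else b).pobDecided = if p then a.pobDecided else b.pobDecided := apply_ite _ _ _ _

@[simp] theorem Local.ite_taDecided (p : Prop) [Decidable p] (a b : Local UA RA Obj Code State) :
    (if p then a else b).taDecided = if p then a.taDecided else b.taDecided := apply_ite _ _ _ _

@[simp] theorem Local.ite_active (p : Prop) [Decidable p] (a b : Local UA RA Obj Code State) :
    (if p then a else b).active = if p then a.active else b.active := apply_ite _ _ _ _

@[simp] theorem Local.setFP_fpLock (s : Local UA RA Obj Code State) (A A' : UA) (m : ℕ)
    (tx : Tx UA RA Obj Code) : (s.setFP A tx).fpLock A' m =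
      if A' = A ∧ m = tx.sn then some tx else s.fpLock A' m := by
  simp [Local.setFP]

@[simp] theorem Local.trySP_spLock (s : Local UA RA Obj Code State) (A A' : UA) (m : ℕ)
    (tx : Tx UA RA Obj Code) : (s.trySP A tx).spLock A' m =
      if s.spLock A tx.sn = none ∧ A' = A ∧ m = tx.sn then some tx else s.spLock A' m := by
  unfold Local.trySP
  split_ifs <;> simp_all [upd₂_apply]

@[simp] theorem Local.setFP_ra (s : Local UA RA Obj Code State) (A : UA) (tx : Tx UA RA Obj Code) :
    (s.setFP A tx).ra = s.ra := rfl

@[simp] theorem Local.ite_ra (p : Prop) [Decidable p] (a b : Local UA RA Obj Code State) :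
    (if p then a else b).ra = if p then a.ra else b.ra := apply_ite _ _ _ _

@[simp] theorem RAState.ite_state (p : Prop) [Decidable p] (a b : RAState UA RA Obj Code State) :
    (if p then a else b).state = if p then a.state else b.state := apply_ite _ _ _ _

@[simp] theorem RAState.ite_owned (p : Prop) [Decidable p] (a b : RAState UA RA Obj Code State) :
    (if p then a else b).owned = if p then a.owned else b.owned := apply_ite _ _ _ _

@[simp] theorem RAState.ite_pool (p : Prop) [Decidable p] (a b : RAState UA RA Obj Code State) :
    (if p then a else b).pool = if p then a.pool else b.pool := apply_ite _ _ _ _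

@[simp] theorem RAState.ite_done (p : Prop) [Decidable p] (a b : RAState UA RA Obj Code State) :
    (if p then a else b).done = if p then a.done else b.done := apply_ite _ _ _ _

@[simp] theorem RAState.ite_start (p : Prop) [Decidable p] (a b : RAState UA RA Obj Code State) :
    (if p then a else b).start = if p then a.start else b.start := apply_ite _ _ _ _

@[simp] theorem RAState.ite_decided (p : Prop) [Decidable p] (a b : RAState UA RA Obj Code State) :
    (if p then a else b).decided = if p then a.decided else b.decided := apply_ite _ _ _ _

@[simp] theorem RAState.ite_fp (p : Prop) [Decidable p] (a b : RAState UA RA Obj Code State) :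
    (if p then a else b).fp = if p then a.fp else b.fp := apply_ite _ _ _ _

@[simp] theorem RAState.ite_fpReply (p : Prop) [Decidable p] (a b : RAState UA RA Obj Code State) :
    (if p then a else b).fpReply = if p then a.fpReply else b.fpReply := apply_ite _ _ _ _

@[simp] theorem RAState.ite_voted (p : Prop) [Decidable p] (a b : RAState UA RA Obj Code State) :
    (if p then a else b).voted = if p then a.voted else b.voted := apply_ite _ _ _ _

@[simp] theorem RAState.ite_cand (p : Prop) [Decidable p] (a b : RAState UA RA Obj Code State) :
    (if p then a else b).cand = if p then a.cand else b.cand := apply_ite _ _ _ _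

@[simp] theorem RAState.ite_spReply (p : Prop) [Decidable p] (a b : RAState UA RA Obj Code State) :
    (if p then a else b).spReply = if p then a.spReply else b.spReply := apply_ite _ _ _ _

@[simp] theorem RAState.ite_needFallback (p : Prop) [Decidable p]
    (a b : RAState UA RA Obj Code State) :
    (if p then a else b).needFallback = if p then a.needFallback else b.needFallback :=
  apply_ite _ _ _ _

@[simp] theorem RAState.ite_cand₂ (p : Prop) [Decidable p] (a b : RAState UA RA Obj Code State) :
    (if p then a else b).cand₂ = if p then a.cand₂ else b.cand₂ := apply_ite _ _ _ _

@[simp] theorem RAState.ite_qcDecided (p : Prop) [Decidable p]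
    (a b : RAState UA RA Obj Code State) :
    (if p then a else b).qcDecided = if p then a.qcDecided else b.qcDecided :=
  apply_ite _ _ _ _

@[simp] theorem RAState.ite_taAsked (p : Prop) [Decidable p] (a b : RAState UA RA Obj Code State) :
    (if p then a else b).taAsked = if p then a.taAsked else b.taAsked := apply_ite _ _ _ _

@[simp] theorem Local.trySP_fpLock (s : Local UA RA Obj Code State) (A : UA)
    (tx : Tx UA RA Obj Code) : (s.trySP A tx).fpLock = s.fpLock := by
  unfold Local.trySP; split_ifs <;> rfl

@[simp] theorem Local.trySP_executed (s : Local UA RA Obj Code State) (A : UA)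
    (tx : Tx UA RA Obj Code) : (s.trySP A tx).executed = s.executed := by
  unfold Local.trySP; split_ifs <;> rfl

@[simp] theorem Local.trySP_created (s : Local UA RA Obj Code State) (A : UA)
    (tx : Tx UA RA Obj Code) : (s.trySP A tx).created = s.created := by
  unfold Local.trySP; split_ifs <;> rfl

@[simp] theorem Local.trySP_consumed (s : Local UA RA Obj Code State) (A : UA)
    (tx : Tx UA RA Obj Code) : (s.trySP A tx).consumed = s.consumed := by
  unfold Local.trySP; split_ifs <;> rfl

@[simp] theorem Local.trySP_waiting (s : Local UA RA Obj Code State) (A : UA)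
    (tx : Tx UA RA Obj Code) : (s.trySP A tx).waiting = s.waiting := by
  unfold Local.trySP; split_ifs <;> rfl

@[simp] theorem Local.trySP_effects (s : Local UA RA Obj Code State) (A : UA)
    (tx : Tx UA RA Obj Code) : (s.trySP A tx).effects = s.effects := by
  unfold Local.trySP; split_ifs <;> rfl

@[simp] theorem Local.trySP_pobDecided (s : Local UA RA Obj Code State) (A : UA)
    (tx : Tx UA RA Obj Code) : (s.trySP A tx).pobDecided = s.pobDecided := by
  unfold Local.trySP; split_ifs <;> rfl

@[simp] theorem Local.trySP_taDecided (s : Local UA RA Obj Code State) (A : UA)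
    (tx : Tx UA RA Obj Code) : (s.trySP A tx).taDecided = s.taDecided := by
  unfold Local.trySP; split_ifs <;> rfl

@[simp] theorem Local.trySP_active (s : Local UA RA Obj Code State) (A : UA)
    (tx : Tx UA RA Obj Code) : (s.trySP A tx).active = s.active := by
  unfold Local.trySP; split_ifs <;> rfl

@[simp] theorem Local.trySP_ra (s : Local UA RA Obj Code State) (A : UA)
    (tx : Tx UA RA Obj Code) : (s.trySP A tx).ra = s.ra := by
  unfold Local.trySP; split_ifs <;> rfl

@[simp] theorem addPool_fpLock (s : Local UA RA Obj Code State) (tx : Tx UA RA Obj Code) :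
    (s.addPool tx).fpLock = s.fpLock := (addPool_poolsExtended s tx).book.fpLock

@[simp] theorem applyDecision_fpLock (X : RA) (k : ℕ) (B : Block UA RA Obj Code) (t : ℝ)
    (s : Local UA RA Obj Code State) : (applyDecision P X k B t s).fpLock = s.fpLock :=
  (applyDecision_decides P X k B t s).book.fpLock

@[simp] theorem addPool_spLock (s : Local UA RA Obj Code State) (tx : Tx UA RA Obj Code) :
    (s.addPool tx).spLock = s.spLock := (addPool_poolsExtended s tx).book.spLock

@[simp] theorem applyDecision_spLock (X : RA) (k : ℕ) (B : Block UA RA Obj Code) (t : ℝ)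
    (s : Local UA RA Obj Code State) : (applyDecision P X k B t s).spLock = s.spLock :=
  (applyDecision_decides P X k B t s).book.spLock

@[simp] theorem addPool_executed (s : Local UA RA Obj Code State) (tx : Tx UA RA Obj Code) :
    (s.addPool tx).executed = s.executed := (addPool_poolsExtended s tx).book.executed

@[simp] theorem applyDecision_executed (X : RA) (k : ℕ) (B : Block UA RA Obj Code) (t : ℝ)
    (s : Local UA RA Obj Code State) : (applyDecision P X k B t s).executed = s.executed :=
  (applyDecision_decides P X k B t s).book.executed

@[simp] theorem addPool_consumed (s : Local UA RA Obj Code State) (tx : Tx UA RA Obj Code) :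
    (s.addPool tx).consumed = s.consumed := (addPool_poolsExtended s tx).book.consumed

@[simp] theorem applyDecision_consumed (X : RA) (k : ℕ) (B : Block UA RA Obj Code) (t : ℝ)
    (s : Local UA RA Obj Code State) : (applyDecision P X k B t s).consumed = s.consumed :=
  (applyDecision_decides P X k B t s).book.consumed

@[simp] theorem addPool_waiting (s : Local UA RA Obj Code State) (tx : Tx UA RA Obj Code) :
    (s.addPool tx).waiting = s.waiting := (addPool_poolsExtended s tx).book.waiting

@[simp] theorem applyDecision_waiting (X : RA) (k : ℕ) (B : Block UA RA Obj Code) (t : ℝ)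
    (s : Local UA RA Obj Code State) : (applyDecision P X k B t s).waiting = s.waiting :=
  (applyDecision_decides P X k B t s).book.waiting

@[simp] theorem addPool_pobDecided (s : Local UA RA Obj Code State) (tx : Tx UA RA Obj Code) :
    (s.addPool tx).pobDecided = s.pobDecided := (addPool_poolsExtended s tx).book.pobDecided

@[simp] theorem addPool_taDecided (s : Local UA RA Obj Code State) (tx : Tx UA RA Obj Code) :
    (s.addPool tx).taDecided = s.taDecided := (addPool_poolsExtended s tx).book.taDecided

@[simp] theorem applyDecision_taDecided (X : RA) (k : ℕ) (B : Block UA RA Obj Code) (t : ℝ)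
    (s : Local UA RA Obj Code State) : (applyDecision P X k B t s).taDecided = s.taDecided :=
  (applyDecision_decides P X k B t s).book.taDecided

@[simp] theorem addPool_active (s : Local UA RA Obj Code State) (tx : Tx UA RA Obj Code) :
    (s.addPool tx).active = s.active := (addPool_poolsExtended s tx).active

@[simp] theorem addPool_effects (s : Local UA RA Obj Code State) (tx : Tx UA RA Obj Code) :
    (s.addPool tx).effects = s.effects := (addPool_poolsExtended s tx).effects

@[simp] theorem addPool_created (s : Local UA RA Obj Code State) (tx : Tx UA RA Obj Code) :
    (s.addPool tx).created = s.created := (addPool_poolsExtended s tx).created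

@[simp] theorem addPool_ra_start (s : Local UA RA Obj Code State) (tx : Tx UA RA Obj Code)
    (Y : RA) : ((s.addPool tx).ra Y).start = (s.ra Y).start :=
  ((addPool_poolsExtended s tx).book.ra Y).start

@[simp] theorem applyDecision_ra_start (X : RA) (k : ℕ) (B : Block UA RA Obj Code) (t : ℝ)
    (s : Local UA RA Obj Code State) (Y : RA) :
    ((applyDecision P X k B t s).ra Y).start = (s.ra Y).start :=
  ((applyDecision_decides P X k B t s).book.ra Y).start

@[simp] theorem addPool_ra_fp (s : Local UA RA Obj Code State) (tx : Tx UA RA Obj Code)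
    (Y : RA) : ((s.addPool tx).ra Y).fp = (s.ra Y).fp :=
  ((addPool_poolsExtended s tx).book.ra Y).fp

@[simp] theorem applyDecision_ra_fp (X : RA) (k : ℕ) (B : Block UA RA Obj Code) (t : ℝ)
    (s : Local UA RA Obj Code State) (Y : RA) :
    ((applyDecision P X k B t s).ra Y).fp = (s.ra Y).fp :=
  ((applyDecision_decides P X k B t s).book.ra Y).fp

@[simp] theorem addPool_ra_fpReply (s : Local UA RA Obj Code State) (tx : Tx UA RA Obj Code)
    (Y : RA) : ((s.addPool tx).ra Y).fpReply = (s.ra Y).fpReply :=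
  ((addPool_poolsExtended s tx).book.ra Y).fpReply

@[simp] theorem applyDecision_ra_fpReply (X : RA) (k : ℕ) (B : Block UA RA Obj Code) (t : ℝ)
    (s : Local UA RA Obj Code State) (Y : RA) :
    ((applyDecision P X k B t s).ra Y).fpReply = (s.ra Y).fpReply :=
  ((applyDecision_decides P X k B t s).book.ra Y).fpReply

@[simp] theorem addPool_ra_voted (s : Local UA RA Obj Code State) (tx : Tx UA RA Obj Code)
    (Y : RA) : ((s.addPool tx).ra Y).voted = (s.ra Y).voted :=
  ((addPool_poolsExtended s tx).book.ra Y).voted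

@[simp] theorem applyDecision_ra_voted (X : RA) (k : ℕ) (B : Block UA RA Obj Code) (t : ℝ)
    (s : Local UA RA Obj Code State) (Y : RA) :
    ((applyDecision P X k B t s).ra Y).voted = (s.ra Y).voted :=
  ((applyDecision_decides P X k B t s).book.ra Y).voted

@[simp] theorem addPool_ra_cand (s : Local UA RA Obj Code State) (tx : Tx UA RA Obj Code)
    (Y : RA) : ((s.addPool tx).ra Y).cand = (s.ra Y).cand :=
  ((addPool_poolsExtended s tx).book.ra Y).cand

@[simp] theorem applyDecision_ra_cand (X : RA) (k : ℕ) (B : Block UA RA Obj Code) (t : ℝ)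
    (s : Local UA RA Obj Code State) (Y : RA) :
    ((applyDecision P X k B t s).ra Y).cand = (s.ra Y).cand :=
  ((applyDecision_decides P X k B t s).book.ra Y).cand

@[simp] theorem addPool_ra_spReply (s : Local UA RA Obj Code State) (tx : Tx UA RA Obj Code)
    (Y : RA) : ((s.addPool tx).ra Y).spReply = (s.ra Y).spReply :=
  ((addPool_poolsExtended s tx).book.ra Y).spReply

@[simp] theorem applyDecision_ra_spReply (X : RA) (k : ℕ) (B : Block UA RA Obj Code) (t : ℝ)
    (s : Local UA RA Obj Code State) (Y : RA) :
    ((applyDecision P X k B t s).ra Y).spReply = (s.ra Y).spReply :=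
  ((applyDecision_decides P X k B t s).book.ra Y).spReply

@[simp] theorem addPool_ra_needFallback (s : Local UA RA Obj Code State) (tx : Tx UA RA Obj Code)
    (Y : RA) : ((s.addPool tx).ra Y).needFallback = (s.ra Y).needFallback :=
  ((addPool_poolsExtended s tx).book.ra Y).needFallback

@[simp] theorem applyDecision_ra_needFallback (X : RA) (k : ℕ) (B : Block UA RA Obj Code) (t : ℝ)
    (s : Local UA RA Obj Code State) (Y : RA) :
    ((applyDecision P X k B t s).ra Y).needFallback = (s.ra Y).needFallback :=
  ((applyDecision_decides P X k B t s).book.ra Y).needFallback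

@[simp] theorem addPool_ra_cand₂ (s : Local UA RA Obj Code State) (tx : Tx UA RA Obj Code)
    (Y : RA) : ((s.addPool tx).ra Y).cand₂ = (s.ra Y).cand₂ :=
  ((addPool_poolsExtended s tx).book.ra Y).cand₂

@[simp] theorem applyDecision_ra_cand₂ (X : RA) (k : ℕ) (B : Block UA RA Obj Code) (t : ℝ)
    (s : Local UA RA Obj Code State) (Y : RA) :
    ((applyDecision P X k B t s).ra Y).cand₂ = (s.ra Y).cand₂ :=
  ((applyDecision_decides P X k B t s).book.ra Y).cand₂

@[simp] theorem addPool_ra_qcDecided (s : Local UA RA Obj Code State) (tx : Tx UA RA Obj Code)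
    (Y : RA) : ((s.addPool tx).ra Y).qcDecided = (s.ra Y).qcDecided :=
  ((addPool_poolsExtended s tx).book.ra Y).qcDecided

@[simp] theorem applyDecision_ra_qcDecided (X : RA) (k : ℕ) (B : Block UA RA Obj Code) (t : ℝ)
    (s : Local UA RA Obj Code State) (Y : RA) :
    ((applyDecision P X k B t s).ra Y).qcDecided = (s.ra Y).qcDecided :=
  ((applyDecision_decides P X k B t s).book.ra Y).qcDecided

@[simp] theorem addPool_ra_taAsked (s : Local UA RA Obj Code State) (tx : Tx UA RA Obj Code)
    (Y : RA) : ((s.addPool tx).ra Y).taAsked = (s.ra Y).taAsked :=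
  ((addPool_poolsExtended s tx).book.ra Y).taAsked

@[simp] theorem applyDecision_ra_taAsked (X : RA) (k : ℕ) (B : Block UA RA Obj Code) (t : ℝ)
    (s : Local UA RA Obj Code State) (Y : RA) :
    ((applyDecision P X k B t s).ra Y).taAsked = (s.ra Y).taAsked :=
  ((applyDecision_decides P X k B t s).book.ra Y).taAsked

@[simp] theorem addPool_ra_decided (s : Local UA RA Obj Code State) (tx : Tx UA RA Obj Code)
    (Y : RA) : ((s.addPool tx).ra Y).decided = (s.ra Y).decided :=
  (addPool_poolsExtended s tx).decided Y

@[simp] theorem addPool_core (s : Local UA RA Obj Code State) (tx : Tx UA RA Obj Code)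
    (Y : RA) : (s.addPool tx).core Y = s.core Y := (addPool_poolsExtended s tx).core Y

@[simp] theorem addPool_ra_done (s : Local UA RA Obj Code State) (tx : Tx UA RA Obj Code)
    (Y : RA) : ((s.addPool tx).ra Y).done = (s.ra Y).done :=
  congrArg Core.done ((addPool_poolsExtended s tx).core Y)

@[simp] theorem addPool_ra_pool (s : Local UA RA Obj Code State) (tx t : Tx UA RA Obj Code)
    (Y : RA) : t ∈ ((s.addPool tx).ra Y).pool ↔
      t ∈ (s.ra Y).pool ∨ t = tx ∧ t.recipient = some Y ∧ t ∉ (s.ra Y).done := by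
  rw [(addPool_poolsExtended s tx).pool, List.mem_singleton]

theorem applyDecision_ra_decided (X : RA) (k : ℕ) (B : Block UA RA Obj Code) (t : ℝ)
    (s : Local UA RA Obj Code State) (Y : RA) :
    ((applyDecision P X k B t s).ra Y).decided =
      if Y = X then Function.update (s.ra Y).decided k (some (B, t)) else (s.ra Y).decided := by
  split_ifs with h
  · subst h; exact (applyDecision_decides P Y k B t s).decided
  · exact (applyDecision_decides P X k B t s).decided_ne Y h

theorem mem_applyDecision_ra_done (X : RA) (k : ℕ) (B : Block UA RA Obj Code) (t : ℝ)
    (s : Local UA RA Obj Code State) (Y : RA) (u : Tx UA RA Obj Code) :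
    u ∈ ((applyDecision P X k B t s).ra Y).done ↔ u ∈ (s.ra Y).done ∨ Y = X ∧ u ∈ B := by
  have h := applyDecision_decides P X k B t s
  by_cases hY : Y = X
  · subst hY
    have := congrArg Core.done h.core
    change ((applyDecision P Y k B t s).ra Y).done = _ at this
    rw [this, mem_done_coreBlock]
    simp [Local.core]
  · have := congrArg Core.done (h.core_ne Y hY)
    change ((applyDecision P X k B t s).ra Y).done = (s.ra Y).done at this
    simp [this, hY]

/-! ### What only grows at a validator -/

/-- What only grows, or is never changed once set, in the local state of a validator. -/
structure Local.Le (s s' : Local UA RA Obj Code State) : Prop where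
  fpLock : ∀ A m tx, s.fpLock A m = some tx → s'.fpLock A m = some tx
  spLock : ∀ A m tx, s.spLock A m = some tx → s'.spLock A m = some tx
  executed : s.executed ⊆ s'.executed
  done : ∀ X, (s.ra X).done ⊆ (s'.ra X).done
  start : ∀ X k t, (s.ra X).start k = some t → (s'.ra X).start k = some t
  decided : ∀ X k b, (s.ra X).decided k = some b → (s'.ra X).decided k = some b
  fp : ∀ X k b, (s.ra X).fp k = some b → (s'.ra X).fp k = some b
  fpReply : ∀ X k tx b, (s.ra X).fpReply k tx = some b → (s'.ra X).fpReply k tx = some b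
  voted : ∀ X, (s.ra X).voted ⊆ (s'.ra X).voted
  holds : ∀ φ, s.Holds φ → s'.Holds φ

theorem Local.Le.refl (s : Local UA RA Obj Code State) : s.Le s := by
  constructor <;> first | exact fun _ => subset_rfl | exact subset_rfl | simp

theorem Local.Le.trans {s s' s'' : Local UA RA Obj Code State} (h : s.Le s') (h' : s'.Le s'') :
    s.Le s'' where
  fpLock A m tx := h'.fpLock A m tx ∘ h.fpLock A m tx
  spLock A m tx := h'.spLock A m tx ∘ h.spLock A m tx
  executed := h.executed.trans h'.executed
  done X := (h.done X).trans (h'.done X)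
  start X k t := h'.start X k t ∘ h.start X k t
  decided X k t := h'.decided X k t ∘ h.decided X k t
  fp X k t := h'.fp X k t ∘ h.fp X k t
  fpReply X k tx t := h'.fpReply X k tx t ∘ h.fpReply X k tx t
  voted X := (h.voted X).trans (h'.voted X)
  holds φ := h'.holds φ ∘ h.holds φ

/-- Facts persist when the fields that they mention only grow. -/
theorem Local.holds_of_subset {s s' : Local UA RA Obj Code State}
    (active : s.active ⊆ s'.active) (effects : s.effects ⊆ s'.effects)
    (created : s.created ⊆ s'.created) (executed : s.executed ⊆ s'.executed)
    (decided : ∀ X k b, (s.ra X).decided k = some b → (s'.ra X).decided k = some b)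
    (pob : ∀ A m tx, s.pobDecided A m = some tx → s'.pobDecided A m = some tx)
    (pool : ∀ X tx, tx ∈ (s.ra X).pool → tx ∈ (s'.ra X).pool)
    (done : ∀ X tx, tx ∈ (s.ra X).done → tx ∈ (s'.ra X).done)
    (φ : Fact UA RA Obj Code) (h : s.Holds φ) : s'.Holds φ := by
  cases φ with
  | active => exact active h
  | effect => exact effects h
  | created => exact created h
  | arrived =>
    obtain ⟨h1, X, h2, h3⟩ := h
    exact ⟨h1, X, h2, h3.imp (pool X _) (done X _)⟩
  | executed => exact executed h
  | decided => exact h.imp fun _ => decided _ _ _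
  | pobDecided => exact pob _ _ _ h

theorem Step.local_le (h : Step P E c c') (V : Val) : (c.loc V).Le (c'.loc V) := by
  rcases h.locStep V with h | h | ⟨A, tx, hA, hver, rfl⟩ | ⟨Y, m, B, hB, hnew, rfl⟩ |
    ⟨A, sn, tx, htx, hnew, rfl⟩
  · rw [h]; exact .refl _
  · by_cases hdec : ∃ Y k B, c.InInstance V Y k ∧
        c'.loc V = applyDecision P Y k B c.now (c.loc V)
    · obtain ⟨Y, k, B, hin, e⟩ := hdec
      rw [e]
      have H := applyDecision_decides P Y k B c.now (c.loc V)
      have hd : ∀ X m b, ((c.loc V).ra X).decided m = some b →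
          ((applyDecision P Y k B c.now (c.loc V)).ra X).decided m = some b := by
        intro X m b hb
        have := hin.2
        rw [applyDecision_ra_decided]
        grind
      constructor <;> try simp
      · intro X tx htx
        exact (mem_applyDecision_ra_done ..).2 (.inl htx)
      · exact fun X m B t => hd X m (B, t)
      · intro φ hφ
        by_cases hφ' : ∀ Y m C, φ ≠ .decided Y m C
        · exact (H.holds φ hφ').2 (.inl hφ)
        · push Not at hφ'
          obtain ⟨Z, m, C, rfl⟩ := hφ'
          exact hφ.imp fun _ => hd _ _ _
    · have aux : ∀ (s' : Local UA RA Obj Code State), c'.loc V = s' → (c.loc V).Le s' := by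
        intro s' hs'
        cases h
        case decide Y k B hin _ => exact absurd ⟨Y, k, B, hin, by simp⟩ hdec
        all_goals
          simp at hs'
          subst hs'
          constructor
        all_goals try refine Local.holds_of_subset ?_ ?_ ?_ ?_ ?_ ?_ ?_ ?_
        all_goals try simp [ite_apply]
        all_goals grind [Config.InInstance, upd₂_apply]
      exact aux _ rfl
  all_goals
    constructor
    all_goals try refine Local.holds_of_subset ?_ ?_ ?_ ?_ ?_ ?_ ?_ ?_
    all_goals try simp [ite_apply]
    all_goals grind

/-! ### Where new values come from -/

theorem Step.fp_origin (h : Step P E c c') {V : Val} {X : RA} {k : ℕ} {b}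
    (hb : ((c'.loc V).ra X).fp k = some b) :
    ((c.loc V).ra X).fp k = some b ∨ b.2 = c.now ∧
      (P.leader X k, Msg.propose X k b.1) ∈ c.inbox V ∧ ∀ tx ∈ b.1, tx.recipient = some X := by
  rcases h.locStep V with h | h | ⟨A, tx, hA, hver, rfl⟩ | ⟨Y, m, B, hB, hnew, rfl⟩ |
    ⟨A, sn, tx, htx, hnew, rfl⟩
  · rw [h] at hb; exact .inl hb
  · cases h <;> simp at hb
    all_goals grind
  all_goals
    simp at hb
  all_goals grind

theorem Step.fpLock_origin (h : Step P E c c') {V : Val} {A₀ : UA} {m₀ : ℕ}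
    {u : Tx UA RA Obj Code} (hb : (c'.loc V).fpLock A₀ m₀ = some u) :
    (c.loc V).fpLock A₀ m₀ = some u ∨ u.issuer = some A₀ ∧ u.sn = m₀ ∧ c.Verify E u := by
  rcases h.locStep V with h | h | ⟨A, tx, hA, hver, rfl⟩ | ⟨Y, m, B, hB, hnew, rfl⟩ |
    ⟨A, sn, tx, htx, hnew, rfl⟩
  · rw [h] at hb; exact .inl hb
  · cases h <;> simp at hb
    all_goals grind [upd₂_apply, Tx.IsUARA]
  all_goals simp [ite_apply] at hb
  all_goals grind [upd₂_apply]

theorem Step.waiting_origin (h : Step P E c c') {V : Val} {u : Tx UA RA Obj Code}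
    (hb : u ∈ (c'.loc V).waiting) : u ∈ (c.loc V).waiting ∨
      ∃ A, u.IsUARA A ∧ (c'.loc V).fpLock A u.sn = some u := by
  rcases h.locStep V with h | h | ⟨A, tx, hA, hver, rfl⟩ | ⟨Y, m, B, hB, hnew, rfl⟩ |
    ⟨A, sn, tx, htx, hnew, rfl⟩
  · rw [h] at hb; exact .inl hb
  · cases h <;> simp at hb
    all_goals grind [upd₂_apply]
  all_goals simp [ite_apply] at hb ⊢
  all_goals grind [upd₂_apply, Tx.IsUARA]

theorem Step.start_origin (h : Step P E c c') {V : Val} {X : RA} {k : ℕ} {t : ℝ}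
    (hb : ((c'.loc V).ra X).start k = some t) : ((c.loc V).ra X).start k = some t ∨
      t = c.now ∧ X ∈ (c.loc V).active ∧ ((c.loc V).ra X).start k = none ∧
        (k = 0 ∨ ((c.loc V).ra X).decided (k - 1) ≠ none) ∧
        (P.leader X k = V → (V, .propose X k ((c.loc V).ra X).pool, c.now) ∈ c'.sent) := by
  rcases h.locStep V with h | h | ⟨A, tx, hA, hver, rfl⟩ | ⟨Y, m, B, hB, hnew, rfl⟩ |
    ⟨A, sn, tx, htx, hnew, rfl⟩
  · rw [h] at hb; exact .inl hb
  · cases h <;> simp [ite_apply] at hb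
    all_goals grind [upd₂_apply, Config.bcast, Config.updRA, Config.setLoc]
  all_goals simp [ite_apply] at hb
  all_goals grind [upd₂_apply]

theorem Step.fpReply_origin (h : Step P E c c') {V : Val} {X : RA} {k : ℕ}
    {u : Tx UA RA Obj Code} {b : Bool} (hb : ((c'.loc V).ra X).fpReply k u = some b) :
    ((c.loc V).ra X).fpReply k u = some b ∨
      ∃ B t A, ((c.loc V).ra X).fp k = some (B, t) ∧ u ∈ B ∧ u.IsUARA A ∧
        (b = true → (c.loc V).fpLock A u.sn = some u) ∧
        (b = false → ¬ c.Verify E u ∨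
          (∃ tx', (c.loc V).fpLock A u.sn = some tx' ∧ tx' ≠ u) ∨ t + P.Δ < c.now) := by
  rcases h.locStep V with h | h | ⟨A, tx, hA, hver, rfl⟩ | ⟨Y, m, B, hB, hnew, rfl⟩ |
    ⟨A, sn, tx, htx, hnew, rfl⟩
  · rw [h] at hb; exact .inl hb
  · cases h <;> simp [ite_apply] at hb
    all_goals grind [upd₂_apply]
  all_goals simp [ite_apply] at hb
  all_goals grind [upd₂_apply]

theorem Step.voted_origin (h : Step P E c c') {V : Val} {X : RA} {k : ℕ}
    (hb : k ∈ ((c'.loc V).ra X).voted) : k ∈ ((c.loc V).ra X).voted ∨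
      ∃ v fb τ, (V, .vote X k v fb, τ) ∈ c'.sent := by
  rcases h.locStep V with h | h | ⟨A, tx, hA, hver, rfl⟩ | ⟨Y, m, B, hB, hnew, rfl⟩ |
    ⟨A, sn, tx, htx, hnew, rfl⟩
  · rw [h] at hb; exact .inl hb
  · cases h <;> simp at hb
    all_goals grind [upd₂_apply, Config.bcast]
  all_goals simp [ite_apply] at hb
  all_goals grind [upd₂_apply]

theorem Step.cand_origin (h : Step P E c c') {V : Val} {X : RA} {k : ℕ} {B₀}
    (hb : ((c'.loc V).ra X).cand k = some B₀) : ((c.loc V).ra X).cand k = some B₀ ∨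
      c.InInstance V X k ∧ c.TimerExpired P V X k ∧
        Nat.card Val ≤ (c.votersFor V X k B₀).ncard + P.p + 2 * P.f := by
  rcases h.locStep V with h | h | ⟨A, tx, hA, hver, rfl⟩ | ⟨Y, m, B, hB, hnew, rfl⟩ |
    ⟨A, sn, tx, htx, hnew, rfl⟩
  · rw [h] at hb; exact .inl hb
  · cases h <;> simp [ite_apply] at hb
    all_goals grind [upd₂_apply]
  all_goals simp [ite_apply] at hb
  all_goals grind [upd₂_apply]

theorem Step.spReply_origin (h : Step P E c c') {V : Val} {X : RA} {k : ℕ}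
    {u : Tx UA RA Obj Code} (hb : ((c'.loc V).ra X).spReply k u = some false) :
    ((c.loc V).ra X).spReply k u = some false ∨
      ∃ A w, u.IsUARA A ∧ (c'.loc V).spLock A u.sn = some w ∧ w ≠ u := by
  rcases h.locStep V with h | h | ⟨A, tx, hA, hver, rfl⟩ | ⟨Y, m, B, hB, hnew, rfl⟩ |
    ⟨A, sn, tx, htx, hnew, rfl⟩
  · rw [h] at hb; exact .inl hb
  · cases h
    case spLock Y m B A tx hc htx hA hrep =>
      simp [ite_apply] at hb
      by_cases hX : X = Y ∧ k = m ∧ u = tx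
      · obtain ⟨rfl, rfl, rfl⟩ := hX
        simp at hb
        rcases hsp : (c.loc V).spLock A u.sn with _ | w
        · exact absurd hsp hb.1
        · exact .inr ⟨A, w, hA, by simp [hsp], by rintro rfl; exact hb.2 hsp⟩
      · left
        grind
    all_goals simp [ite_apply] at hb
    all_goals grind [upd₂_apply]
  all_goals simp [ite_apply] at hb
  all_goals grind [upd₂_apply]

theorem Step.needFallback_origin (h : Step P E c c') {V : Val} {X : RA} {k : ℕ}
    (hb : k ∈ ((c'.loc V).ra X).needFallback) : k ∈ ((c.loc V).ra X).needFallback ∨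
      c.InInstance V X k ∧
      (c.TimerExpired P V X k ∧ Nat.card Val ≤ (c.voters V X k).ncard + P.f ∧
          (∀ B, ¬ Nat.card Val ≤ (c.votersFor V X k B).ncard + P.p + 2 * P.f) ∨
        ∃ B, ((c.loc V).ra X).cand k = some B ∧
          ∃ u ∈ B, ∃ A, u.IsUARA A ∧ ((c.loc V).ra X).spReply k u = some false) := by
  rcases h.locStep V with h | h | ⟨A, tx, hA, hver, rfl⟩ | ⟨Y, m, B, hB, hnew, rfl⟩ |
    ⟨A, sn, tx, htx, hnew, rfl⟩
  · rw [h] at hb; exact .inl hb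
  · cases h <;> simp at hb
    all_goals grind [upd₂_apply]
  all_goals simp [ite_apply] at hb
  all_goals grind [upd₂_apply]

theorem Step.cand₂_origin (h : Step P E c c') {V : Val} {X : RA} {k : ℕ} {C₀}
    (hb : ((c'.loc V).ra X).cand₂ k = some C₀) : ((c.loc V).ra X).cand₂ k = some C₀ ∨
      k ∈ ((c.loc V).ra X).needFallback ∧
        ∀ u ∈ C₀, Nat.card Val ≤ (c.fallbacksWith V X k u).ncard + 2 * P.f := by
  rcases h.locStep V with h | h | ⟨A, tx, hA, hver, rfl⟩ | ⟨Y, m, B, hB, hnew, rfl⟩ |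
    ⟨A, sn, tx, htx, hnew, rfl⟩
  · rw [h] at hb; exact .inl hb
  · cases h <;> simp [ite_apply] at hb
    all_goals grind [upd₂_apply]
  all_goals simp [ite_apply] at hb
  all_goals grind [upd₂_apply]

theorem Step.spLock_origin (h : Step P E c c') {V : Val} {A₀ : UA} {m₀ : ℕ}
    {u : Tx UA RA Obj Code} (hb : (c'.loc V).spLock A₀ m₀ = some u) :
    (c.loc V).spLock A₀ m₀ = some u ∨ u.sn = m₀ ∧
      (u.IsUARA A₀ ∧ (∃ X k B, u ∈ B ∧ (((c.loc V).ra X).cand k = some B ∨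
          ((c.loc V).ra X).cand₂ k = some B ∨ ((c.loc V).ra X).qcDecided k = some B)) ∨
        Nat.card Val ≤ (c.pobVotersFor V A₀ u).ncard + P.p + 2 * P.f) := by
  rcases h.locStep V with h | h | ⟨A, tx, hA, hver, rfl⟩ | ⟨Y, m, B, hB, hnew, rfl⟩ |
    ⟨A, sn, tx, htx, hnew, rfl⟩
  · rw [h] at hb; exact .inl hb
  · cases h <;> simp at hb
    all_goals grind [upd₂_apply]
  all_goals simp [ite_apply] at hb
  all_goals grind [upd₂_apply]

theorem Step.qcDecided_origin (h : Step P E c c') {V : Val} {X : RA} {k : ℕ} {B₀}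
    (hb : ((c'.loc V).ra X).qcDecided k = some B₀) :
    ((c.loc V).ra X).qcDecided k = some B₀ ∨ (X, k, B₀) ∈ c.qcCert := by
  rcases h.locStep V with h | h | ⟨A, tx, hA, hver, rfl⟩ | ⟨Y, m, B, hB, hnew, rfl⟩ |
    ⟨A, sn, tx, htx, hnew, rfl⟩
  · rw [h] at hb; exact .inl hb
  · cases h <;> simp [ite_apply] at hb
    all_goals grind [upd₂_apply]
  all_goals simp [ite_apply] at hb
  all_goals grind [upd₂_apply]

theorem Step.taDecided_origin (h : Step P E c c') {V : Val} {A₀ : UA} {m₀ : ℕ}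
    {u : Tx UA RA Obj Code} (hb : (c'.loc V).taDecided A₀ m₀ = some u) :
    (c.loc V).taDecided A₀ m₀ = some u ∨ (A₀, m₀, u) ∈ c.taCert := by
  rcases h.locStep V with h | h | ⟨A, tx, hA, hver, rfl⟩ | ⟨Y, m, B, hB, hnew, rfl⟩ |
    ⟨A, sn, tx, htx, hnew, rfl⟩
  · rw [h] at hb; exact .inl hb
  · cases h <;> simp at hb
    all_goals grind [upd₂_apply]
  all_goals simp [ite_apply] at hb
  all_goals grind [upd₂_apply]

theorem Step.taAsked_origin (h : Step P E c c') {V : Val} {X : RA} {k : ℕ}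
    {u : Tx UA RA Obj Code} (hb : (k, u) ∈ ((c'.loc V).ra X).taAsked) :
    (k, u) ∈ ((c.loc V).ra X).taAsked ∨
      ∃ B, ((c.loc V).ra X).qcDecided k = some B ∧ u ∈ B := by
  rcases h.locStep V with h | h | ⟨A, tx, hA, hver, rfl⟩ | ⟨Y, m, B, hB, hnew, rfl⟩ |
    ⟨A, sn, tx, htx, hnew, rfl⟩
  · rw [h] at hb; exact .inl hb
  · cases h <;> simp at hb
    all_goals grind [upd₂_apply]
  all_goals simp [ite_apply] at hb
  all_goals grind [upd₂_apply]

/-- A sequence number is executed by a UA-RA transaction already executed on its recipient, or by a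
decided UA transaction, whose preconditions hold. -/
theorem Step.executed_origin (h : Step P E c c') {V : Val} :
    (c'.loc V).executed = (c.loc V).executed ∧ (c'.loc V).consumed = (c.loc V).consumed ∨
      ∃ A tx, (c.loc V).Ready A tx ∧ (A, tx.sn) ∉ (c.loc V).executed ∧
        (c'.loc V).executed = insert (A, tx.sn) (c.loc V).executed ∧
        (c'.loc V).consumed = (c.loc V).consumed ∪ {q | q.1 = A ∧ q.2 ∈ tx.objs} ∧
        (tx.IsUARA A ∧ (∃ cr, (tx, cr) ∈ (c.loc V).effects ∧ ↑cr ⊆ (c'.loc V).created) ∨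
          tx.IsUA A ∧ (c.loc V).pobDecided A tx.sn = some tx ∧
            ↑(P.execUA tx).1 ⊆ (c'.loc V).created ∧ ↑(P.execUA tx).2 ⊆ (c'.loc V).active) := by
  rcases h.locStep V with h | h | ⟨A, tx, hA, hver, rfl⟩ | ⟨Y, m, B, hB, hnew, rfl⟩ |
    ⟨A, sn, tx, htx, hnew, rfl⟩
  · rw [h]; exact .inl ⟨rfl, rfl⟩
  · cases h
    case finish A tx cr hA he hnew hready =>
      exact .inr ⟨A, tx, hready, hnew, by simp, by simp, .inl ⟨hA, cr, he, by simp⟩⟩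
    case execUA A tx hA hdec hver hnew hready =>
      exact .inr ⟨A, tx, hready, hnew, by simp, by simp, .inr ⟨hA, hdec, by simp, by simp⟩⟩
    all_goals exact .inl ⟨by simp, by simp⟩
  all_goals exact .inl ⟨by simp, by simp⟩

theorem Step.pool_origin (h : Step P E c c') {V : Val} {X : RA} {u : Tx UA RA Obj Code}
    (hb : u ∈ ((c'.loc V).ra X).pool) : u ∈ ((c.loc V).ra X).pool ∨
      u.recipient = some X ∧ (u.IsRARA ∨
        ∃ A, u.IsUARA A ∧ u ∈ (c.loc V).waiting ∧ (c.loc V).Ready A u) := by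
  rcases h.locStep V with h | h | ⟨A, tx, hA, hver, rfl⟩ | ⟨Y, m, B, hB, hnew, rfl⟩ |
    ⟨A, sn, tx, htx, hnew, rfl⟩
  · rw [h] at hb; exact .inl hb
  · cases h
    case decide Y k B _ _ =>
      simp at hb
      exact ((applyDecision_decides P Y k B c.now (c.loc V)).pool X u hb).imp_right
        fun h => ⟨h.2, .inl h.1⟩
    all_goals simp at hb
    all_goals grind
  all_goals simp at hb
  all_goals grind

/-- No step puts an executed transaction into a pool or leaves one there. -/
theorem Step.pool_done_origin (h : Step P E c c') {V : Val} {X : RA} {u : Tx UA RA Obj Code}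
    (hb : u ∈ ((c'.loc V).ra X).pool) (hd : u ∈ ((c'.loc V).ra X).done) :
    u ∈ ((c.loc V).ra X).pool ∧ u ∈ ((c.loc V).ra X).done := by
  rcases h.locStep V with h | h | ⟨A, tx, hA, hver, rfl⟩ | ⟨Y, m, B, hB, hnew, rfl⟩ |
    ⟨A, sn, tx, htx, hnew, rfl⟩
  · rw [h] at hb hd; exact ⟨hb, hd⟩
  · cases h
    case decide Y k B _ _ =>
      simp at hb hd
      exact (applyDecision_decides P Y k B c.now (c.loc V)).pool_done X u hb hd
    all_goals simp at hb hd
    all_goals grind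
  all_goals simp at hb hd
  all_goals grind

/-- Either `V` decides a block in this step, or its cores and decisions stay as they are. -/
theorem Step.decide_or (h : Step P E c c') (V : Val) :
    (∃ X k B, c.InInstance V X k ∧ CanDecide P E c V X k B ∧
      c'.loc V = applyDecision P X k B c.now (c.loc V) ∧
      c'.sent = insert (V, .proof X k B, c.now) c.sent) ∨
    (∀ X, (c'.loc V).core X = (c.loc V).core X) ∧
      (∀ X, ((c'.loc V).ra X).decided = ((c.loc V).ra X).decided) ∧
      (c'.loc V).effects = (c.loc V).effects := by
  rcases h.locStep V with h | h | ⟨A, tx, hA, hver, rfl⟩ | ⟨Y, m, B, hB, hnew, rfl⟩ |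
    ⟨A, sn, tx, htx, hnew, rfl⟩
  · rw [h]; exact .inr ⟨fun _ => rfl, fun _ => rfl, rfl⟩
  · cases h
    case decide X k B hin hdec =>
      exact .inl ⟨X, k, B, hin, hdec, by simp, by simp [Config.bcast, Config.setLoc]⟩
    case forward A tx _ _ _ =>
      right
      simp only [Config.setLoc_loc_self]
      exact ⟨fun X => (addPool_core _ _ X).trans rfl, fun X => by simp, by simp⟩
    all_goals
      right
      simp [Local.core]
  all_goals
    right
    simp [Local.core]

/-- Where the facts that hold at `V` come from. -/
theorem Step.holds_origin (h : Step P E c c') {V : Val} {φ : Fact UA RA Obj Code}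
    (hb : (c'.loc V).Holds φ) : (c.loc V).Holds φ ∨
      (∃ X k B, c.InInstance V X k ∧ CanDecide P E c V X k B ∧
        (V, .proof X k B, c.now) ∈ c'.sent ∧
        (emitsList P X ((c.loc V).core X) (P.order B) φ ∨ φ = .decided X k B)) ∨
      (∃ A tx cr, tx.IsUARA A ∧ (tx, cr) ∈ (c.loc V).effects ∧ (c.loc V).Ready A tx ∧
        (φ = .executed (A, tx.sn) ∨ ∃ q ∈ cr, φ = .created q)) ∨
      (∃ A tx, tx.IsUA A ∧ (c.loc V).pobDecided A tx.sn = some tx ∧ c.Verify E tx ∧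
        (c.loc V).Ready A tx ∧ (φ = .executed (A, tx.sn) ∨
          (∃ q ∈ (P.execUA tx).1, φ = .created q) ∨ ∃ Y ∈ (P.execUA tx).2, φ = .active Y)) ∨
      ∃ A tx, CanPobDecide P E c V A tx ∧ (V, .pobProof A tx.sn tx, c.now) ∈ c'.sent ∧
        φ = .pobDecided A tx.sn tx := by
  rcases h.locStep V with h | h | ⟨A, tx, hA, hver, rfl⟩ | ⟨Y, m, B, hB, hnew, rfl⟩ |
    ⟨A, sn, tx, htx, hnew, rfl⟩
  · rw [h] at hb; exact .inl hb
  · cases h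
    case decide X k B hin hdec =>
      simp at hb
      by_cases hφ : ∀ Y m C, φ ≠ .decided Y m C
      · rcases ((applyDecision_decides P X k B c.now (c.loc V)).holds φ hφ).1 hb with h | h
        · exact .inl h
        · exact .inr (.inl ⟨X, k, B, hin, hdec, by simp [Config.bcast, Config.setLoc], .inl h⟩)
      · push Not at hφ
        obtain ⟨Y, m, C, rfl⟩ := hφ
        obtain ⟨t, ht⟩ := hb
        rw [applyDecision_ra_decided] at ht
        by_cases hY : Y = X ∧ m = k
        · obtain ⟨rfl, rfl⟩ := hY
          simp at ht
          exact .inr (.inl ⟨Y, m, B, hin, hdec, by simp [Config.bcast, Config.setLoc],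
            .inr (by rw [ht.1])⟩)
        · refine .inl ⟨t, ?_⟩
          grind
    case finish A tx cr hA he hnew hready =>
      cases φ <;> simp [Local.Holds] at hb ⊢ <;> grind
    case execUA A tx hA hdec hver hnew hready =>
      cases φ <;> simp [Local.Holds] at hb ⊢ <;> grind
    case pobDecide A tx hnew hdec =>
      cases φ
      case pobDecided A' m' tx' =>
        simp [Local.Holds] at hb
        by_cases hA : A' = A ∧ m' = tx.sn
        · obtain ⟨rfl, rfl⟩ := hA
          simp at hb
          subst hb
          exact .inr (.inr (.inr (.inr ⟨A', tx, hdec, by simp [Config.bcast, Config.setLoc], rfl⟩)))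
        · rw [if_neg hA] at hb
          exact .inl hb
      all_goals
        simp [Local.Holds] at hb
        exact .inl hb
    case forward A tx hA hw hready =>
      cases φ
      case arrived t =>
        left
        simp [Local.Holds] at hb ⊢
        grind [Tx.IsRARA, Tx.IsUARA]
      all_goals
        simp [Local.Holds] at hb
        exact .inl hb
    all_goals
      left
      cases φ <;> simp [Local.Holds] at hb ⊢ <;> grind
  all_goals
    left
    cases φ <;> simp [Local.Holds] at hb ⊢ <;> grind

/-! ### Messages, proposals and user transactions -/

/-- What only grows in a configuration. -/
structure Config.Le (c c' : Config Val UA RA Obj Code State) : Prop where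
  now : c.now ≤ c'.now
  sent : c.sent ⊆ c'.sent
  inbox : ∀ V, c.inbox V ⊆ c'.inbox V
  emitted : c.emitted ⊆ c'.emitted
  qcCert : c.qcCert ⊆ c'.qcCert
  taCert : c.taCert ⊆ c'.taCert
  loc : ∀ V, (c.loc V).Le (c'.loc V)

theorem Config.Le.refl (c : Config Val UA RA Obj Code State) : c.Le c :=
  ⟨le_rfl, subset_rfl, fun _ => subset_rfl, subset_rfl, subset_rfl, subset_rfl, fun _ => .refl _⟩

theorem Config.Le.trans {c c' c'' : Config Val UA RA Obj Code State} (h : c.Le c')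
    (h' : c'.Le c'') : c.Le c'' :=
  ⟨h.1.trans h'.1, h.2.trans h'.2, fun V => (h.3 V).trans (h'.3 V), h.4.trans h'.4,
    h.5.trans h'.5, h.6.trans h'.6, fun V => (h.7 V).trans (h'.7 V)⟩

theorem Config.Le.verify (h : c.Le c') {tx : Tx UA RA Obj Code} (hv : c.Verify E tx) :
    c'.Verify E tx := fun A hA hA' => (hv A hA hA').imp fun _ h' => h.emitted h'

theorem Act.now (h : Act P E V c c') : c'.now = c.now := by
  cases h <;> try rfl
  dsimp only
  split_ifs <;> rfl

theorem Act.rest {V : Val} (h : Act P E V c c') : c'.inbox = c.inbox ∧ c'.emitted = c.emitted ∧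
    c'.nextSn = c.nextSn ∧ c'.qcCert = c.qcCert ∧ c'.taCert = c.taCert := by
  cases h <;> try exact ⟨rfl, rfl, rfl, rfl, rfl⟩
  dsimp only
  split_ifs <;> exact ⟨rfl, rfl, rfl, rfl, rfl⟩

theorem receiveTx_sent (V : Val) (A : UA) (tx : Tx UA RA Obj Code) :
    (receiveTx c V A tx).sent = c.sent ∨ ∃ v, (receiveTx c V A tx).sent =
      insert (V, .pobVote A tx.sn v, c.now) c.sent ∧
        ∀ u, v = some u → u = tx ∧ ((receiveTx c V A tx).loc V).fpLock A tx.sn = some tx := by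
  rw [receiveTx_loc_self]
  unfold receiveTx
  dsimp only
  split_ifs <;> first
    | exact .inl rfl
    | (exfalso; tauto)
    | exact .inr ⟨none, rfl, by simp⟩
    | exact .inr ⟨some tx, rfl, by simp⟩

theorem receiveTx_rest (V : Val) (A : UA) (tx : Tx UA RA Obj Code) :
    (receiveTx c V A tx).now = c.now ∧ (receiveTx c V A tx).inbox = c.inbox ∧
      (receiveTx c V A tx).emitted = c.emitted ∧ (receiveTx c V A tx).nextSn = c.nextSn ∧
      (receiveTx c V A tx).qcProposed = c.qcProposed ∧
      (receiveTx c V A tx).taProposed = c.taProposed ∧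
      (receiveTx c V A tx).qcCert = c.qcCert ∧ (receiveTx c V A tx).taCert = c.taCert := by
  unfold receiveTx
  dsimp only
  split_ifs <;> exact ⟨rfl, rfl, rfl, rfl, rfl, rfl, rfl, rfl⟩

/-- What an honest validator does when it sends a message. -/
def Sends (P : Params Val UA RA Obj Code State) (c c' : Config Val UA RA Obj Code State)
    (V : Val) : Msg UA RA Obj Code → Prop
  | .propose X k B => P.leader X k = V ∧ ((c.loc V).ra X).start k = none ∧
      ((c'.loc V).ra X).start k = some c.now ∧ B = ((c.loc V).ra X).pool
  | .vote X k v fb => c.InInstance V X k ∧ k ∈ ((c'.loc V).ra X).voted ∧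
      fb = ((c.loc V).ra X).pool ∧ ∃ B t, ((c.loc V).ra X).fp k = some (B, t) ∧
        (∀ tx ∈ B, ∀ A, tx.IsUARA A → ((c.loc V).ra X).fpReply k tx ≠ none) ∧
        v = if ∀ tx ∈ B, ∀ A, tx.IsUARA A → ((c.loc V).ra X).fpReply k tx = some true
          then some B else none
  | .proof X k B => c.InInstance V X k ∧ ((c'.loc V).ra X).decided k = some (B, c.now)
  | .pobVote A m v => ∀ tx, v = some tx → ((c'.loc V).fpLock A m) = some tx
  | .pobProof _ _ _ => True

theorem Act.sent_origin {V : Val} (h : Act P E V c c') :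
    c'.sent = c.sent ∨ ∃ m, c'.sent = insert (V, m, c.now) c.sent ∧ Sends P c c' V m := by
  cases h
  case initiate X k hact hnew hprev =>
    dsimp only
    split_ifs with hL
    · exact .inr ⟨_, rfl, hL, hnew, by simp, rfl⟩
    · exact .inl rfl
  case vote X k B t hin hfp hrep hnew =>
    exact .inr ⟨_, rfl, hin, by simp, rfl, B, t, hfp, hrep, rfl⟩
  case decide X k B hin hdec =>
    exact .inr ⟨_, rfl, hin, by simp [applyDecision_ra_decided]⟩
  case pobDecide A tx hnew hdec => exact .inr ⟨_, rfl, trivial⟩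
  all_goals exact .inl rfl

theorem Step.sent_origin (h : Step P E c c') {V : Val} {m : Msg UA RA Obj Code} {τ : ℝ}
    (hb : (V, m, τ) ∈ c'.sent) :
    (V, m, τ) ∈ c.sent ∨ V ∈ E.honest ∧ τ = c.now ∧ Sends P c c' V m := by
  rcases h with ⟨W, hW, _, h⟩ | ⟨_, h⟩ | _
  · rcases h.sent_origin with h' | ⟨m', h', hm⟩
    · rw [h'] at hb; exact .inl hb
    · rw [h', Set.mem_insert_iff] at hb
      rcases hb with hb | hb
      · simp only [Prod.mk.injEq] at hb
        obtain ⟨rfl, rfl, rfl⟩ := hb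
        exact .inr ⟨hW, rfl, hm⟩
      · exact .inl hb
  · cases h
    case deliverTx W A tx hW hA hver hnew =>
      rcases receiveTx_sent (c := c) W A tx with h' | ⟨v, h', hm⟩
      · rw [h'] at hb; exact .inl hb
      · rw [h', Set.mem_insert_iff] at hb
        rcases hb with hb | hb
        · simp only [Prod.mk.injEq] at hb
          obtain ⟨rfl, rfl, rfl⟩ := hb
          refine .inr ⟨hW, rfl, fun u hu => ?_⟩
          obtain ⟨rfl, h2⟩ := hm u hu
          exact h2
        · exact .inl hb
    all_goals exact .inl hb
  · exact .inl hb

theorem Step.le (h : Step P E c c') : c.Le c' := by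
  have hloc := h.local_le
  rcases h with ⟨W, hW, _, h⟩ | ⟨_, h⟩ | ⟨t, ht⟩
  · obtain ⟨h1, h2, h3, h4, h5⟩ := h.rest
    refine ⟨h.now.ge, ?_, fun V => by rw [h1], by rw [h2], by rw [h4], by rw [h5], hloc⟩
    rcases h.sent_origin with h' | ⟨m', h', hm⟩
    · rw [h']
    · rw [h']; exact Set.subset_insert _ _
  · cases h
    case deliverTx W A tx hW hA hver hnew =>
      obtain ⟨h1, h2, h3, h4, h5, h6, h7, h8⟩ := receiveTx_rest (c := c) W A tx
      refine ⟨h1.ge, ?_, fun V => by rw [h2], by rw [h3], by rw [h7], by rw [h8], hloc⟩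
      rcases receiveTx_sent (c := c) W A tx with h' | ⟨v, h', hm⟩
      · rw [h']
      · rw [h']; exact Set.subset_insert _ _
    all_goals
      refine ⟨le_rfl, ?_, ?_, ?_, ?_, ?_, hloc⟩ <;> first
        | exact subset_rfl
        | exact fun _ => subset_rfl
        | exact Set.subset_insert _ _
        | skip
    case refine_2 U V m hm =>
      intro W
      by_cases hW : W = V
      · subst hW; simp
      · simp [hW]
  · exact ⟨ht, subset_rfl, fun _ => subset_rfl, subset_rfl, subset_rfl, subset_rfl, hloc⟩

theorem Step.inbox_origin (h : Step P E c c') {U V : Val} {m : Msg UA RA Obj Code}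
    (hb : (U, m) ∈ c'.inbox V) :
    (U, m) ∈ c.inbox V ∨ (U ∈ E.honest → ∃ τ, (U, m, τ) ∈ c.sent) := by
  rcases h with ⟨W, hW, _, h⟩ | ⟨_, h⟩ | ⟨t, ht⟩
  · rw [h.rest.1] at hb; exact .inl hb
  · cases h
    case deliverTx W A tx hW hA hver hnew =>
      rw [(receiveTx_rest (c := c) W A tx).2.1] at hb; exact .inl hb
    case deliver U' V' m' hm =>
      by_cases hW : V = V'
      · subst hW
        simp at hb
        grind
      · simp [hW] at hb
        exact .inl hb
    all_goals exact .inl hb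
  · exact .inl hb

theorem Step.emitted_origin (h : Step P E c c') : c'.emitted = c.emitted ∧ c'.nextSn = c.nextSn ∨
    ∃ A tx, tx.issuer = some A ∧ A ∈ E.honestUser ∧ tx.sn = c.nextSn A ∧
      c'.emitted = insert (tx, c.now) c.emitted ∧
      c'.nextSn = Function.update c.nextSn A (c.nextSn A + 1) := by
  rcases h with ⟨W, hW, _, h⟩ | ⟨_, h⟩ | ⟨t, ht⟩
  · exact .inl ⟨h.rest.2.1, h.rest.2.2.1⟩
  · cases h
    case deliverTx W A tx hW hA hver hnew =>
      have := receiveTx_rest (c := c) W A tx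
      exact .inl ⟨this.2.2.1, this.2.2.2.1⟩
    case emit A tx hA htx hsn hobj hfresh hprev => exact .inr ⟨A, tx, htx, hA, hsn, rfl, rfl⟩
    all_goals exact .inl ⟨rfl, rfl⟩
  · exact .inl ⟨rfl, rfl⟩

theorem Step.qcProposed_origin (h : Step P E c c') {V : Val} {X : RA} {k : ℕ}
    {D : Block UA RA Obj Code} (hb : (V, X, k, D) ∈ c'.qcProposed) :
    (V, X, k, D) ∈ c.qcProposed ∨ ((c.loc V).ra X).cand k = some D ∨
      ∃ C, ((c.loc V).ra X).cand₂ k = some C ∧ D ⊆ C := by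
  rcases h with ⟨W, hW, _, h⟩ | ⟨_, h⟩ | ⟨t, ht⟩
  · cases h
    case initiate =>
      left
      dsimp only at hb
      split_ifs at hb <;> exact hb
    case spPropose X' k' B hin hc hrep hnew =>
      simp at hb
      grind
    case fbPropose X' k' C hin hc hrep hnew =>
      simp at hb
      rcases hb with ⟨rfl, rfl, rfl, rfl⟩ | hb
      · exact .inr (.inr ⟨C, hc, Finset.filter_subset _ _⟩)
      · exact .inl hb
    all_goals exact .inl hb
  · cases h
    case deliverTx W A tx hW hA hver hnew =>
      rw [(receiveTx_rest (c := c) W A tx).2.2.2.2.1] at hb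
      exact .inl hb
    all_goals exact .inl hb
  · exact .inl hb

theorem Step.taProposed_origin (h : Step P E c c') {V : Val} {A : UA} {m : ℕ}
    {w : Tx UA RA Obj Code} (hb : (V, A, m, w) ∈ c'.taProposed) :
    (V, A, m, w) ∈ c.taProposed ∨ (c'.loc V).spLock A m = some w := by
  rcases h with ⟨W, hW, _, h⟩ | ⟨_, h⟩ | ⟨t, ht⟩
  · cases h
    case initiate =>
      left
      dsimp only at hb
      split_ifs at hb <;> exact hb
    case taPropose X k B A' tx w' hin hqc htx hA hnew hw =>
      simp only [Set.mem_insert_iff, Prod.mk.injEq] at hb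
      rcases hb with ⟨rfl, rfl, rfl, rfl⟩ | hb
      · right
        simpa using hw
      · exact .inl hb
    case pobPropose A' tx hvotes hlock hnew =>
      simp only [Set.mem_insert_iff, Prod.mk.injEq] at hb
      rcases hb with ⟨rfl, rfl, rfl, rfl⟩ | hb
      · right
        simp
        grind
      · exact .inl hb
    all_goals exact .inl hb
  · cases h
    case deliverTx W A tx hW hA hver hnew =>
      rw [(receiveTx_rest (c := c) W A tx).2.2.2.2.2.1] at hb
      exact .inl hb
    all_goals exact .inl hb
  · exact .inl hb

/-! ### Invariants of executions -/

namespace IsExecution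

theorem le (hrun : IsExecution P E run) {i j : ℕ} (h : i ≤ j) : (run i).Le (run j) := by
  induction h with
  | refl => exact .refl _
  | step _ ih => exact ih.trans (hrun.step _).le

theorem loc_le (hrun : IsExecution P E run) {i j : ℕ} (h : i ≤ j) (V : Val) :
    ((run i).loc V).Le ((run j).loc V) := (hrun.le h).loc V

theorem fpLock_spec (hrun : IsExecution P E run) {i : ℕ} {V : Val} {A : UA} {m : ℕ}
    {u : Tx UA RA Obj Code} (h : ((run i).loc V).fpLock A m = some u) :
    u.issuer = some A ∧ u.sn = m ∧ (run i).Verify E u := by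
  induction i with
  | zero => rw [hrun.init] at h; simp [initConfig, initLocal] at h
  | succ i ih =>
    have hs := hrun.step i
    rcases hs.fpLock_origin h with h | h
    · exact ⟨(ih h).1, (ih h).2.1, hs.le.verify (ih h).2.2⟩
    · exact ⟨h.1, h.2.1, hs.le.verify h.2.2⟩

theorem emitted_spec (hrun : IsExecution P E run) (i : ℕ) :
    (∀ tx τ, (tx, τ) ∈ (run i).emitted → ∀ A, tx.issuer = some A → tx.sn < (run i).nextSn A) ∧
    ∀ tx τ tx' τ', (tx, τ) ∈ (run i).emitted → (tx', τ') ∈ (run i).emitted →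
      tx.issuer = tx'.issuer → tx.issuer ≠ none → tx.sn = tx'.sn → tx = tx' := by
  induction i with
  | zero => rw [hrun.init]; simp [initConfig]
  | succ i ih =>
    rcases (hrun.step i).emitted_origin with ⟨h1, h2⟩ | ⟨A, tx, htx, -, hsn, h1, h2⟩
    · rw [h1, h2]; exact ih
    · rw [h1, h2]
      have key : ∀ u τ, (u, τ) ∈ (run i).emitted → u.issuer = tx.issuer → u.sn ≠ tx.sn := by
        intro u τ hu hi
        have := ih.1 u τ hu A (hi.trans htx)
        omega
      refine ⟨fun u τ hu A' hA' => ?_, fun u τ u' τ' hu hu' hi hne hsn' => ?_⟩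
      · rcases Set.mem_insert_iff.1 hu with hu | hu
        · obtain ⟨rfl, -⟩ := Prod.mk.inj hu
          obtain rfl : A = A' := Option.some.inj (htx.symm.trans hA')
          simp [hsn]
        · have := ih.1 u τ hu A' hA'
          by_cases hAA : A' = A
          · subst hAA; simp; omega
          · simpa [hAA] using this
      · rcases Set.mem_insert_iff.1 hu with g | g <;>
          rcases Set.mem_insert_iff.1 hu' with g' | g'
        · rw [(Prod.mk.inj g).1, (Prod.mk.inj g').1]
        · obtain ⟨rfl, -⟩ := Prod.mk.inj g
          exact absurd hsn'.symm (key u' τ' g' hi.symm)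
        · obtain ⟨rfl, -⟩ := Prod.mk.inj g'
          exact absurd hsn' (key u τ g hi)
        · exact ih.2 u τ u' τ' g g' hi hne hsn'

/-- An honest user signs at most one transaction per sequence number. -/
theorem verify_unique (hrun : IsExecution P E run) {i j : ℕ} {A : UA} {tx tx' : Tx UA RA Obj Code}
    (hA : A ∈ E.honestUser) (h : (run i).Verify E tx) (h' : (run j).Verify E tx')
    (hi : tx.issuer = some A) (hi' : tx'.issuer = some A) (hsn : tx.sn = tx'.sn) : tx = tx' := by
  obtain ⟨τ, hτ⟩ := (hrun.le (le_max_left i j)).verify h A hi hA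
  obtain ⟨τ', hτ'⟩ := (hrun.le (le_max_right i j)).verify h' A hi' hA
  exact (hrun.emitted_spec (max i j)).2 _ _ _ _ hτ hτ' (hi.trans hi'.symm) (by simp [hi]) hsn

theorem waiting_spec (hrun : IsExecution P E run) {i : ℕ} {V : Val} {u : Tx UA RA Obj Code}
    (h : u ∈ ((run i).loc V).waiting) :
    ∃ A, u.IsUARA A ∧ ((run i).loc V).fpLock A u.sn = some u := by
  induction i with
  | zero => rw [hrun.init] at h; simp [initConfig, initLocal] at h
  | succ i ih =>
    rcases (hrun.step i).waiting_origin h with h | h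
    · exact (ih h).imp fun A h => ⟨h.1, ((hrun.step i).local_le V).fpLock _ _ _ h.2⟩
    · exact h

theorem pool_spec (hrun : IsExecution P E run) {i : ℕ} {V : Val} {X : RA}
    {u : Tx UA RA Obj Code} (h : u ∈ (((run i).loc V).ra X).pool) :
    u.recipient = some X ∧ (u.IsRARA ∨ ∃ A, u.IsUARA A ∧ ((run i).loc V).fpLock A u.sn = some u ∧
      ∃ i' ≤ i, ((run i').loc V).Ready A u) := by
  induction i with
  | zero => rw [hrun.init] at h; simp [initConfig, initLocal, initRA] at h
  | succ i ih =>
    have hle := (hrun.step i).local_le V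
    rcases (hrun.step i).pool_origin h with h | ⟨hX, h⟩
    · obtain ⟨h1, h2⟩ := ih h
      refine ⟨h1, h2.imp_right ?_⟩
      rintro ⟨A, hA, hl, i', hi', hr⟩
      exact ⟨A, hA, hle.fpLock _ _ _ hl, i', by omega, hr⟩
    · refine ⟨hX, h.imp_right ?_⟩
      rintro ⟨A, hA, hw, hr⟩
      obtain ⟨A', hA', hl⟩ := hrun.waiting_spec hw
      obtain rfl : A = A' := Option.some.inj (hA.1.symm.trans hA'.1)
      exact ⟨A, hA, hle.fpLock _ _ _ hl, i, by omega, hr⟩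

theorem notMem_done_of_mem_pool (hrun : IsExecution P E run) {i : ℕ} {V : Val} {X : RA}
    {u : Tx UA RA Obj Code} (h : u ∈ (((run i).loc V).ra X).pool) :
    u ∉ (((run i).loc V).ra X).done := by
  induction i with
  | zero => rw [hrun.init]; simp [initConfig, initLocal, initRA]
  | succ i ih =>
    intro hd
    obtain ⟨h1, h2⟩ := (hrun.step i).pool_done_origin h hd
    exact ih h1 h2

theorem fp_spec (hrun : IsExecution P E run) {i : ℕ} {V : Val} {X : RA} {k : ℕ} {b}
    (h : (((run i).loc V).ra X).fp k = some b) : (∀ tx ∈ b.1, tx.recipient = some X) ∧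
      ∃ i' < i, b.2 = (run i').now ∧ (P.leader X k, Msg.propose X k b.1) ∈ (run i').inbox V := by
  induction i with
  | zero => rw [hrun.init] at h; simp [initConfig, initLocal, initRA] at h
  | succ i ih =>
    rcases (hrun.step i).fp_origin h with h | ⟨h1, h2, h3⟩
    · obtain ⟨h1, i', hi', h2⟩ := ih h
      exact ⟨h1, i', by omega, h2⟩
    · exact ⟨h3, i, by omega, h1, h2⟩

theorem fpReply_spec (hrun : IsExecution P E run) {i : ℕ} {V : Val} {X : RA} {k : ℕ}
    {u : Tx UA RA Obj Code} {b : Bool} (h : (((run i).loc V).ra X).fpReply k u = some b) :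
    ∃ i' < i, ∃ B t A, (((run i').loc V).ra X).fp k = some (B, t) ∧ u ∈ B ∧ u.IsUARA A ∧
      (b = true → ((run i').loc V).fpLock A u.sn = some u) ∧
      (b = false → ¬ (run i').Verify E u ∨
        (∃ tx', ((run i').loc V).fpLock A u.sn = some tx' ∧ tx' ≠ u) ∨
        t + P.Δ < (run i').now) := by
  induction i with
  | zero => rw [hrun.init] at h; simp [initConfig, initLocal, initRA] at h
  | succ i ih =>
    rcases (hrun.step i).fpReply_origin h with h | h
    · obtain ⟨i', hi', h⟩ := ih h
      exact ⟨i', by omega, h⟩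
    · exact ⟨i, by omega, h⟩

theorem cand_spec (hrun : IsExecution P E run) {i : ℕ} {V : Val} {X : RA} {k : ℕ}
    {B : Block UA RA Obj Code} (h : (((run i).loc V).ra X).cand k = some B) :
    ∃ i' < i, (run i').InInstance V X k ∧ (run i').TimerExpired P V X k ∧
      Nat.card Val ≤ ((run i').votersFor V X k B).ncard + P.p + 2 * P.f := by
  induction i with
  | zero => rw [hrun.init] at h; simp [initConfig, initLocal, initRA] at h
  | succ i ih =>
    rcases (hrun.step i).cand_origin h with h | h
    · obtain ⟨i', hi', h⟩ := ih h
      exact ⟨i', by omega, h⟩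
    · exact ⟨i, by omega, h⟩

theorem spReply_spec (hrun : IsExecution P E run) {i : ℕ} {V : Val} {X : RA} {k : ℕ}
    {u : Tx UA RA Obj Code} (h : (((run i).loc V).ra X).spReply k u = some false) :
    ∃ i' A w, u.IsUARA A ∧ ((run i').loc V).spLock A u.sn = some w ∧ w ≠ u := by
  induction i with
  | zero => rw [hrun.init] at h; simp [initConfig, initLocal, initRA] at h
  | succ i ih => exact ((hrun.step i).spReply_origin h).elim ih fun h => ⟨_, h⟩

theorem needFallback_spec (hrun : IsExecution P E run) {i : ℕ} {V : Val} {X : RA} {k : ℕ}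
    (h : k ∈ (((run i).loc V).ra X).needFallback) : ∃ i' < i, (run i').InInstance V X k ∧
      ((run i').TimerExpired P V X k ∧ Nat.card Val ≤ ((run i').voters V X k).ncard + P.f ∧
          (∀ B, ¬ Nat.card Val ≤ ((run i').votersFor V X k B).ncard + P.p + 2 * P.f) ∨
        ∃ B, (((run i').loc V).ra X).cand k = some B ∧
          ∃ u ∈ B, ∃ A, u.IsUARA A ∧ (((run i').loc V).ra X).spReply k u = some false) := by
  induction i with
  | zero => rw [hrun.init] at h; simp [initConfig, initLocal, initRA] at h
  | succ i ih =>
    rcases (hrun.step i).needFallback_origin h with h | h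
    · obtain ⟨i', hi', h⟩ := ih h
      exact ⟨i', by omega, h⟩
    · exact ⟨i, by omega, h⟩

theorem cand₂_spec (hrun : IsExecution P E run) {i : ℕ} {V : Val} {X : RA} {k : ℕ}
    {C : Block UA RA Obj Code} (h : (((run i).loc V).ra X).cand₂ k = some C) :
    ∃ i', k ∈ (((run i').loc V).ra X).needFallback ∧
      ∀ u ∈ C, Nat.card Val ≤ ((run i').fallbacksWith V X k u).ncard + 2 * P.f := by
  induction i with
  | zero => rw [hrun.init] at h; simp [initConfig, initLocal, initRA] at h
  | succ i ih => exact ((hrun.step i).cand₂_origin h).elim ih fun h => ⟨_, h⟩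

theorem qcDecided_spec (hrun : IsExecution P E run) {i : ℕ} {V : Val} {X : RA} {k : ℕ}
    {B : Block UA RA Obj Code} (h : (((run i).loc V).ra X).qcDecided k = some B) :
    (X, k, B) ∈ (run i).qcCert := by
  induction i with
  | zero => rw [hrun.init] at h; simp [initConfig, initLocal, initRA] at h
  | succ i ih =>
    have hs := hrun.step i
    exact hs.le.qcCert ((hs.qcDecided_origin h).elim ih id)

theorem taDecided_spec (hrun : IsExecution P E run) {i : ℕ} {V : Val} {A : UA} {m : ℕ}
    {u : Tx UA RA Obj Code} (h : ((run i).loc V).taDecided A m = some u) :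
    (A, m, u) ∈ (run i).taCert := by
  induction i with
  | zero => rw [hrun.init] at h; simp [initConfig, initLocal] at h
  | succ i ih =>
    have hs := hrun.step i
    exact hs.le.taCert ((hs.taDecided_origin h).elim ih id)

theorem taAsked_spec (hrun : IsExecution P E run) {i : ℕ} {V : Val} {X : RA} {k : ℕ}
    {u : Tx UA RA Obj Code} (h : (k, u) ∈ (((run i).loc V).ra X).taAsked) :
    ∃ i' B, (X, k, B) ∈ (run i').qcCert ∧ u ∈ B := by
  induction i with
  | zero => rw [hrun.init] at h; simp [initConfig, initLocal, initRA] at h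
  | succ i ih =>
    rcases (hrun.step i).taAsked_origin h with h | ⟨B, hB, hu⟩
    · exact ih h
    · exact ⟨i, B, hrun.qcDecided_spec hB, hu⟩

theorem spLock_spec (hrun : IsExecution P E run) {i : ℕ} {V : Val} {A : UA} {m : ℕ}
    {u : Tx UA RA Obj Code} (h : ((run i).loc V).spLock A m = some u) : u.sn = m ∧
      ∃ i', u.IsUARA A ∧ (∃ X k B, u ∈ B ∧ ((((run i').loc V).ra X).cand k = some B ∨
          (((run i').loc V).ra X).cand₂ k = some B ∨ (X, k, B) ∈ (run i').qcCert)) ∨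
        Nat.card Val ≤ ((run i').pobVotersFor V A u).ncard + P.p + 2 * P.f := by
  induction i with
  | zero => rw [hrun.init] at h; simp [initConfig, initLocal] at h
  | succ i ih =>
    rcases (hrun.step i).spLock_origin h with h | ⟨h, h'⟩
    · exact ih h
    · refine ⟨h, i, h'.imp_left ?_⟩
      rintro ⟨h1, X, k, B, hu, hB⟩
      exact ⟨h1, X, k, B, hu, hB.imp_right fun h => h.imp_right hrun.qcDecided_spec⟩

theorem sent_spec (hrun : IsExecution P E run) {i : ℕ} {V : Val} {m : Msg UA RA Obj Code} {τ : ℝ}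
    (h : (V, m, τ) ∈ (run i).sent) :
    V ∈ E.honest ∧ ∃ i' < i, τ = (run i').now ∧ Sends P (run i') (run (i' + 1)) V m := by
  induction i with
  | zero => rw [hrun.init] at h; simp [initConfig] at h
  | succ i ih =>
    rcases (hrun.step i).sent_origin h with h | ⟨h1, h2, h3⟩
    · obtain ⟨h1, i', hi', h2⟩ := ih h
      exact ⟨h1, i', by omega, h2⟩
    · exact ⟨h1, i, by omega, h2, h3⟩

theorem inbox_spec (hrun : IsExecution P E run) {i : ℕ} {U V : Val} {m : Msg UA RA Obj Code}
    (h : (U, m) ∈ (run i).inbox V) (hU : U ∈ E.honest) : ∃ τ, (U, m, τ) ∈ (run i).sent := by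
  induction i with
  | zero => rw [hrun.init] at h; simp [initConfig] at h
  | succ i ih =>
    have hs := hrun.step i
    rcases hs.inbox_origin h with h | h
    · exact (ih h).imp fun _ h => hs.le.sent h
    · exact (h hU).imp fun _ h => hs.le.sent h

theorem qcProposed_spec (hrun : IsExecution P E run) {i : ℕ} {V : Val} {X : RA} {k : ℕ}
    {D : Block UA RA Obj Code} (h : (V, X, k, D) ∈ (run i).qcProposed) :
    ∃ i', (((run i').loc V).ra X).cand k = some D ∨
      ∃ C, (((run i').loc V).ra X).cand₂ k = some C ∧ D ⊆ C := by
  induction i with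
  | zero => rw [hrun.init] at h; simp [initConfig] at h
  | succ i ih => exact ((hrun.step i).qcProposed_origin h).elim ih fun h => ⟨_, h⟩

theorem taProposed_spec (hrun : IsExecution P E run) {i : ℕ} {V : Val} {A : UA} {m : ℕ}
    {w : Tx UA RA Obj Code} (h : (V, A, m, w) ∈ (run i).taProposed) :
    ((run i).loc V).spLock A m = some w := by
  induction i with
  | zero => rw [hrun.init] at h; simp [initConfig] at h
  | succ i ih =>
    exact ((hrun.step i).taProposed_origin h).elim
      (fun h => ((hrun.step i).local_le V).spLock _ _ _ (ih h)) id

theorem start_spec (hrun : IsExecution P E run) {i : ℕ} {V : Val} {X : RA} {k : ℕ} {t : ℝ}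
    (h : (((run i).loc V).ra X).start k = some t) : ∃ i' < i, t = (run i').now ∧
      X ∈ ((run i').loc V).active ∧ (((run i').loc V).ra X).start k = none ∧
      (((run (i' + 1)).loc V).ra X).start k = some t ∧
      (k = 0 ∨ (((run i').loc V).ra X).decided (k - 1) ≠ none) ∧
      (P.leader X k = V →
        (V, .propose X k (((run i').loc V).ra X).pool, t) ∈ (run (i' + 1)).sent) := by
  induction i with
  | zero => rw [hrun.init] at h; simp [initConfig, initLocal, initRA] at h
  | succ i ih =>
    rcases (hrun.step i).start_origin h with h' | ⟨h1, h2, h3, h4, h5⟩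
    · obtain ⟨i', hi', h'⟩ := ih h'
      exact ⟨i', by omega, h'⟩
    · exact ⟨i, by omega, h1, h2, h3, h, h4, by rw [h1]; exact h5⟩

theorem pobDecided_spec (hrun : IsExecution P E run) {i : ℕ} {V : Val} {A : UA} {m : ℕ}
    {u : Tx UA RA Obj Code} (h : ((run i).loc V).pobDecided A m = some u) :
    u.sn = m ∧ ∃ i' < i, CanPobDecide P E (run i') V A u := by
  induction i with
  | zero => rw [hrun.init] at h; simp [initConfig, initLocal] at h
  | succ i ih =>
    have hs := (hrun.step i).holds_origin (V := V) (φ := .pobDecided A m u) h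
    rcases hs with h | ⟨X, k, B, -, -, -, h | h⟩ | ⟨_, _, _, -, -, -, h | ⟨_, _, h⟩⟩ |
      ⟨_, _, -, -, -, -, h | ⟨_, _, h⟩ | ⟨_, _, h⟩⟩ | ⟨A', u', h1, -, h⟩
    · obtain ⟨h1, i', hi', h⟩ := ih h
      exact ⟨h1, i', by omega, h⟩
    · exact absurd h not_emitsList_pobDecided
    on_goal 7 =>
      injection h with h2 h3 h4
      subst h2 h3 h4
      exact ⟨rfl, i, by omega, h1⟩
    all_goals exact absurd h (by simp)

theorem decided_spec (hrun : IsExecution P E run) {i : ℕ} {V : Val} {X : RA} {k : ℕ}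
    {B : Block UA RA Obj Code} {d : ℝ} (h : (((run i).loc V).ra X).decided k = some (B, d)) :
    ∃ i' < i, (run i').InInstance V X k ∧ CanDecide P E (run i') V X k B ∧ d = (run i').now ∧
      (((run (i' + 1)).loc V).ra X).decided k = some (B, d) ∧
      (V, .proof X k B, d) ∈ (run (i' + 1)).sent := by
  induction i with
  | zero => rw [hrun.init] at h; simp [initConfig, initLocal, initRA] at h
  | succ i ih =>
    by_cases hold : (((run i).loc V).ra X).decided k = some (B, d)
    · obtain ⟨i', hi', h'⟩ := ih hold
      exact ⟨i', by omega, h'⟩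
    · rcases (hrun.step i).decide_or V with ⟨Y, m, C, hin, hdec, e, hs⟩ | ⟨-, h', -⟩
      · have h0 := h
        rw [e, applyDecision_ra_decided] at h
        split_ifs at h with hY
        · subst hY
          by_cases hk : k = m
          · subst hk
            simp only [Function.update_self, Option.some.injEq, Prod.mk.injEq] at h
            obtain ⟨rfl, rfl⟩ := h
            exact ⟨i, by omega, hin, hdec, rfl, h0, by rw [hs]; exact Set.mem_insert _ _⟩
          · rw [Function.update_of_ne hk] at h
            exact absurd h hold
        · exact absurd h hold
      · rw [h'] at h
        exact absurd h hold

/-- Decisions are stamped with the time at which they are taken. -/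
theorem now_le_of_undecided (hrun : IsExecution P E run) {i j : ℕ} {V : Val} {X : RA} {k : ℕ}
    {B : Block UA RA Obj Code} {d : ℝ} (h : (((run i).loc V).ra X).decided k = none)
    (h' : (((run j).loc V).ra X).decided k = some (B, d)) : (run i).now ≤ d := by
  obtain ⟨i', hi', -, -, rfl, h2, -⟩ := hrun.decided_spec h'
  rcases le_or_gt i i' with hle | hlt
  · exact (hrun.le hle).now
  · have := (hrun.loc_le (show i' + 1 ≤ i from hlt) V).decided _ _ _ h2
    rw [h] at this
    cases this

theorem start_of_decided (hrun : IsExecution P E run) {i : ℕ} {V : Val} {X : RA} {k : ℕ}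
    (h : (((run i).loc V).ra X).decided k ≠ none) : (((run i).loc V).ra X).start k ≠ none := by
  obtain ⟨⟨B, d⟩, hb⟩ := Option.ne_none_iff_exists'.1 h
  obtain ⟨i', hi', hin, -⟩ := hrun.decided_spec hb
  obtain ⟨t, ht⟩ := Option.ne_none_iff_exists'.1 hin.1
  rw [(hrun.loc_le hi'.le V).start _ _ _ ht]
  simp

/-- No message of an instance is sent after its decision. -/
theorem sent_le_decided (hrun : IsExecution P E run) {i j : ℕ} {V : Val} {X : RA} {k : ℕ}
    {B : Block UA RA Obj Code} {d τ : ℝ} {m : Msg UA RA Obj Code}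
    (h : (((run j).loc V).ra X).decided k = some (B, d)) (hm : (V, m, τ) ∈ (run i).sent)
    (hof : m.OfInstance X k) : τ ≤ d := by
  obtain ⟨-, i', -, rfl, hs⟩ := hrun.sent_spec hm
  refine hrun.now_le_of_undecided ?_ h
  cases m with
  | propose Y m C =>
    obtain ⟨rfl, rfl⟩ := hof
    by_contra hne
    exact hrun.start_of_decided hne hs.2.1
  | vote Y m v fb => obtain ⟨rfl, rfl⟩ := hof; exact hs.1.2
  | proof Y m C => obtain ⟨rfl, rfl⟩ := hof; exact hs.1.2
  | pobVote => exact hof.elim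
  | pobProof => exact hof.elim

/-- An honest vote can be read off the accepted proposal and the replies to the FP-lock requests.
These never change, so an honest validator votes once. -/
theorem vote_spec (hrun : IsExecution P E run) {i : ℕ} {V : Val} {X : RA} {k : ℕ}
    {v : Option (Block UA RA Obj Code)} {fb : Block UA RA Obj Code} {τ : ℝ}
    (h : (V, .vote X k v fb, τ) ∈ (run i).sent) : ∃ B t, (((run i).loc V).ra X).fp k = some (B, t) ∧
      (∀ tx ∈ B, ∀ A, tx.IsUARA A → (((run i).loc V).ra X).fpReply k tx ≠ none) ∧
      v = if ∀ tx ∈ B, ∀ A, tx.IsUARA A → (((run i).loc V).ra X).fpReply k tx = some true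
        then some B else none := by
  obtain ⟨-, i', hi', -, hs⟩ := hrun.sent_spec h
  obtain ⟨-, -, -, B, t, hfp, hrep, hv⟩ := hs
  have hle := hrun.loc_le hi'.le V
  have key : ∀ tx ∈ B, ∀ A, tx.IsUARA A →
      (((run i).loc V).ra X).fpReply k tx = (((run i').loc V).ra X).fpReply k tx := by
    intro tx htx A hA
    obtain ⟨b, hb⟩ := Option.ne_none_iff_exists'.1 (hrep tx htx A hA)
    rw [hb, hle.fpReply _ _ _ _ hb]
  refine ⟨B, t, hle.fp _ _ _ hfp, fun tx htx A hA => ?_, ?_⟩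
  · rw [key tx htx A hA]; exact hrep tx htx A hA
  · rw [hv]
    refine if_congr ?_ rfl rfl
    refine forall_congr' fun tx => forall_congr' fun htx => forall_congr' fun A =>
      forall_congr' fun hA => ?_
    rw [key tx htx A hA]

theorem vote_of_voted (hrun : IsExecution P E run) {i : ℕ} {V : Val} {X : RA} {k : ℕ}
    (h : k ∈ (((run i).loc V).ra X).voted) :
    ∃ v fb τ, (V, .vote X k v fb, τ) ∈ (run i).sent := by
  induction i with
  | zero => rw [hrun.init] at h; simp [initConfig, initLocal, initRA] at h
  | succ i ih =>
    rcases (hrun.step i).voted_origin h with h | h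
    · obtain ⟨v, fb, τ, h⟩ := ih h
      exact ⟨v, fb, τ, (hrun.step i).le.sent h⟩
    · exact h

theorem vote_unique (hrun : IsExecution P E run) {i j : ℕ} {V : Val} {X : RA} {k : ℕ}
    {v v' : Option (Block UA RA Obj Code)} {fb fb' : Block UA RA Obj Code} {τ τ' : ℝ}
    (h : (V, .vote X k v fb, τ) ∈ (run i).sent) (h' : (V, .vote X k v' fb', τ') ∈ (run j).sent) :
    v = v' := by
  obtain ⟨B, t, h1, -, h2⟩ := hrun.vote_spec ((hrun.le (le_max_left i j)).sent h)
  obtain ⟨B', t', h1', -, h2'⟩ := hrun.vote_spec ((hrun.le (le_max_right i j)).sent h')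
  rw [h1] at h1'
  obtain ⟨rfl, rfl⟩ := Prod.mk.inj (Option.some.inj h1')
  rw [h2, h2']

end IsExecution

/-! ### Quorums and agreement -/

theorem Tx.IsUARA.unique {A A' : UA} {tx : Tx UA RA Obj Code} (h : tx.IsUARA A)
    (h' : tx.IsUARA A') : A = A' := Option.some.inj (h.1.symm.trans h'.1)

theorem ncard_le_inter_add [Finite Val] (S H : Set Val) :
    S.ncard ≤ (S ∩ H).ncard + (Hᶜ).ncard := by
  calc S.ncard = (S ∩ H ∪ S ∩ Hᶜ).ncard := by rw [← Set.inter_union_distrib_left]; simp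
    _ ≤ (S ∩ H).ncard + (S ∩ Hᶜ).ncard := Set.ncard_union_le _ _
    _ ≤ _ := by gcongr; exacts [Set.toFinite _, Set.inter_subset_right]

theorem ncard_add_ncard_le [Finite Val] {S T H : Set Val} (hS : S ⊆ H) (hT : T ⊆ H) :
    S.ncard + T.ncard + (Hᶜ).ncard ≤ Nat.card Val + (S ∩ T).ncard := by
  have h1 := Set.ncard_union_add_ncard_inter S T
  have h2 : (S ∪ T).ncard ≤ H.ncard := Set.ncard_le_ncard (Set.union_subset hS hT) (Set.toFinite _)
  have h3 := Set.ncard_add_ncard_compl H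
  omega

/-- The honest validators that ever FP-lock `tx` for user actor `A` and sequence number `m`. -/
def lockers (E : Scenario Val UA) (run : ℕ → Config Val UA RA Obj Code State) (A : UA) (m : ℕ)
    (tx : Tx UA RA Obj Code) : Set Val :=
  {U | U ∈ E.honest ∧ ∃ i, ((run i).loc U).fpLock A m = some tx}

/-- So many honest validators FP-lock `tx` that it may be decided on the fast path. -/
def FastLocked (P : Params Val UA RA Obj Code State) (E : Scenario Val UA)
    (run : ℕ → Config Val UA RA Obj Code State) (A : UA) (m : ℕ) (tx : Tx UA RA Obj Code) : Prop :=
  Nat.card Val ≤ (lockers E run A m tx).ncard + P.p + (E.honestᶜ).ncard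

/-- So many honest validators FP-lock `tx` that it may be SP-locked. -/
def Supported (P : Params Val UA RA Obj Code State) (E : Scenario Val UA)
    (run : ℕ → Config Val UA RA Obj Code State) (A : UA) (m : ℕ) (tx : Tx UA RA Obj Code) : Prop :=
  Nat.card Val ≤ (lockers E run A m tx).ncard + P.p + 2 * P.f + (E.honestᶜ).ncard

/-- `tx` may be decided, on the fast path or by Transaction Agreement. -/
def Certified (P : Params Val UA RA Obj Code State) (E : Scenario Val UA)
    (run : ℕ → Config Val UA RA Obj Code State) (A : UA) (m : ℕ) (tx : Tx UA RA Obj Code) : Prop :=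
  FastLocked P E run A m tx ∨ ∃ i, (A, m, tx) ∈ (run i).taCert

theorem FastLocked.supported {A : UA} {m : ℕ} {tx : Tx UA RA Obj Code}
    (h : FastLocked P E run A m tx) : Supported P E run A m tx := by
  unfold FastLocked Supported at *
  omega

namespace IsExecution

theorem lockers_disjoint (hrun : IsExecution P E run) {A : UA} {m : ℕ}
    {tx tx' : Tx UA RA Obj Code} (h : tx ≠ tx') :
    lockers E run A m tx ∩ lockers E run A m tx' = ∅ := by
  refine Set.eq_empty_of_forall_notMem fun U => ?_
  rintro ⟨⟨-, i, hi⟩, -, j, hj⟩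
  have h1 := (hrun.loc_le (le_max_left i j) U).fpLock _ _ _ hi
  have h2 := (hrun.loc_le (le_max_right i j) U).fpLock _ _ _ hj
  rw [h1] at h2
  exact h (Option.some.inj h2)

/-- The sets of honest validators that FP-lock different transactions are disjoint, and
`n ≥ 3f + 2p + 1` leaves no room for a fast-path and a slow-path quorum of that kind. -/
theorem eq_of_fastLocked [Finite Val] (hrun : IsExecution P E run)
    (hn : 3 * P.f + 2 * P.p + 1 ≤ Nat.card Val) (hf : (E.honestᶜ).ncard ≤ P.f) {A : UA} {m : ℕ}
    {tx w : Tx UA RA Obj Code} (h : FastLocked P E run A m tx) (h' : Supported P E run A m w) :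
    w = tx := by
  by_contra hne
  have := ncard_add_ncard_le (S := lockers E run A m tx) (T := lockers E run A m w)
    (H := E.honest) (fun _ h => h.1) (fun _ h => h.1)
  rw [hrun.lockers_disjoint (Ne.symm hne), Set.ncard_empty] at this
  unfold FastLocked at h
  unfold Supported at h'
  omega

theorem supported_spec (hrun : IsExecution P E run)
    (hn : 3 * P.f + 2 * P.p + 1 ≤ Nat.card Val) (hf : (E.honestᶜ).ncard ≤ P.f) {A : UA} {m : ℕ}
    {tx : Tx UA RA Obj Code} (h : Supported P E run A m tx) :
    tx.issuer = some A ∧ tx.sn = m ∧ ∃ i, (run i).Verify E tx := by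
  unfold Supported at h
  obtain ⟨U, -, i, hi⟩ := Set.nonempty_of_ncard_ne_zero
    (show (lockers E run A m tx).ncard ≠ 0 by omega)
  obtain ⟨h1, h2, h3⟩ := hrun.fpLock_spec hi
  exact ⟨h1, h2, i, h3⟩

theorem vote_locks (hrun : IsExecution P E run) {i : ℕ} {U : Val} {X : RA} {k : ℕ}
    {B fb : Block UA RA Obj Code} {τ : ℝ} (h : (U, .vote X k (some B) fb, τ) ∈ (run i).sent) :
    (∀ tx ∈ B, tx.recipient = some X) ∧
      ∀ tx ∈ B, ∀ A, tx.IsUARA A → U ∈ lockers E run A tx.sn tx := by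
  obtain ⟨B', t, hfp, -, hv⟩ := hrun.vote_spec h
  split_ifs at hv with hall
  obtain rfl := Option.some.inj hv
  refine ⟨(hrun.fp_spec hfp).1, fun tx htx A hA => ⟨(hrun.sent_spec h).1, ?_⟩⟩
  obtain ⟨i', -, _, _, A', -, -, hA', hl, -⟩ := hrun.fpReply_spec (hall tx htx A hA)
  obtain rfl := hA.unique hA'
  exact ⟨i', hl rfl⟩

/-- Honest fallback blocks are pools, and the UA-RA transactions of a pool were FP-locked
before they joined it. -/
theorem fallback_locks (hrun : IsExecution P E run) {i : ℕ} {U : Val} {X : RA} {k : ℕ}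
    {v : Option (Block UA RA Obj Code)} {fb : Block UA RA Obj Code} {τ : ℝ}
    (h : (U, .vote X k v fb, τ) ∈ (run i).sent) {tx : Tx UA RA Obj Code} (htx : tx ∈ fb) :
    tx.recipient = some X ∧ ∀ A, tx.IsUARA A → U ∈ lockers E run A tx.sn tx := by
  obtain ⟨hU, i', -, -, -, -, rfl, -⟩ := hrun.sent_spec h
  obtain ⟨h1, h2⟩ := hrun.pool_spec htx
  refine ⟨h1, fun A hA => ⟨hU, i', ?_⟩⟩
  rcases h2 with h2 | ⟨A', hA', hl, -⟩
  · exact absurd (hA.1.symm.trans h2) (by simp)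
  · obtain rfl := hA.unique hA'
    exact hl

theorem votersFor_spec (hrun : IsExecution P E run) {i : ℕ} {V : Val} {X : RA} {k : ℕ}
    {B : Block UA RA Obj Code} {U : Val}
    (hU : U ∈ (run i).votersFor V X k B ∩ E.honest) :
    ∃ fb τ, (U, .vote X k (some B) fb, τ) ∈ (run i).sent := by
  obtain ⟨⟨fb, h⟩, hU⟩ := hU
  exact ⟨fb, hrun.inbox_spec h hU⟩

/-- A block that gathers the votes of a slow-path candidate is addressed to `X` and supported. -/
theorem supported_of_votes [Finite Val] (hrun : IsExecution P E run)
    (hn : 3 * P.f + 2 * P.p + 1 ≤ Nat.card Val) (hf : (E.honestᶜ).ncard ≤ P.f) {i : ℕ} {V : Val}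
    {X : RA} {k : ℕ} {B : Block UA RA Obj Code}
    (h : Nat.card Val ≤ ((run i).votersFor V X k B).ncard + P.p + 2 * P.f)
    {tx : Tx UA RA Obj Code} (htx : tx ∈ B) :
    tx.recipient = some X ∧ ∀ A, tx.IsUARA A → Supported P E run A tx.sn tx := by
  have h1 := ncard_le_inter_add ((run i).votersFor V X k B) E.honest
  constructor
  · obtain ⟨U, hU⟩ := Set.nonempty_of_ncard_ne_zero
      (show ((run i).votersFor V X k B ∩ E.honest).ncard ≠ 0 by omega)
    obtain ⟨fb, τ, hs⟩ := hrun.votersFor_spec hU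
    exact (hrun.vote_locks hs).1 tx htx
  · intro A hA
    have h2 : ((run i).votersFor V X k B ∩ E.honest).ncard ≤ (lockers E run A tx.sn tx).ncard := by
      refine Set.ncard_le_ncard (fun U hU => ?_) (Set.toFinite _)
      obtain ⟨fb, τ, hs⟩ := hrun.votersFor_spec hU
      exact (hrun.vote_locks hs).2 tx htx A hA
    unfold Supported
    omega

theorem supported_of_fallbacks [Finite Val] (hrun : IsExecution P E run)
    (hn : 3 * P.f + 2 * P.p + 1 ≤ Nat.card Val) (hf : (E.honestᶜ).ncard ≤ P.f) {i : ℕ} {V : Val}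
    {X : RA} {k : ℕ} {tx : Tx UA RA Obj Code}
    (h : Nat.card Val ≤ ((run i).fallbacksWith V X k tx).ncard + 2 * P.f) :
    tx.recipient = some X ∧ ∀ A, tx.IsUARA A → Supported P E run A tx.sn tx := by
  have h1 := ncard_le_inter_add ((run i).fallbacksWith V X k tx) E.honest
  have key : ∀ U ∈ (run i).fallbacksWith V X k tx ∩ E.honest,
      tx.recipient = some X ∧ ∀ A, tx.IsUARA A → U ∈ lockers E run A tx.sn tx := by
    rintro U ⟨⟨v, fb, hin, htx⟩, hU⟩
    obtain ⟨τ, hs⟩ := hrun.inbox_spec hin hU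
    exact hrun.fallback_locks hs htx
  constructor
  · obtain ⟨U, hU⟩ := Set.nonempty_of_ncard_ne_zero
      (show ((run i).fallbacksWith V X k tx ∩ E.honest).ncard ≠ 0 by omega)
    exact (key U hU).1
  · intro A hA
    have h2 : ((run i).fallbacksWith V X k tx ∩ E.honest).ncard ≤
        (lockers E run A tx.sn tx).ncard :=
      Set.ncard_le_ncard (fun U hU => (key U hU).2 A hA) (Set.toFinite _)
    unfold Supported
    omega

theorem pobVote_locks (hrun : IsExecution P E run) {i : ℕ} {U : Val} {A : UA} {m : ℕ}
    {tx : Tx UA RA Obj Code} {τ : ℝ} (h : (U, .pobVote A m (some tx), τ) ∈ (run i).sent) :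
    U ∈ lockers E run A m tx := by
  obtain ⟨hU, i', -, -, hs⟩ := hrun.sent_spec h
  exact ⟨hU, i' + 1, hs tx rfl⟩

theorem pobVotersFor_ncard_le [Finite Val] (hrun : IsExecution P E run) (i : ℕ) (V : Val) (A : UA)
    (tx : Tx UA RA Obj Code) : ((run i).pobVotersFor V A tx).ncard ≤
      (lockers E run A tx.sn tx).ncard + (E.honestᶜ).ncard := by
  refine (ncard_le_inter_add _ E.honest).trans (Nat.add_le_add_right ?_ _)
  refine Set.ncard_le_ncard ?_ (Set.toFinite _)
  rintro U ⟨h, hU⟩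
  obtain ⟨τ, hs⟩ := hrun.inbox_spec h hU
  exact hrun.pobVote_locks hs

theorem qcProposed_supported [Finite Val] (hrun : IsExecution P E run)
    (hn : 3 * P.f + 2 * P.p + 1 ≤ Nat.card Val) (hf : (E.honestᶜ).ncard ≤ P.f) {i : ℕ} {V : Val}
    {X : RA} {k : ℕ} {D : Block UA RA Obj Code} (h : (V, X, k, D) ∈ (run i).qcProposed)
    {tx : Tx UA RA Obj Code} (htx : tx ∈ D) :
    tx.recipient = some X ∧ ∀ A, tx.IsUARA A → Supported P E run A tx.sn tx := by
  obtain ⟨i', h | ⟨C, hC, hD⟩⟩ := hrun.qcProposed_spec h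
  · obtain ⟨j, -, -, -, hv⟩ := hrun.cand_spec h
    exact hrun.supported_of_votes hn hf hv htx
  · obtain ⟨j, -, hv⟩ := hrun.cand₂_spec hC
    exact hrun.supported_of_fallbacks hn hf (hv tx (hD htx))

/-- Every transaction decided by Quorum Consensus was proposed by some honest validator. -/
theorem qcCert_proposed (hrun : IsExecution P E run)
    (hn : 3 * P.f + 2 * P.p + 1 ≤ Nat.card Val) {i : ℕ}
    {X : RA} {k : ℕ} {B : Block UA RA Obj Code} (h : (X, k, B) ∈ (run i).qcCert)
    {tx : Tx UA RA Obj Code} (htx : tx ∈ B) :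
    ∃ V ∈ E.honest, ∃ j D, (V, X, k, D) ∈ (run j).qcProposed ∧ tx ∈ D := by
  have := hrun.qc.validity_II i X k B tx htx h
  obtain ⟨V, hV, j, D, hD⟩ := Set.nonempty_of_ncard_ne_zero
    (show {V | V ∈ E.honest ∧ ∃ j B', (V, X, k, B') ∈ (run j).qcProposed ∧ tx ∈ B'}.ncard ≠ 0 by
      omega)
  exact ⟨V, hV, j, D, hD⟩

theorem qcCert_supported [Finite Val] (hrun : IsExecution P E run)
    (hn : 3 * P.f + 2 * P.p + 1 ≤ Nat.card Val) (hf : (E.honestᶜ).ncard ≤ P.f) {i : ℕ}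
    {X : RA} {k : ℕ} {B : Block UA RA Obj Code} (h : (X, k, B) ∈ (run i).qcCert)
    {tx : Tx UA RA Obj Code} (htx : tx ∈ B) :
    tx.recipient = some X ∧ ∀ A, tx.IsUARA A → Supported P E run A tx.sn tx := by
  obtain ⟨V, -, j, D, hD, h'⟩ := hrun.qcCert_proposed hn h htx
  exact hrun.qcProposed_supported hn hf hD h'

/-- Each way to an SP-lock (a candidate block, fallback blocks, Quorum Consensus, POB votes)
requires the FP-locks of a slow-path quorum. -/
theorem spLock_supported [Finite Val] (hrun : IsExecution P E run)
    (hn : 3 * P.f + 2 * P.p + 1 ≤ Nat.card Val) (hf : (E.honestᶜ).ncard ≤ P.f) {i : ℕ} {V : Val}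
    {A : UA} {m : ℕ} {tx : Tx UA RA Obj Code} (h : ((run i).loc V).spLock A m = some tx) :
    Supported P E run A m tx := by
  obtain ⟨rfl, i', ⟨hA, X, k, B, htx, hB | hB | hB⟩ | hv⟩ := hrun.spLock_spec h
  · obtain ⟨j, -, -, -, hv⟩ := hrun.cand_spec hB
    exact (hrun.supported_of_votes hn hf hv htx).2 A hA
  · obtain ⟨j, -, hv⟩ := hrun.cand₂_spec hB
    exact (hrun.supported_of_fallbacks hn hf (hv tx htx)).2 A hA
  · exact (hrun.qcCert_supported hn hf hB htx).2 A hA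
  · have := hrun.pobVotersFor_ncard_le i' V A tx
    unfold Supported
    omega

theorem taCert_supported [Finite Val] (hrun : IsExecution P E run)
    (hn : 3 * P.f + 2 * P.p + 1 ≤ Nat.card Val) (hf : (E.honestᶜ).ncard ≤ P.f) {i : ℕ}
    {A : UA} {m : ℕ} {tx : Tx UA RA Obj Code} (h : (A, m, tx) ∈ (run i).taCert) :
    Supported P E run A m tx := by
  have := hrun.ta.validity_II i A m tx h
  obtain ⟨V, hV, j, hj⟩ := Set.nonempty_of_ncard_ne_zero
    (show {V | V ∈ E.honest ∧ ∃ j, (V, A, m, tx) ∈ (run j).taProposed}.ncard ≠ 0 by omega)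
  exact hrun.spLock_supported hn hf (hrun.taProposed_spec hj)

theorem certified_supported [Finite Val] (hrun : IsExecution P E run)
    (hn : 3 * P.f + 2 * P.p + 1 ≤ Nat.card Val) (hf : (E.honestᶜ).ncard ≤ P.f)
    {A : UA} {m : ℕ} {tx : Tx UA RA Obj Code} (h : Certified P E run A m tx) :
    Supported P E run A m tx :=
  h.elim FastLocked.supported fun ⟨_, h⟩ => hrun.taCert_supported hn hf h

/-- At most one transaction per user actor and sequence number can be decided. -/
theorem certified_unique [Finite Val] (hrun : IsExecution P E run)
    (hn : 3 * P.f + 2 * P.p + 1 ≤ Nat.card Val) (hf : (E.honestᶜ).ncard ≤ P.f)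
    {A : UA} {m : ℕ} {tx tx' : Tx UA RA Obj Code} (h : Certified P E run A m tx)
    (h' : Certified P E run A m tx') : tx = tx' := by
  rcases h with h | ⟨i, hi⟩
  · exact (hrun.eq_of_fastLocked hn hf h (hrun.certified_supported hn hf h')).symm
  · rcases h' with h' | ⟨j, hj⟩
    · exact hrun.eq_of_fastLocked hn hf h' (hrun.taCert_supported hn hf hi)
    · exact hrun.ta.agreement i j A m tx tx' hi hj

/-- The honest validators among those that voted for `B`. -/
theorem fastCert_voters [Finite Val] {i : ℕ} {X : RA} {k : ℕ} {B : Block UA RA Obj Code}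
    (h : (run i).FastCert E P X k B) : ∃ S ⊆ E.honest,
      Nat.card Val ≤ S.ncard + P.p + (E.honestᶜ).ncard ∧
      ∀ U ∈ S, ∃ fb τ, (U, .vote X k (some B) fb, τ) ∈ (run i).sent := by
  obtain ⟨S, hS, hs⟩ := h
  have := ncard_le_inter_add S E.honest
  exact ⟨S ∩ E.honest, Set.inter_subset_right, by omega, fun U hU => hs U hU.1 hU.2⟩

theorem fastCert_spec [Finite Val] (hrun : IsExecution P E run)
    (hn : 3 * P.f + 2 * P.p + 1 ≤ Nat.card Val) (hf : (E.honestᶜ).ncard ≤ P.f) {i : ℕ}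
    {X : RA} {k : ℕ} {B : Block UA RA Obj Code} (h : (run i).FastCert E P X k B)
    {tx : Tx UA RA Obj Code} (htx : tx ∈ B) :
    tx.recipient = some X ∧ ∀ A, tx.IsUARA A → FastLocked P E run A tx.sn tx := by
  obtain ⟨S, hSH, hS, hs⟩ := fastCert_voters h
  constructor
  · obtain ⟨U, hU⟩ := Set.nonempty_of_ncard_ne_zero (show S.ncard ≠ 0 by omega)
    obtain ⟨fb, τ, hv⟩ := hs U hU
    exact (hrun.vote_locks hv).1 tx htx
  · intro A hA
    have : S.ncard ≤ (lockers E run A tx.sn tx).ncard := by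
      refine Set.ncard_le_ncard (fun U hU => ?_) (Set.toFinite _)
      obtain ⟨fb, τ, hv⟩ := hs U hU
      exact (hrun.vote_locks hv).2 tx htx A hA
    unfold FastLocked
    omega

/-- If `B` can be decided on the fast path, no other block becomes a slow-path candidate. -/
theorem eq_of_fastCert_of_votes [Finite Val] (hrun : IsExecution P E run)
    (hn : 3 * P.f + 2 * P.p + 1 ≤ Nat.card Val) (hf : (E.honestᶜ).ncard ≤ P.f) {i j : ℕ} {V : Val}
    {X : RA} {k : ℕ} {B D : Block UA RA Obj Code} (h : (run i).FastCert E P X k B)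
    (hD : Nat.card Val ≤ ((run j).votersFor V X k D).ncard + P.p + 2 * P.f) : D = B := by
  obtain ⟨S, hSH, hS, hs⟩ := fastCert_voters h
  by_contra hne
  have h1 := ncard_le_inter_add ((run j).votersFor V X k D) E.honest
  have h2 := ncard_add_ncard_le (S := S) (T := (run j).votersFor V X k D ∩ E.honest) hSH
    Set.inter_subset_right
  have h3 : S ∩ ((run j).votersFor V X k D ∩ E.honest) = ∅ := by
    refine Set.eq_empty_of_forall_notMem fun U => ?_
    rintro ⟨hU, hU'⟩
    obtain ⟨fb, τ, hv⟩ := hs U hU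
    obtain ⟨fb', τ', hv'⟩ := hrun.votersFor_spec hU'
    exact hne (Option.some.inj (hrun.vote_unique hv' hv))
  rw [h3, Set.ncard_empty] at h2
  omega

/-- If `B` can be decided on the fast path, honest validators propose only `B` to Quorum
Consensus. -/
theorem eq_of_fastCert_of_qcProposed [Finite Val] (hrun : IsExecution P E run)
    (hn : 3 * P.f + 2 * P.p + 1 ≤ Nat.card Val) (hf : (E.honestᶜ).ncard ≤ P.f) {i j : ℕ} {V : Val}
    {X : RA} {k : ℕ} {B D : Block UA RA Obj Code} (h : (run i).FastCert E P X k B)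
    (hD : (V, X, k, D) ∈ (run j).qcProposed) : D = B := by
  have hcand : ∀ {j D}, (((run j).loc V).ra X).cand k = some D → D = B := fun hc => by
    obtain ⟨j', -, -, -, hv⟩ := hrun.cand_spec hc
    exact hrun.eq_of_fastCert_of_votes hn hf h hv
  obtain ⟨j', hc | ⟨C, hC, -⟩⟩ := hrun.qcProposed_spec hD
  · exact hcand hc
  · exfalso
    obtain ⟨j₁, hneed, -⟩ := hrun.cand₂_spec hC
    obtain ⟨j₂, -, -, ⟨-, hvoters, hno⟩ | ⟨B', hB', u, hu, A, hA, hrep⟩⟩ :=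
      hrun.needFallback_spec hneed
    · -- the honest voters for `B` among the voters heard suffice to make `B` a candidate
      obtain ⟨S, hSH, hS, hs⟩ := fastCert_voters h
      have h1 := ncard_le_inter_add ((run j₂).voters V X k) E.honest
      have h2 := ncard_add_ncard_le (S := S) (T := (run j₂).voters V X k ∩ E.honest) hSH
        Set.inter_subset_right
      have h3 : (S ∩ ((run j₂).voters V X k ∩ E.honest)).ncard ≤
          ((run j₂).votersFor V X k B).ncard := by
        refine Set.ncard_le_ncard ?_ (Set.toFinite _)
        rintro U ⟨hU, ⟨v, fb', hin⟩, hUh⟩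
        obtain ⟨fb, τ, hv⟩ := hs U hU
        obtain ⟨τ', hv'⟩ := hrun.inbox_spec hin hUh
        obtain rfl := hrun.vote_unique hv' hv
        exact ⟨fb', hin⟩
      exact hno B (by omega)
    · obtain rfl := hcand hB'
      obtain ⟨j₃, A', w, hA', hw, hne⟩ := hrun.spReply_spec hrep
      exact hne (hrun.eq_of_fastLocked hn hf ((hrun.fastCert_spec hn hf h hu).2 A' hA')
        (hrun.spLock_supported hn hf hw))

theorem eq_of_fastCert_of_slowCert [Finite Val] (hrun : IsExecution P E run)
    (hn : 3 * P.f + 2 * P.p + 1 ≤ Nat.card Val) (hf : (E.honestᶜ).ncard ≤ P.f) {i j : ℕ}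
    {X : RA} {k : ℕ} {B B' : Block UA RA Obj Code} (h : (run i).FastCert E P X k B)
    (h' : (run j).SlowCert X k B') : B' = B := by
  obtain ⟨Bqc, hqc, hta, rfl⟩ := h'
  have hB : Bqc = B := by
    ext tx
    constructor
    · intro htx
      obtain ⟨V, -, j', D, hD, hm⟩ := hrun.qcCert_proposed hn hqc htx
      rwa [hrun.eq_of_fastCert_of_qcProposed hn hf h hD] at hm
    · intro htx
      refine hrun.qc.validity_I j X k Bqc tx hqc fun j' V _ D hD => ?_
      rwa [hrun.eq_of_fastCert_of_qcProposed hn hf h hD]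
  subst hB
  refine Finset.filter_true_of_mem fun tx htx A hA => ?_
  obtain ⟨w, hw⟩ := hta tx htx A hA
  rwa [hrun.eq_of_fastLocked hn hf ((hrun.fastCert_spec hn hf h htx).2 A hA)
    (hrun.taCert_supported hn hf hw)] at hw

/-- Agreement of POA: at most one block per instance has a valid proof. -/
theorem validProof_unique [Finite Val] (hrun : IsExecution P E run)
    (hn : 3 * P.f + 2 * P.p + 1 ≤ Nat.card Val) (hf : (E.honestᶜ).ncard ≤ P.f) {i j : ℕ}
    {X : RA} {k : ℕ} {B B' : Block UA RA Obj Code} (h : (run i).ValidProof E P X k B)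
    (h' : (run j).ValidProof E P X k B') : B = B' := by
  rcases h with h | h <;> rcases h' with h' | h'
  · obtain ⟨S, hSH, hS, hs⟩ := fastCert_voters h
    obtain ⟨S', hSH', hS', hs'⟩ := fastCert_voters h'
    have := ncard_add_ncard_le hSH hSH'
    obtain ⟨U, hU, hU'⟩ := Set.nonempty_of_ncard_ne_zero (show (S ∩ S').ncard ≠ 0 by omega)
    obtain ⟨fb, τ, hv⟩ := hs U hU
    obtain ⟨fb', τ', hv'⟩ := hs' U hU'
    exact Option.some.inj (hrun.vote_unique hv hv')
  · exact (hrun.eq_of_fastCert_of_slowCert hn hf h h').symm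
  · exact hrun.eq_of_fastCert_of_slowCert hn hf h' h
  · obtain ⟨B₁, h1, h2, rfl⟩ := h
    obtain ⟨B₂, h1', h2', rfl⟩ := h'
    obtain rfl := hrun.qc.agreement i j X k B₁ B₂ h1 h1'
    refine Finset.filter_congr fun tx htx => forall_congr' fun A => forall_congr' fun hA => ?_
    constructor
    · intro h
      obtain ⟨w, hw⟩ := h2' tx htx A hA
      rwa [hrun.ta.agreement j i A tx.sn w tx hw h] at hw
    · intro h
      obtain ⟨w, hw⟩ := h2 tx htx A hA
      rwa [hrun.ta.agreement i j A tx.sn w tx hw h] at hw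

theorem validProof_spec [Finite Val] (hrun : IsExecution P E run)
    (hn : 3 * P.f + 2 * P.p + 1 ≤ Nat.card Val) (hf : (E.honestᶜ).ncard ≤ P.f) {i : ℕ}
    {X : RA} {k : ℕ} {B : Block UA RA Obj Code} (h : (run i).ValidProof E P X k B)
    {tx : Tx UA RA Obj Code} (htx : tx ∈ B) :
    tx.recipient = some X ∧ ∀ A, tx.IsUARA A → Certified P E run A tx.sn tx := by
  rcases h with h | ⟨B', h1, h2, rfl⟩
  · exact (hrun.fastCert_spec hn hf h htx).imp_right fun h A hA => .inl (h A hA)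
  · rw [Finset.mem_filter] at htx
    exact ⟨(hrun.qcCert_supported hn hf h1 htx.1).1, fun A hA => .inr ⟨i, htx.2 A hA⟩⟩

theorem validProof_mono (hrun : IsExecution P E run)
    {i j : ℕ} (hij : i ≤ j) {X : RA} {k : ℕ} {B : Block UA RA Obj Code}
    (h : (run i).ValidProof E P X k B) : (run j).ValidProof E P X k B := by
  have hle := hrun.le hij
  rcases h with ⟨S, hS, hs⟩ | ⟨B', h1, h2, rfl⟩
  · refine .inl ⟨S, hS, fun U hU hUh => ?_⟩
    obtain ⟨fb, τ, h⟩ := hs U hU hUh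
    exact ⟨fb, τ, hle.sent h⟩
  · refine .inr ⟨B', hle.qcCert h1, fun tx htx A hA => (h2 tx htx A hA).imp fun w h =>
      hle.taCert h, Finset.filter_congr fun tx htx => forall_congr' fun A => forall_congr' fun hA =>
      ⟨fun h => hle.taCert h, fun h => ?_⟩⟩
    obtain ⟨w, hw⟩ := h2 tx htx A hA
    rwa [hrun.ta.agreement i j A tx.sn w tx hw h] at hw

theorem validProof_of_canDecide (hrun : IsExecution P E run) {i : ℕ} {V : Val} {X : RA} {k : ℕ}
    {B : Block UA RA Obj Code} (h : CanDecide P E (run i) V X k B) :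
    (run i).ValidProof E P X k B := by
  rcases h with h | h | ⟨B', h1, h2, rfl⟩
  · exact .inl ⟨_, h, fun U hU hUh => hrun.votersFor_spec ⟨hU, hUh⟩⟩
  · exact h.2
  · have key : ∀ tx ∈ B', ∀ A, tx.IsUARA A → ∃ w, (A, tx.sn, w) ∈ (run i).taCert ∧
        ((run i).loc V).taDecided A tx.sn = some w := fun tx htx A hA => by
      obtain ⟨w, hw⟩ := Option.ne_none_iff_exists'.1 (h2 tx htx A hA)
      exact ⟨w, hrun.taDecided_spec hw, hw⟩
    refine .inr ⟨B', hrun.qcDecided_spec h1, fun tx htx A hA =>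
      (key tx htx A hA).imp fun _ h => h.1, Finset.filter_congr fun tx htx => forall_congr' fun A =>
      forall_congr' fun hA => ⟨fun h => hrun.taDecided_spec h, fun h => ?_⟩⟩
    obtain ⟨w, hw, hd⟩ := key tx htx A hA
    rwa [hrun.ta.agreement i i A tx.sn w tx hw h] at hd

theorem validPobProof_of_canPobDecide (hrun : IsExecution P E run) {i : ℕ} {V : Val} {A : UA}
    {tx : Tx UA RA Obj Code} (h : CanPobDecide P E (run i) V A tx) :
    (run i).ValidPobProof E P A tx.sn tx := by
  rcases h with h | h | h
  · exact .inl ⟨_, h, fun U hU hUh => hrun.inbox_spec hU hUh⟩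
  · exact h.2
  · exact .inr (hrun.taDecided_spec h)

theorem validPobProof_mono (hrun : IsExecution P E run) {i j : ℕ} (hij : i ≤ j) {A : UA} {m : ℕ}
    {tx : Tx UA RA Obj Code} (h : (run i).ValidPobProof E P A m tx) :
    (run j).ValidPobProof E P A m tx := by
  have hle := hrun.le hij
  exact h.imp (fun ⟨S, hS, hs⟩ => ⟨S, hS, fun U hU hUh => (hs U hU hUh).imp fun _ h => hle.sent h⟩)
    fun h => hle.taCert h

theorem certified_of_validPobProof [Finite Val] (hrun : IsExecution P E run) {i : ℕ} {A : UA}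
    {m : ℕ} {tx : Tx UA RA Obj Code} (h : (run i).ValidPobProof E P A m tx) :
    Certified P E run A m tx := by
  rcases h with ⟨S, hS, hs⟩ | h
  · have h1 := ncard_le_inter_add S E.honest
    have h2 : (S ∩ E.honest).ncard ≤ (lockers E run A m tx).ncard := by
      refine Set.ncard_le_ncard (fun U hU => ?_) (Set.toFinite _)
      obtain ⟨τ, h⟩ := hs U hU.1 hU.2
      exact hrun.pobVote_locks h
    left
    unfold FastLocked
    omega
  · exact .inr ⟨i, h⟩

theorem certified_of_pobDecided [Finite Val] (hrun : IsExecution P E run) {i : ℕ} {V : Val}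
    {A : UA} {m : ℕ} {tx : Tx UA RA Obj Code} (h : ((run i).loc V).pobDecided A m = some tx) :
    Certified P E run A m tx := by
  obtain ⟨rfl, i', -, h⟩ := hrun.pobDecided_spec h
  exact hrun.certified_of_validPobProof (hrun.validPobProof_of_canPobDecide h)

theorem validProof_of_decided (hrun : IsExecution P E run) {i : ℕ} {V : Val} {X : RA} {k : ℕ}
    {B : Block UA RA Obj Code} {d : ℝ} (h : (((run i).loc V).ra X).decided k = some (B, d)) :
    (run i).ValidProof E P X k B := by
  obtain ⟨i', hi', -, h, -⟩ := hrun.decided_spec h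
  exact hrun.validProof_mono hi'.le (hrun.validProof_of_canDecide h)

/-- Honest validators decide the same block. -/
theorem decided_unique [Finite Val] (hrun : IsExecution P E run)
    (hn : 3 * P.f + 2 * P.p + 1 ≤ Nat.card Val) (hf : (E.honestᶜ).ncard ≤ P.f) {i j : ℕ}
    {U V : Val} {X : RA} {k : ℕ} {B B' : Block UA RA Obj Code} {d d' : ℝ}
    (h : (((run i).loc U).ra X).decided k = some (B, d))
    (h' : (((run j).loc V).ra X).decided k = some (B', d')) : B = B' :=
  hrun.validProof_unique hn hf (hrun.validProof_of_decided h) (hrun.validProof_of_decided h')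

end IsExecution

/-! ### Histories of actors -/

/-- The genesis core of a reactive actor. -/
def initCore (P : Params Val UA RA Obj Code State) (X : RA) : Core UA RA Obj Code State :=
  ⟨P.initState X, P.initObjs X, ∅⟩

theorem mem_done_foldl_coreBlock (X : RA) (bs : List (Block UA RA Obj Code))
    (σ : Core UA RA Obj Code State) (t : Tx UA RA Obj Code) :
    t ∈ (bs.foldl (coreBlock P X) σ).done ↔ t ∈ σ.done ∨ ∃ B ∈ bs, t ∈ B := by
  induction bs generalizing σ with
  | nil => simp
  | cons B bs ih => simp [ih, mem_done_coreBlock, or_assoc]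

theorem emitsList_effect {X : RA} {σ : Core UA RA Obj Code State} {l : List (Tx UA RA Obj Code)}
    {tx : Tx UA RA Obj Code} {cr : Finset (UA × Obj)} (h : emitsList P X σ l (.effect tx cr)) :
    tx ∈ l ∧ tx ∉ σ.done ∧ ∃ A, tx.IsUARA A := by
  induction l generalizing σ with
  | nil => exact h.elim
  | cons t l ih =>
    rcases h with ⟨h1, rfl, h2, -⟩ | h
    · exact ⟨List.mem_cons_self, h1, h2⟩
    · obtain ⟨h1, h2, h3⟩ := ih h
      rw [mem_done_coreTx, not_or] at h2
      exact ⟨List.mem_cons_of_mem _ h1, h2.1, h3⟩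

theorem emitsList_effect_unique {X : RA} {σ : Core UA RA Obj Code State}
    {l : List (Tx UA RA Obj Code)} {tx : Tx UA RA Obj Code} {cr cr' : Finset (UA × Obj)}
    (h : emitsList P X σ l (.effect tx cr)) (h' : emitsList P X σ l (.effect tx cr')) :
    cr = cr' := by
  induction l generalizing σ with
  | nil => exact h.elim
  | cons t l ih =>
    have key : ∀ cr, emitsList P X (coreTx P X σ t) l (.effect tx cr) → tx ≠ t := fun cr h => by
      have := (emitsList_effect h).2.1
      rw [mem_done_coreTx, not_or] at this
      exact this.2
    rcases h with ⟨-, h1, -, rfl⟩ | h <;> rcases h' with ⟨-, h1', -, rfl⟩ | h'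
    · rfl
    · exact absurd h1 (key _ h')
    · exact absurd h1' (key _ h)
    · exact ih h h'

namespace IsExecution

theorem pred_decided_of_start (hrun : IsExecution P E run) {i : ℕ} {V : Val} {X : RA} {k : ℕ}
    (h : (((run i).loc V).ra X).start k ≠ none) :
    k = 0 ∨ (((run i).loc V).ra X).decided (k - 1) ≠ none := by
  obtain ⟨t, ht⟩ := Option.ne_none_iff_exists'.1 h
  obtain ⟨i', hi', -, -, -, -, hd, -⟩ := hrun.start_spec ht
  refine hd.imp_right fun hd => ?_
  obtain ⟨b, hb⟩ := Option.ne_none_iff_exists'.1 hd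
  rw [(hrun.loc_le hi'.le V).decided _ _ _ hb]
  simp

/-- The blocks that a validator has decided for `X` form a list, which determines the core of `X`
and the facts that its execution has brought about. -/
theorem history (hrun : IsExecution P E run) (i : ℕ) (V : Val) (X : RA) :
    ∃ bs : List (Block UA RA Obj Code),
      (∀ k, ((((run i).loc V).ra X).decided k).map Prod.fst = bs[k]?) ∧
      ((run i).loc V).core X = bs.foldl (coreBlock P X) (initCore P X) ∧
      ∀ k B, bs[k]? = some B → ∀ φ,
        emitsList P X ((bs.take k).foldl (coreBlock P X) (initCore P X)) (P.order B) φ →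
        ((run i).loc V).Holds φ := by
  induction i with
  | zero => exact ⟨[], by rw [hrun.init]; simp [initConfig, initLocal, initRA],
      by rw [hrun.init]; rfl, by simp⟩
  | succ i ih =>
    obtain ⟨bs, h1, h2, h3⟩ := ih
    have hle := (hrun.step i).local_le V
    have h3' : ∀ k B, bs[k]? = some B → ∀ φ,
        emitsList P X ((bs.take k).foldl (coreBlock P X) (initCore P X)) (P.order B) φ →
        ((run (i + 1)).loc V).Holds φ := fun k B hB φ hφ => hle.holds _ (h3 k B hB φ hφ)
    rcases (hrun.step i).decide_or V with ⟨Y, k, B, hin, hdec, e, -⟩ | ⟨hc, hd, -⟩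
    · have H := applyDecision_decides P Y k B (run i).now ((run i).loc V)
      rw [← e] at H
      by_cases hXY : X = Y
      · subst hXY
        have hk : bs.length = k := by
          have hlt : bs.length ≤ k := by
            have := h1 k
            rw [hin.2] at this
            simpa using this.symm
          rcases hrun.pred_decided_of_start hin.1 with h0 | h0
          · omega
          · obtain ⟨b, hb⟩ := Option.ne_none_iff_exists'.1 h0
            have := h1 (k - 1)
            rw [hb] at this
            have := (List.getElem?_eq_some_iff.1 this.symm).1
            omega
        refine ⟨bs ++ [B], fun m => ?_, ?_, fun m C hC φ hφ => ?_⟩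
        · rw [H.decided]
          by_cases hm : m = k
          · subst hm; simp [← hk]
          · rw [Function.update_of_ne hm, h1]
            rcases lt_or_gt_of_ne hm with hlt | hlt
            · rw [List.getElem?_append_left (by omega)]
            · rw [List.getElem?_eq_none (by omega), List.getElem?_eq_none (by simp; omega)]
        · rw [H.core, h2, List.foldl_append]; rfl
        · by_cases hm : m < k
          · rw [List.getElem?_append_left (by omega)] at hC
            rw [List.take_append_of_le_length (by omega)] at hφ
            exact h3' m C hC φ hφ
          · have hm' : m = k := by
              have := (List.getElem?_eq_some_iff.1 hC).1
              simp at this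
              omega
            subst hm'
            subst hk
            simp only [List.take_left'] at hφ
            simp at hC
            subst hC
            refine (H.holds φ ?_).2 (.inr (by rwa [h2]))
            rintro Y m C rfl
            exact not_emitsList_decided hφ
      · exact ⟨bs, by rw [H.decided_ne X hXY]; exact h1, (H.core_ne X hXY).trans h2, h3'⟩
    · exact ⟨bs, by rw [hd X]; exact h1, (hc X).trans h2, h3'⟩

theorem mem_done_iff (hrun : IsExecution P E run) {i : ℕ} {V : Val} {X : RA}
    {tx : Tx UA RA Obj Code} : tx ∈ (((run i).loc V).ra X).done ↔
      ∃ k B d, (((run i).loc V).ra X).decided k = some (B, d) ∧ tx ∈ B := by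
  obtain ⟨bs, h1, h2, -⟩ := hrun.history i V X
  have : (((run i).loc V).ra X).done = _ := congrArg Core.done h2
  rw [this, mem_done_foldl_coreBlock]
  simp only [initCore, Finset.notMem_empty, false_or, List.mem_iff_getElem?, ← h1,
    Option.map_eq_some_iff, Prod.exists]
  constructor
  · rintro ⟨B, ⟨k, _, d, hd, rfl⟩, htx⟩
    exact ⟨k, _, d, hd, htx⟩
  · rintro ⟨k, B, d, hd, htx⟩
    exact ⟨B, ⟨k, B, d, hd, rfl⟩, htx⟩

/-- Instances are decided in order. -/
theorem decided_of_le (hrun : IsExecution P E run) {i : ℕ} {V : Val} {X : RA} {j k : ℕ}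
    (hjk : j ≤ k) (h : (((run i).loc V).ra X).decided k ≠ none) :
    (((run i).loc V).ra X).decided j ≠ none := by
  obtain ⟨bs, h1, -⟩ := hrun.history i V X
  obtain ⟨b, hb⟩ := Option.ne_none_iff_exists'.1 h
  have h2 := h1 k
  rw [hb] at h2
  have hlt := (List.getElem?_eq_some_iff.1 h2.symm).1
  intro hj
  have h3 := h1 j
  rw [hj, List.getElem?_eq_getElem (by omega)] at h3
  cases h3

/-- Executing a decided block has the same effects at every honest validator. -/
theorem holds_of_emits [Finite Val] (hrun : IsExecution P E run)
    (hn : 3 * P.f + 2 * P.p + 1 ≤ Nat.card Val) (hf : (E.honestᶜ).ncard ≤ P.f) {i j : ℕ}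
    {U V : Val} {X : RA} {k : ℕ} {B : Block UA RA Obj Code} {d : ℝ}
    (hin : (run i).InInstance V X k) (hU : (((run j).loc U).ra X).decided k = some (B, d))
    {φ : Fact UA RA Obj Code}
    (hφ : emitsList P X (((run i).loc V).core X) (P.order B) φ) : ((run j).loc U).Holds φ := by
  obtain ⟨bs, h1, h2, -⟩ := hrun.history i V X
  obtain ⟨bs', h1', -, h3'⟩ := hrun.history j U X
  have hlt : bs.length ≤ k := by
    have := h1 k
    rw [hin.2] at this
    simpa using this.symm
  have hB : bs'[k]? = some B := by rw [← h1', hU]; rfl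
  have hlt' := (List.getElem?_eq_some_iff.1 hB).1
  have htake : bs'.take k = bs := by
    refine List.ext_getElem? fun m => ?_
    rw [List.getElem?_take]
    split_ifs with hm
    · have hV : (((run i).loc V).ra X).decided m ≠ none := by
        rcases hrun.pred_decided_of_start hin.1 with h0 | h0
        · omega
        · exact hrun.decided_of_le (by omega) h0
      have hU' : (((run j).loc U).ra X).decided m ≠ none :=
        hrun.decided_of_le hm.le (by rw [hU]; simp)
      obtain ⟨⟨C, e⟩, hC⟩ := Option.ne_none_iff_exists'.1 hV
      obtain ⟨⟨C', e'⟩, hC'⟩ := Option.ne_none_iff_exists'.1 hU'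
      rw [← h1, ← h1', hC, hC', hrun.decided_unique hn hf hC hC']
      rfl
    · rw [List.getElem?_eq_none (by omega)]
  refine h3' k B hB φ ?_
  rwa [htake, ← h2]

/-- A UA-RA transaction is executed at most once, on its recipient, so the objects that it creates
are determined. -/
theorem effects_spec [Finite Val] (hrun : IsExecution P E run)
    (hn : 3 * P.f + 2 * P.p + 1 ≤ Nat.card Val) (hf : (E.honestᶜ).ncard ≤ P.f) (i : ℕ) (V : Val) :
    (∀ tx cr, (tx, cr) ∈ ((run i).loc V).effects → (∃ A, tx.IsUARA A) ∧
      ∃ X k B d, (((run i).loc V).ra X).decided k = some (B, d) ∧ tx ∈ B) ∧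
    ∀ tx cr cr', (tx, cr) ∈ ((run i).loc V).effects → (tx, cr') ∈ ((run i).loc V).effects →
      cr = cr' := by
  induction i with
  | zero => rw [hrun.init]; simp [initConfig, initLocal]
  | succ i ih =>
    have hle := (hrun.step i).local_le V
    rcases (hrun.step i).decide_or V with ⟨X, k, B, hin, hdec, e, -⟩ | ⟨-, hd, he⟩
    · have H := applyDecision_decides P X k B (run i).now ((run i).loc V)
      rw [← e] at H
      have key : ∀ tx cr, (tx, cr) ∈ ((run (i + 1)).loc V).effects →
          (tx, cr) ∈ ((run i).loc V).effects ∨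
          emitsList P X (((run i).loc V).core X) (P.order B) (.effect tx cr) :=
        fun tx cr h => (H.holds (.effect tx cr) (by simp)).1 h
      have hB : (((run (i + 1)).loc V).ra X).decided k = some (B, (run i).now) := by
        rw [H.decided]; simp
      -- a transaction with recorded effects is done at its recipient, so it is not executed again
      have old : ∀ tx cr cr', (tx, cr) ∈ ((run i).loc V).effects →
          ¬ emitsList P X (((run i).loc V).core X) (P.order B) (.effect tx cr') := by
        intro tx cr cr' h h'
        obtain ⟨h1, h2, -⟩ := emitsList_effect h'
        obtain ⟨-, Y, m, C, d, hC, htx⟩ := ih.1 tx cr h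
        have hX := (hrun.validProof_spec hn hf (hrun.validProof_of_decided hB)
          ((P.mem_order B tx).1 h1)).1
        have hY := (hrun.validProof_spec hn hf (hrun.validProof_of_decided hC) htx).1
        obtain rfl : X = Y := Option.some.inj (hX.symm.trans hY)
        exact h2 (hrun.mem_done_iff.2 ⟨m, C, d, hC, htx⟩)
      refine ⟨fun tx cr h => ?_, fun tx cr cr' h h' => ?_⟩
      · rcases key tx cr h with h | h
        · obtain ⟨h1, Y, m, C, d, hC, htx⟩ := ih.1 tx cr h
          exact ⟨h1, Y, m, C, d, hle.decided _ _ _ hC, htx⟩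
        · obtain ⟨h1, -, h2⟩ := emitsList_effect h
          exact ⟨h2, X, k, B, _, hB, (P.mem_order B tx).1 h1⟩
      · rcases key tx cr h with h | h <;> rcases key tx cr' h' with h' | h'
        · exact ih.2 tx cr cr' h h'
        · exact absurd h' (old _ _ _ h)
        · exact absurd h (old _ _ _ h')
        · exact emitsList_effect_unique h h'
    · rw [he]; simp only [hd]; exact ih

theorem certified_of_effect [Finite Val] (hrun : IsExecution P E run)
    (hn : 3 * P.f + 2 * P.p + 1 ≤ Nat.card Val) (hf : (E.honestᶜ).ncard ≤ P.f) {i : ℕ} {V : Val}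
    {A : UA} {tx : Tx UA RA Obj Code} {cr : Finset (UA × Obj)} (hA : tx.IsUARA A)
    (h : (tx, cr) ∈ ((run i).loc V).effects) : Certified P E run A tx.sn tx := by
  obtain ⟨-, X, k, B, d, hB, htx⟩ := (hrun.effects_spec hn hf i V).1 tx cr h
  exact (hrun.validProof_spec hn hf (hrun.validProof_of_decided hB) htx).2 A hA

/-- Each sequence number is executed by the one certified transaction, in order, and the consumed
objects are those of the executed transactions. -/
theorem executed_spec [Finite Val] (hrun : IsExecution P E run)
    (hn : 3 * P.f + 2 * P.p + 1 ≤ Nat.card Val) (hf : (E.honestᶜ).ncard ≤ P.f) (i : ℕ) (V : Val) :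
    (∀ A m, (A, m) ∈ ((run i).loc V).executed → ∃ tx, tx.sn = m ∧ Certified P E run A m tx ∧
      (tx.IsUARA A ∧ (∃ cr, (tx, cr) ∈ ((run i).loc V).effects ∧
          (cr : Set (UA × Obj)) ⊆ ((run i).loc V).created) ∨
        tx.IsUA A ∧ ((P.execUA tx).1 : Set (UA × Obj)) ⊆ ((run i).loc V).created ∧
          ((P.execUA tx).2 : Set RA) ⊆ ((run i).loc V).active)) ∧
    (∀ A m, (A, m + 1) ∈ ((run i).loc V).executed → (A, m) ∈ ((run i).loc V).executed) ∧
    ∀ A o, (A, o) ∈ ((run i).loc V).consumed ↔ ∃ tx : Tx UA RA Obj Code,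
      Certified P E run A tx.sn tx ∧ (A, tx.sn) ∈ ((run i).loc V).executed ∧ o ∈ tx.objs := by
  induction i with
  | zero => rw [hrun.init]; simp [initConfig, initLocal]
  | succ i ih =>
    have hle := (hrun.step i).local_le V
    have hactive : ((run i).loc V).active ⊆ ((run (i + 1)).loc V).active :=
      fun Y hY => hle.holds (.active Y) hY
    have hcreated : ((run i).loc V).created ⊆ ((run (i + 1)).loc V).created :=
      fun q hq => hle.holds (.created q) hq
    obtain ⟨ih1, ih2, ih3⟩ := ih
    have old : ∀ A m, (A, m) ∈ ((run i).loc V).executed → ∃ tx, tx.sn = m ∧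
        Certified P E run A m tx ∧
        (tx.IsUARA A ∧ (∃ cr, (tx, cr) ∈ ((run (i + 1)).loc V).effects ∧
            (cr : Set (UA × Obj)) ⊆ ((run (i + 1)).loc V).created) ∨
          tx.IsUA A ∧ ((P.execUA tx).1 : Set (UA × Obj)) ⊆ ((run (i + 1)).loc V).created ∧
            ((P.execUA tx).2 : Set RA) ⊆ ((run (i + 1)).loc V).active) := by
      intro A m h
      obtain ⟨tx, h1, h2, h3⟩ := ih1 A m h
      refine ⟨tx, h1, h2, h3.imp ?_ ?_⟩
      · rintro ⟨hA, cr, hcr, hc⟩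
        exact ⟨hA, cr, hle.holds (.effect tx cr) hcr, hc.trans hcreated⟩
      · rintro ⟨hA, h4, h5⟩
        exact ⟨hA, h4.trans hcreated, h5.trans hactive⟩
    rcases (hrun.step i).executed_origin (V := V) with
      ⟨h1, h2⟩ | ⟨A, tx, hready, hnew, h1, h2, h3⟩
    · rw [h1, h2]
      exact ⟨old, ih2, ih3⟩
    · rw [h1, h2]
      have hcert : Certified P E run A tx.sn tx := by
        rcases h3 with ⟨hA, cr, hcr, -⟩ | ⟨-, hp, -⟩
        · exact hrun.certified_of_effect hn hf hA hcr
        · exact hrun.certified_of_pobDecided hp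
      refine ⟨fun A' m h => ?_, fun A' m h => ?_, fun A' o => ?_⟩
      · rcases Set.mem_insert_iff.1 h with h | h
        · obtain ⟨rfl, rfl⟩ := Prod.mk.inj h
          refine ⟨tx, rfl, hcert, h3.imp ?_ ?_⟩
          · rintro ⟨hA, cr, hcr, hc⟩
            exact ⟨hA, cr, hle.holds (.effect tx cr) hcr, hc⟩
          · rintro ⟨hA, -, h4⟩
            exact ⟨hA, h4⟩
        · exact old A' m h
      · rcases Set.mem_insert_iff.1 h with h | h
        · obtain ⟨rfl, hm⟩ := Prod.mk.inj h
          rcases hready.1 with h0 | h0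
          · omega
          · rw [← hm] at h0
            exact Set.mem_insert_of_mem _ h0
        · exact Set.mem_insert_of_mem _ (ih2 A' m h)
      · rw [Set.mem_union, ih3]
        constructor
        · rintro (⟨u, hu1, hu2, hu3⟩ | ⟨rfl, ho⟩)
          · exact ⟨u, hu1, Set.mem_insert_of_mem _ hu2, hu3⟩
          · exact ⟨tx, hcert, Set.mem_insert _ _, ho⟩
        · rintro ⟨u, hu1, hu2, hu3⟩
          rcases Set.mem_insert_iff.1 hu2 with h | h
          · obtain ⟨rfl, hm⟩ := Prod.mk.inj h
            rw [hm] at hu1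
            obtain rfl := hrun.certified_unique hn hf hu1 hcert
            exact .inr ⟨rfl, hu3⟩
          · exact .inl ⟨u, hu1, h, hu3⟩

theorem executed_of_le [Finite Val] (hrun : IsExecution P E run)
    (hn : 3 * P.f + 2 * P.p + 1 ≤ Nat.card Val) (hf : (E.honestᶜ).ncard ≤ P.f) {i : ℕ} {V : Val}
    {A : UA} {m m' : ℕ} (hm : m' ≤ m) (h : (A, m) ∈ ((run i).loc V).executed) :
    (A, m') ∈ ((run i).loc V).executed := by
  induction hm with
  | refl => exact h
  | step _ ih => exact ih ((hrun.executed_spec hn hf i V).2.1 _ _ h)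

/-- The execution preconditions carry over to a validator at which the same facts hold and which
has not yet executed this sequence number. -/
theorem ready_of_facts [Finite Val] (hrun : IsExecution P E run)
    (hn : 3 * P.f + 2 * P.p + 1 ≤ Nat.card Val) (hf : (E.honestᶜ).ncard ≤ P.f) {i j : ℕ}
    {U V : Val} (hsub : ∀ φ, ((run i).loc V).Holds φ → ((run j).loc U).Holds φ) {A : UA}
    {tx : Tx UA RA Obj Code} (hready : ((run i).loc V).Ready A tx)
    (hnew : (A, tx.sn) ∉ ((run j).loc U).executed) : ((run j).loc U).Ready A tx := by
  refine ⟨hready.1.imp_right fun h => hsub (.executed _) h, fun o ho => ?_⟩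
  obtain ⟨h1, h2⟩ := hready.2 ho
  refine ⟨hsub (.created _) h1, fun hc => h2 ?_⟩
  obtain ⟨u, hu1, hu2, hu3⟩ := ((hrun.executed_spec hn hf j U).2.2 A o).1 hc
  refine ((hrun.executed_spec hn hf i V).2.2 A o).2 ⟨u, hu1, ?_, hu3⟩
  -- `U` executes in order and has not reached `tx`, so `u` precedes `tx` and `V` executed it too
  have hlt : u.sn < tx.sn := by
    by_contra hge
    exact hnew (hrun.executed_of_le hn hf (not_lt.1 hge) hu2)
  rcases hready.1 with h0 | h0
  · omega
  · exact hrun.executed_of_le hn hf (by omega) h0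

end IsExecution

/-! ### Facts spread within one message delay -/

/-- At step `j` nothing is left to do, and all messages sent before step `i` have arrived. -/
structure CaughtUp (P : Params Val UA RA Obj Code State) (E : Scenario Val UA)
    (run : ℕ → Config Val UA RA Obj Code State) (i j : ℕ) : Prop where
  le : i ≤ j
  quiet : ∀ V ∈ E.honest, ∀ c', ¬ Act P E V (run j) c'
  delivered : ∀ U ∈ E.honest, ∀ V ∈ E.honest, ∀ m τ, (U, m, τ) ∈ (run i).sent →
    (U, m) ∈ (run j).inbox V

theorem CaughtUp.mono (hrun : IsExecution P E run) {i i' j : ℕ} (h : CaughtUp P E run i j)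
    (hi : i' ≤ i) : CaughtUp P E run i' j :=
  ⟨hi.trans h.le, h.quiet, fun U hU V hV m τ hm => h.delivered U hU V hV m τ ((hrun.le hi).sent hm)⟩

/-- Only a tick advances the clock, and a tick changes nothing else. -/
theorem Step.now_or (h : Step P E c c') : c'.now = c.now ∨
    (∀ V ∈ E.honest, ∀ c', ¬ Act P E V c c') ∧ ∃ t, c' = { c with now := t } := by
  rcases h with ⟨V, hV, _, h⟩ | ⟨_, h⟩ | ⟨t, ht, hq⟩
  · exact .inl h.now
  · left
    cases h
    case deliverTx V A tx _ _ _ _ => exact (receiveTx_rest V A tx).1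
    all_goals rfl
  · exact .inr ⟨hq, t, rfl⟩

namespace IsExecution

/-- Before time passes beyond one message delay, all validators have caught up: at the last step
before the clock exceeds `T + δ` only a tick is possible, and the messages that are due then have
been delivered. -/
theorem exists_caughtUp (hrun : IsExecution P E run) (hδ : 0 ≤ E.δ) {i : ℕ} {T : ℝ}
    (hT : E.GST ≤ T) (hi : (run i).now ≤ T) :
    ∃ j, CaughtUp P E run i j ∧ (run j).now ≤ T + E.δ := by
  have hex := hrun.diverges (T + E.δ)
  have hlt := Nat.find_spec hex
  have hmin := fun m (hm : m < Nat.find hex) => not_lt.1 (Nat.find_min hex hm)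
  generalize Nat.find hex = n at hlt hmin
  have hin : i < n := by
    by_contra hle
    have := (hrun.le (not_lt.1 hle)).now
    linarith
  obtain ⟨j, rfl⟩ : ∃ j, n = j + 1 := ⟨n - 1, by omega⟩
  have hj := hmin j (by omega)
  have hij : i ≤ j := by omega
  have htick : (∀ V ∈ E.honest, ∀ c', ¬ Act P E V (run j) c') ∧
      (run (j + 1)).inbox = (run j).inbox := by
    rcases (hrun.step j).now_or with h | ⟨hq, t, h⟩
    · rw [h] at hlt
      exact absurd hlt (not_lt.2 hj)
    · exact ⟨hq, by rw [h]⟩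
  refine ⟨j, ⟨hij, htick.1, fun U hU V hV m τ hm => ?_⟩, hj⟩
  rw [← htick.2]
  refine hrun.delivery (j + 1) U V m τ hU hV ((hrun.le (by omega)).sent hm) (lt_of_le_of_lt ?_ hlt)
  obtain ⟨-, i', hi', rfl, -⟩ := hrun.sent_spec hm
  have := (hrun.le hi'.le).now
  have : max (run i').now E.GST ≤ T := max_le (by linarith) hT
  linarith

theorem start_of_quiet {j : ℕ} {U : Val} {X : RA} {k : ℕ}
    (hquiet : ∀ c', ¬ Act P E U (run j) c') (hact : X ∈ ((run j).loc U).active)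
    (hprev : k = 0 ∨ (((run j).loc U).ra X).decided (k - 1) ≠ none) :
    (((run j).loc U).ra X).start k ≠ none := fun h => hquiet _ (.initiate X k hact h hprev)

theorem active_of_start (hrun : IsExecution P E run) {i : ℕ} {V : Val} {X : RA} {k : ℕ}
    (h : (((run i).loc V).ra X).start k ≠ none) : X ∈ ((run i).loc V).active := by
  obtain ⟨t, ht⟩ := Option.ne_none_iff_exists'.1 h
  obtain ⟨i', hi', -, hX, -⟩ := hrun.start_spec ht
  exact (hrun.loc_le hi'.le V).holds (.active X) hX

theorem start_of_facts (hrun : IsExecution P E run) {i j : ℕ} {U V : Val}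
    (hsub : ∀ φ, ((run i).loc V).Holds φ → ((run j).loc U).Holds φ)
    (hquiet : ∀ c', ¬ Act P E U (run j) c') {X : RA} {k : ℕ}
    (h : (((run i).loc V).ra X).start k ≠ none) : (((run j).loc U).ra X).start k ≠ none := by
  refine start_of_quiet hquiet (hsub (.active X) (hrun.active_of_start h)) ?_
  refine (hrun.pred_decided_of_start h).imp_right fun hd => ?_
  obtain ⟨⟨B, d⟩, hb⟩ := Option.ne_none_iff_exists'.1 hd
  obtain ⟨d', hd'⟩ := hsub (.decided X (k - 1) B) ⟨d, hb⟩
  rw [hd']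
  simp

/-- A validator that has caught up with a proof of decision has decided. -/
theorem decided_of_proof (hrun : IsExecution P E run) {i j : ℕ} (hc : CaughtUp P E run i j)
    {U V : Val} (hU : U ∈ E.honest) (hV : V ∈ E.honest) {X : RA} {k : ℕ}
    {B : Block UA RA Obj Code} {τ : ℝ} (hs : (V, .proof X k B, τ) ∈ (run i).sent)
    (hp : (run i).ValidProof E P X k B) (hstart : (((run j).loc U).ra X).start k ≠ none) :
    (((run j).loc U).ra X).decided k ≠ none := by
  intro hd
  exact hc.quiet U hU _ (.decide X k B ⟨hstart, hd⟩
    (.inr (.inl ⟨⟨V, hc.delivered V hV U hU _ _ hs⟩, hrun.validProof_mono hc.le hp⟩)))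

/-- What holds at some honest validator holds at every honest validator once it has caught up.  The
proof follows the steps by which the facts came about at `V`, and shows that `U`, having no action
left, has performed the corresponding ones. -/
theorem spread [Finite Val] (hrun : IsExecution P E run)
    (hn : 3 * P.f + 2 * P.p + 1 ≤ Nat.card Val) (hf : (E.honestᶜ).ncard ≤ P.f) {i j : ℕ}
    (hc : CaughtUp P E run i j) {U V : Val} (hU : U ∈ E.honest) (hV : V ∈ E.honest)
    (φ : Fact UA RA Obj Code) (h : ((run i).loc V).Holds φ) : ((run j).loc U).Holds φ := by
  induction i generalizing φ with
  | zero =>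
    have : ((run 0).loc U).Holds φ := by rw [hrun.init] at h ⊢; exact h
    exact (hrun.loc_le (Nat.zero_le j) U).holds φ this
  | succ i ih =>
    have hsub := ih (hc.mono hrun i.le_succ)
    have hquiet := hc.quiet U hU
    have hij : i ≤ j := i.le_succ.trans hc.le
    rcases (hrun.step i).holds_origin h with h | ⟨X, k, B, hin, hdec, hs, hφ⟩ |
      ⟨A, tx, cr, hA, he, hready, hφ⟩ | ⟨A, tx, hA, hpd, hver, hready, hφ⟩ | ⟨A, tx, hdec, hs, rfl⟩
    · exact hsub φ h
    · have hp := hrun.validProof_of_canDecide hdec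
      have hd := hrun.decided_of_proof hc hU hV hs (hrun.validProof_mono i.le_succ hp)
        (hrun.start_of_facts hsub hquiet hin.1)
      obtain ⟨⟨B', d⟩, hb⟩ := Option.ne_none_iff_exists'.1 hd
      obtain rfl := hrun.validProof_unique hn hf hp (hrun.validProof_of_decided hb)
      rcases hφ with hφ | rfl
      · exact hrun.holds_of_emits hn hf hin hb hφ
      · exact ⟨d, hb⟩
    · have he' : (tx, cr) ∈ ((run j).loc U).effects := hsub (.effect tx cr) he
      have hex : (A, tx.sn) ∈ ((run j).loc U).executed := by
        by_contra hnew
        exact hquiet _ (.finish A tx cr hA he' hnew (hrun.ready_of_facts hn hf hsub hready hnew))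
      obtain ⟨u, hu1, hu2, hu3⟩ := (hrun.executed_spec hn hf j U).1 A tx.sn hex
      obtain rfl := hrun.certified_unique hn hf hu2 (hrun.certified_of_effect hn hf hA he')
      rcases hφ with rfl | ⟨q, hq, rfl⟩
      · exact hex
      · rcases hu3 with ⟨-, cr', hcr', hc'⟩ | ⟨hu3, -⟩
        · rw [← (hrun.effects_spec hn hf j U).2 u cr cr' he' hcr'] at hc'
          exact hc' hq
        · exact absurd hu3.2 hA.2
    · have hpd' : ((run j).loc U).pobDecided A tx.sn = some tx := hsub (.pobDecided A tx.sn tx) hpd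
      have hex : (A, tx.sn) ∈ ((run j).loc U).executed := by
        by_contra hnew
        exact hquiet _ (.execUA A tx hA hpd' ((hrun.le hij).verify hver) hnew
          (hrun.ready_of_facts hn hf hsub hready hnew))
      obtain ⟨u, hu1, hu2, hu3⟩ := (hrun.executed_spec hn hf j U).1 A tx.sn hex
      obtain rfl := hrun.certified_unique hn hf hu2 (hrun.certified_of_pobDecided hpd')
      rcases hu3 with ⟨hu3, -⟩ | ⟨-, h1, h2⟩
      · exact absurd hA.2 hu3.2
      · rcases hφ with rfl | ⟨q, hq, rfl⟩ | ⟨Y, hY, rfl⟩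
        · exact hex
        · exact h1 hq
        · exact h2 hY
    · have hp := hrun.validPobProof_of_canPobDecide hdec
      rcases hd : ((run j).loc U).pobDecided A tx.sn with _ | u
      · exact absurd (.pobDecide A tx hd (.inr (.inl ⟨⟨V, hc.delivered V hV U hU _ _ hs⟩,
          hrun.validPobProof_mono hij hp⟩))) (hquiet _)
      · obtain rfl := hrun.certified_unique hn hf (hrun.certified_of_pobDecided hd)
          (hrun.certified_of_validPobProof hp)
        exact hd

/-! ### An instance with an honest leader -/

theorem start_unique (hrun : IsExecution P E run) {i j : ℕ} {V : Val} {X : RA} {k : ℕ} {s t : ℝ}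
    (h : (((run i).loc V).ra X).start k = some s) (h' : (((run j).loc V).ra X).start k = some t) :
    s = t := by
  have h1 := (hrun.loc_le (le_max_left i j) V).start _ _ _ h
  have h2 := (hrun.loc_le (le_max_right i j) V).start _ _ _ h'
  rw [h1] at h2
  exact Option.some.inj h2

/-- The step at which a validator starts an instance is unique. -/
theorem start_step_unique (hrun : IsExecution P E run) {i j : ℕ} {V : Val} {X : RA} {k : ℕ}
    {s t : ℝ} (h : (((run i).loc V).ra X).start k = none)
    (h1 : (((run (i + 1)).loc V).ra X).start k = some s)
    (h' : (((run j).loc V).ra X).start k = none)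
    (h1' : (((run (j + 1)).loc V).ra X).start k = some t) : i = j := by
  have key : ∀ {i j s}, (((run i).loc V).ra X).start k = none →
      (((run (j + 1)).loc V).ra X).start k = some s → i ≤ j := by
    intro i j s h h'
    by_contra hlt
    rw [(hrun.loc_le (show j + 1 ≤ i by omega) V).start _ _ _ h'] at h
    cases h
  exact le_antisymm (key h h1') (key h' h1)

theorem now_succ_of_start (hrun : IsExecution P E run) {i : ℕ} {V : Val} {X : RA} {k : ℕ}
    {s : ℝ} (h : (((run i).loc V).ra X).start k = none)
    (h1 : (((run (i + 1)).loc V).ra X).start k = some s) : (run (i + 1)).now = (run i).now := by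
  rcases (hrun.step i).now_or with h' | ⟨-, t, h'⟩
  · exact h'
  · rw [h'] at h1
    change (((run i).loc V).ra X).start k = some s at h1
    rw [h] at h1
    cases h1

/-- After GST all honest validators start an instance within one message delay. -/
theorem start_within [Finite Val] (hrun : IsExecution P E run)
    (hn : 3 * P.f + 2 * P.p + 1 ≤ Nat.card Val) (hf : (E.honestᶜ).ncard ≤ P.f) (hδ : 0 ≤ E.δ)
    {i : ℕ} {U V : Val} (hU : U ∈ E.honest) (hV : V ∈ E.honest) {X : RA} {k : ℕ} {s : ℝ}
    (h : (((run i).loc V).ra X).start k = some s) (hs : E.GST ≤ s) :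
    ∃ j t, (((run j).loc U).ra X).start k = some t ∧ t ≤ s + E.δ := by
  obtain ⟨i', -, hnow, -, h0, h1, -⟩ := hrun.start_spec h
  obtain ⟨j, hc, hj⟩ := hrun.exists_caughtUp hδ hs
    ((hrun.now_succ_of_start h0 h1).trans hnow.symm).le
  obtain ⟨t, ht⟩ := Option.ne_none_iff_exists'.1 (hrun.start_of_facts
    (hrun.spread hn hf hc hU hV) (hc.quiet U hU) (by rw [h1]; simp))
  obtain ⟨j', hj', rfl, -⟩ := hrun.start_spec ht
  exact ⟨j, _, ht, (hrun.le hj'.le).now.trans hj⟩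

/-- What the leader proposes is not yet executed by a validator that is still in the instance. -/
theorem notMem_done_of_proposed [Finite Val] (hrun : IsExecution P E run)
    (hn : 3 * P.f + 2 * P.p + 1 ≤ Nat.card Val) (hf : (E.honestᶜ).ncard ≤ P.f) {i j : ℕ}
    {L V : Val} {X : RA} {k : ℕ} (hprev : k = 0 ∨ (((run i).loc L).ra X).decided (k - 1) ≠ none)
    (hV : (((run j).loc V).ra X).decided k = none) {tx : Tx UA RA Obj Code}
    (htx : tx ∈ (((run i).loc L).ra X).pool) : tx ∉ (((run j).loc V).ra X).done := by
  intro hd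
  obtain ⟨m, C, d, hC, hm⟩ := hrun.mem_done_iff.1 hd
  have hlt : m < k := by
    by_contra hge
    exact hrun.decided_of_le (not_lt.1 hge) (by rw [hC]; simp) hV
  have hL : (((run i).loc L).ra X).decided m ≠ none := by
    rcases hprev with h0 | h0
    · omega
    · exact hrun.decided_of_le (by omega) h0
  obtain ⟨⟨C', d'⟩, hC'⟩ := Option.ne_none_iff_exists'.1 hL
  obtain rfl := hrun.decided_unique hn hf hC hC'
  exact hrun.notMem_done_of_mem_pool htx (hrun.mem_done_iff.2 ⟨m, C, d', hC', hm⟩)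

/-- A transaction of an honest user that is executed at a validator has been executed by its
recipient there. -/
theorem mem_done_of_executed [Finite Val] (hrun : IsExecution P E run)
    (hn : 3 * P.f + 2 * P.p + 1 ≤ Nat.card Val) (hf : (E.honestᶜ).ncard ≤ P.f) {i j : ℕ}
    {V : Val} {X : RA} {A : UA} {tx : Tx UA RA Obj Code} (hA : tx.IsUARA A)
    (hhon : A ∈ E.honestUser) (hX : tx.recipient = some X) (hver : (run i).Verify E tx)
    (hex : (A, tx.sn) ∈ ((run j).loc V).executed) : tx ∈ (((run j).loc V).ra X).done := by
  obtain ⟨u, hu1, hu2, hu3⟩ := (hrun.executed_spec hn hf j V).1 A tx.sn hex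
  obtain ⟨hi, -, m, hm⟩ := hrun.supported_spec hn hf (hrun.certified_supported hn hf hu2)
  obtain rfl := hrun.verify_unique hhon hm hver hi hA.1 hu1
  rcases hu3 with ⟨-, cr, hcr, -⟩ | ⟨h, -⟩
  · obtain ⟨-, Y, n, C, d, hC, hmem⟩ := (hrun.effects_spec hn hf j V).1 u cr hcr
    have hY := (hrun.validProof_spec hn hf (hrun.validProof_of_decided hC) hmem).1
    obtain rfl : X = Y := Option.some.inj (hX.symm.trans hY)
    exact hrun.mem_done_iff.2 ⟨n, C, d, hC, hmem⟩
  · exact absurd h.2 hA.2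

/-- Once a validator has caught up with the honest leader's proposal, it has decided or voted for
the proposal: it knows all RA-RA transactions of the proposal, and it can FP-lock the UA-RA
transactions because their issuers are honest and their preconditions held at the leader. -/
theorem decided_or_voted [Finite Val] (hrun : IsExecution P E run)
    (hn : 3 * P.f + 2 * P.p + 1 ≤ Nat.card Val) (hf : (E.honestᶜ).ncard ≤ P.f)
    (hδ : 0 ≤ E.δ) (hΔ : E.δ ≤ P.Δ) {i j : ℕ} {X : RA} {k : ℕ} (hL : P.leader X k ∈ E.honest)
    {tL : ℝ} (hnow : tL = (run i).now)
    (h0 : (((run i).loc (P.leader X k)).ra X).start k = none)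
    (h1 : (((run (i + 1)).loc (P.leader X k)).ra X).start k = some tL)
    (hprev : k = 0 ∨ (((run i).loc (P.leader X k)).ra X).decided (k - 1) ≠ none)
    (hsent : (P.leader X k, .propose X k (((run i).loc (P.leader X k)).ra X).pool, tL) ∈
      (run (i + 1)).sent)
    (hgood : ∀ tx ∈ (((run i).loc (P.leader X k)).ra X).pool, ∀ A, tx.IsUARA A →
      A ∈ E.honestUser)
    (hc : CaughtUp P E run (i + 1) j) (hj : (run j).now ≤ tL + E.δ) {V : Val}
    (hV : V ∈ E.honest) {s : ℝ} (hs : (((run j).loc V).ra X).start k = some s)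
    (hsL : tL ≤ s + E.δ) :
    (((run j).loc V).ra X).decided k ≠ none ∨
      ∃ fb τ, (V, .vote X k (some (((run i).loc (P.leader X k)).ra X).pool) fb, τ) ∈
        (run j).sent := by
  by_contra hcon
  rw [not_or, not_not] at hcon
  obtain ⟨hd, hvote⟩ := hcon
  set L := P.leader X k with hLdef
  set B := (((run i).loc L).ra X).pool with hB
  have hquiet := hc.quiet V hV
  have hij : i ≤ j := i.le_succ.trans hc.le
  have hsub : ∀ i' ≤ i, ∀ φ, ((run i').loc L).Holds φ → ((run j).loc V).Holds φ :=
    fun i' hi' => hrun.spread hn hf (hc.mono hrun (by omega)) hV hL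
  have hdone : ∀ tx ∈ B, tx ∉ (((run j).loc V).ra X).done := fun tx htx =>
    hrun.notMem_done_of_proposed hn hf hprev hd htx
  have hin : (run j).InInstance V X k := ⟨by rw [hs]; simp, hd⟩
  -- every proposal of the leader that `V` receives is `B`, and `V` receives it after step `i`
  have hprop : ∀ i' C, (L, Msg.propose X k C) ∈ (run i').inbox V → C = B ∧ i + 1 ≤ i' := by
    intro i' C hC
    obtain ⟨τ, hτ⟩ := hrun.inbox_spec hC hL
    obtain ⟨-, i'', hi'', -, -, hs0, hs1, rfl⟩ := hrun.sent_spec hτ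
    obtain rfl := hrun.start_step_unique h0 h1 hs0 hs1
    exact ⟨rfl, by omega⟩
  have hfpB : ∀ i' C t, (((run i').loc V).ra X).fp k = some (C, t) →
      C = B ∧ i + 1 ≤ i' ∧ tL ≤ t := by
    intro i' C t hfp
    obtain ⟨-, i'', hi'', ht, hC⟩ := hrun.fp_spec hfp
    obtain ⟨h2, h3⟩ := hprop i'' C hC
    have := (hrun.le (show i ≤ i'' by omega)).now
    exact ⟨h2, by omega, by rw [hnow]; exact this.trans ht.ge⟩
  -- `V` has requested the FP-locks for `B`
  obtain ⟨t, hfp, ht⟩ : ∃ t, (((run j).loc V).ra X).fp k = some (B, t) ∧ tL ≤ t := by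
    rcases hfp : (((run j).loc V).ra X).fp k with _ | ⟨C, t⟩
    · refine absurd (.fpBegin X k B hin ?_ hfp ?_ ?_ ?_) (hquiet _)
      · rintro ⟨t, ht, hlt⟩
        obtain rfl := Option.some.inj (hs.symm.trans ht)
        linarith
      · exact hc.delivered L hL V hV _ _ hsent
      · exact fun tx htx => (hrun.pool_spec htx).1
      · intro tx htx hrara
        have hX := (hrun.pool_spec htx).1
        obtain ⟨-, Y, hY, h⟩ := hsub i le_rfl (.arrived tx) ⟨hrara, X, hX, .inl htx⟩
        obtain rfl : X = Y := Option.some.inj (hX.symm.trans hY)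
        exact h.resolve_right (hdone tx htx)
    · obtain ⟨rfl, -, ht⟩ := hfpB j C t hfp
      exact ⟨t, rfl, ht⟩
  -- all requests are granted
  have hrep : ∀ tx ∈ B, ∀ A, tx.IsUARA A → (((run j).loc V).ra X).fpReply k tx = some true := by
    intro tx htx A hA
    have hhon := hgood tx htx A hA
    obtain ⟨hX, hpool⟩ := hrun.pool_spec htx
    obtain ⟨A', hA', hlock, i₀, hi₀, hready⟩ := hpool.resolve_left (by simp [Tx.IsRARA, hA.1])
    obtain rfl := hA.unique hA'
    have hver := (hrun.fpLock_spec hlock).2.2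
    have hnoconf : ∀ i' u, ((run i').loc V).fpLock A tx.sn = some u → u = tx := by
      intro i' u hu
      obtain ⟨hu1, hu2, hu3⟩ := hrun.fpLock_spec hu
      exact hrun.verify_unique hhon hu3 hver hu1 hA.1 hu2
    have hready' : ((run j).loc V).Ready A tx :=
      hrun.ready_of_facts hn hf (hsub i₀ hi₀) hready fun hex =>
        hdone tx htx (hrun.mem_done_of_executed hn hf hA hhon hX hver hex)
    have hverj := (hrun.le hij).verify hver
    rcases hr : (((run j).loc V).ra X).fpReply k tx with _ | _ | _
    · rcases hl : ((run j).loc V).fpLock A tx.sn with _ | u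
      · exact absurd (.fpLock X k B t A tx hfp htx hA hr hverj hl) (hquiet _)
      · obtain rfl := hnoconf j u hl
        exact absurd (.fpSuccess X k B t A u hfp htx hA hr hverj hl hready' (by linarith))
          (hquiet _)
    · exfalso
      obtain ⟨i', hi', C, t', A', hfp', -, hA', -, hbad⟩ := hrun.fpReply_spec hr
      obtain rfl := hA.unique hA'
      obtain ⟨-, hle, ht'⟩ := hfpB i' C t' hfp'
      rcases hbad rfl with h | ⟨u, hu, hne⟩ | h
      · exact h ((hrun.le (show i ≤ i' by omega)).verify hver)
      · exact hne (hnoconf i' u hu)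
      · have := (hrun.le hi'.le).now
        linarith
    · rfl
  by_cases hvd : k ∈ (((run j).loc V).ra X).voted
  · obtain ⟨v, fb, τ, hv⟩ := hrun.vote_of_voted hvd
    obtain ⟨C, t', hfp', -, hvC⟩ := hrun.vote_spec hv
    rw [hfp] at hfp'
    obtain ⟨rfl, rfl⟩ := Prod.mk.inj (Option.some.inj hfp')
    rw [if_pos hrep] at hvC
    exact hvote ⟨fb, τ, hvC ▸ hv⟩
  · exact hquiet _ (.vote X k B t hin hfp (fun tx htx A hA => by rw [hrep tx htx A hA]; simp) hvd)

/-- An honest validator that has decided before its timer runs out stays off the slow path. -/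
theorem qcProposed_notMem (hrun : IsExecution P E run) {j : ℕ} {V : Val} {X : RA} {k : ℕ} {s : ℝ}
    (hs : (((run j).loc V).ra X).start k = some s)
    (hd : (((run j).loc V).ra X).decided k ≠ none) (hj : (run j).now ≤ s + 3 * P.Δ) (i : ℕ)
    (D : Block UA RA Obj Code) : (V, X, k, D) ∉ (run i).qcProposed := by
  have hslow : ∀ i, (run i).InInstance V X k → ¬ (run i).TimerExpired P V X k := by
    rintro i hin ⟨t, ht, hlt⟩
    obtain rfl := hrun.start_unique hs ht
    rcases le_total i j with h | h
    · have := (hrun.le h).now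
      linarith
    · obtain ⟨b, hb⟩ := Option.ne_none_iff_exists'.1 hd
      have := (hrun.loc_le h V).decided _ _ _ hb
      rw [hin.2] at this
      cases this
  have hcand : ∀ {i D}, (((run i).loc V).ra X).cand k ≠ some D := fun h => by
    obtain ⟨i', -, hin, ht, -⟩ := hrun.cand_spec h
    exact hslow i' hin ht
  intro h
  obtain ⟨i', h | ⟨C, hC, -⟩⟩ := hrun.qcProposed_spec h
  · exact hcand h
  · obtain ⟨i₁, hneed, -⟩ := hrun.cand₂_spec hC
    obtain ⟨i₂, -, hin, ⟨ht, -⟩ | ⟨B, hB, -⟩⟩ := hrun.needFallback_spec hneed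
    · exact hslow i₂ hin ht
    · exact hcand hB

end IsExecution

end Model

end Mangrove

theorem mainTheorem5 {Val UA RA Obj Code State : Type*} [Finite Val]
    (P : Mangrove.Params Val UA RA Obj Code State) (E : Mangrove.Scenario Val UA)
    (hn : 3 * P.f + 2 * P.p + 1 ≤ Nat.card Val)
    (hf : (E.honestᶜ).ncard ≤ P.f)
    (hδ : 0 ≤ E.δ) (hΔ : E.δ ≤ P.Δ)
    (run : ℕ → Mangrove.Config Val UA RA Obj Code State)
    (hrun : Mangrove.IsExecution P E run)
    (X : RA) (k : ℕ)
    -- the leader is honest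
    (hL : P.leader X k ∈ E.honest)
    -- at most `p` validators misbehave
    (hp : (E.honestᶜ).ncard ≤ P.p)
    -- the instance takes place after GST
    (hstarted : ∃ V ∈ E.honest, ∃ s, Mangrove.StartsAt run V X k s)
    (hGST : ∀ V ∈ E.honest, ∀ s, Mangrove.StartsAt run V X k s → E.GST ≤ s)
    -- good pool
    (hpool : Mangrove.GoodPool E run (P.leader X k) X k) :
    ∃ tL, Mangrove.StartsAt run (P.leader X k) X k tL ∧
      ∀ V ∈ E.honest, ∃ s B d, Mangrove.StartsAt run V X k s ∧
        Mangrove.DecidesAt run V X k B d ∧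
        d ≤ tL + 2 * E.δ ∧ d ≤ s + 3 * E.δ ∧ Mangrove.StopsAt run V X k d := by
  obtain ⟨V₀, hV₀, s₀, i₀, hi₀⟩ := hstarted
  obtain ⟨jL, tL, htL, -⟩ := hrun.start_within hn hf hδ hL hV₀ hi₀ (hGST V₀ hV₀ s₀ ⟨i₀, hi₀⟩)
  have hTL : E.GST ≤ tL := hGST _ hL tL ⟨jL, htL⟩
  obtain ⟨i, -, hnow, -, h0, h1, hprev, hsent⟩ := hrun.start_spec htL
  -- by `tL + δ` all have caught up with the start of the leader
  obtain ⟨j₁, hc₁, hj₁⟩ := hrun.exists_caughtUp hδ hTL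
    ((hrun.now_succ_of_start h0 h1).trans hnow.symm).le
  have hstart : ∀ V ∈ E.honest, ∃ s, (((run j₁).loc V).ra X).start k = some s ∧ tL ≤ s + E.δ := by
    intro V hV
    obtain ⟨s, hs⟩ := Option.ne_none_iff_exists'.1 (hrun.start_of_facts
      (hrun.spread hn hf hc₁ hV hL) (hc₁.quiet V hV) (by rw [h1]; simp))
    obtain ⟨j, t, ht, hle⟩ := hrun.start_within hn hf hδ hL hV hs (hGST V hV s ⟨j₁, hs⟩)
    exact ⟨s, hs, by rwa [hrun.start_unique htL ht]⟩
  have hvote := fun V hV s hs hle => hrun.decided_or_voted hn hf hδ hΔ hL hnow h0 h1 hprev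
    (hsent rfl) (hpool i h0 (by rw [h1]; simp)) hc₁ hj₁ (V := V) hV (s := s) hs hle
  obtain ⟨j₂, hc₂, hj₂⟩ := hrun.exists_caughtUp (T := tL + E.δ) hδ (by linarith) hj₁
  -- at `j₂` a proof of decision or the votes of all honest validators have arrived
  have hdec : ∀ V ∈ E.honest, (((run j₂).loc V).ra X).decided k ≠ none := by
    intro V hV
    obtain ⟨s, hs, -⟩ := hstart V hV
    have hs₂ := (hrun.loc_le hc₂.le V).start _ _ _ hs
    by_cases hW : ∃ W ∈ E.honest, (((run j₁).loc W).ra X).decided k ≠ none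
    · obtain ⟨W, hW, hd⟩ := hW
      obtain ⟨⟨B, d⟩, hb⟩ := Option.ne_none_iff_exists'.1 hd
      obtain ⟨i', hi', -, -, -, -, hproof⟩ := hrun.decided_spec hb
      exact hrun.decided_of_proof hc₂ hV hW ((hrun.le hi').sent hproof)
        (hrun.validProof_of_decided hb) (by rw [hs₂]; simp)
    · push Not at hW
      intro hd
      refine hc₂.quiet V hV _ (.decide X k (((run i).loc (P.leader X k)).ra X).pool
        ⟨by rw [hs₂]; simp, hd⟩ (.inl ?_))
      have hsub : E.honest ⊆ (run j₂).votersFor V X k (((run i).loc (P.leader X k)).ra X).pool := by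
        intro U hU
        obtain ⟨t, ht, hle⟩ := hstart U hU
        obtain ⟨fb, τ, hv⟩ := (hvote U hU t ht hle).resolve_left (by rw [hW U hU]; simp)
        exact ⟨fb, hc₂.delivered U hU V hV _ _ hv⟩
      -- all honest validators voted, and at most `p` are not honest
      have := Set.ncard_le_ncard hsub (Set.toFinite _)
      have := Set.ncard_add_ncard_compl E.honest
      omega
  have hslow : ∀ V ∈ E.honest, ∀ i' D, (V, X, k, D) ∉ (run i').qcProposed := by
    intro V hV
    obtain ⟨s, hs, hle⟩ := hstart V hV
    exact hrun.qcProposed_notMem ((hrun.loc_le hc₂.le V).start _ _ _ hs) (hdec V hV) (by linarith)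
  refine ⟨tL, ⟨jL, htL⟩, fun V hV => ?_⟩
  obtain ⟨s, hs, hle⟩ := hstart V hV
  obtain ⟨⟨B, d⟩, hb⟩ := Option.ne_none_iff_exists'.1 (hdec V hV)
  have hd : d ≤ tL + 2 * E.δ := by
    obtain ⟨i', hi', -, -, rfl, -⟩ := hrun.decided_spec hb
    have := (hrun.le hi'.le).now
    linarith
  refine ⟨s, B, d, ⟨j₁, hs⟩, ⟨j₂, hb⟩, hd, by linarith,
    fun i' m τ hm hof => hrun.sent_le_decided hb hm hof, hslow V hV, fun i' tx htx => ?_⟩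
  -- Transaction Agreement is requested for decisions of Quorum Consensus, to which nobody proposed
  obtain ⟨i'', C, hC, hmem⟩ := hrun.taAsked_spec htx
  obtain ⟨W, hW, j, D, hD, -⟩ := hrun.qcCert_proposed hn hC hmem
  exact hslow W hW j D hD
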